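/- Let $K$ be a $p$-adic field (a finite extension of some $\mathbb{Q}_p$) with valuation ring $R_K$, maximal ideal $P_K$, residue field of cardinality $q$, and a fixed uniformizer $\pi$; put $|x|_K=q^{-\mathrm{ord}(x)}$ and $\mathrm{ac}\,x=x\pi^{-\mathrm{ord}(x)}$. Let $\Psi$ be a standard additive character of $K$, i.e. $\Psi$ is trivial on $R_K$ but not on $P_K^{-1}=\pi^{-1}R_K$. Let $2\le l\le n$, and let $f_1,\dots,f_l$ be $K$-analytic functions on an open neighborhood $U\subseteq K^n$ of the origin, each given by one power series in $x_1,\dots,x_n$ convergent on $U$, with $f_i(0)=0$. For $f=\sum_m c_mx^m$ let $\Gamma(f)$ be the convex hull of $\bigcup_{c_m\neq 0}(m+\mathbb{R}_{+}^n)$, and for $a\in\mathbb{R}^n$ with all $a_k>0$ let $f_a=\sum_m c_mx^m$, the sum being over those $m\in\Gamma(f)$ at which $\langle a,\cdot\rangle$ attains its minimum on $\Gamma(f)$. Assume that (a) each $f_i$ is convenient: for every $k$ some monomial $x_k^{N}$ has a nonzero coefficient in $f_i$; (b) for $j=l-1$ and $j=l$, the map $(f_1,\dots,f_j)$ is non-degenerate: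 for every $a\in\mathbb{R}^n$ with all $a_k>0$ and every $z\in U\cap(K^\times)^n$ with $f_{1,a}(z)=\dots=f_{j,a}(z)=0$, the matrix $\left[\partial f_{i,a}/\partial x_k(z)\right]_{i\le j,\,k\le n}$ has rank $\min\{j,n\}$; (c) $V^{(l-1)}=\{x\in U: f_1(x)=\dots=f_{l-1}(x)=0\}$ is a closed submanifold of $U$, in the sense that $\left[\partial f_i/\partial x_k(z)\right]_{i\le l-1,\,k\le n}$ has rank $l-1$ at each $z\in V^{(l-1)}$; (d) the form $df_1\wedge\dots\wedge df_l$ does not vanish at any point of $\{z\in U: f_1(z)=\dots=f_{l-1}(z)=0,\ f_l(z)=\lambda\}$, for any $\lambda\in K^\times$; and that $U$ is sufficiently small (how small depending on $f_1,\dots,f_l$ only). Let $\Phi:K^n\to\mathbb{C}$ be a Bruhat-Schwartz function (locally constant with compact support) whose support is contained in $U$. Let $|\gamma_{GL}|$ be the measure induced on $V^{(l-1)}$ by a Gel'fand-Leray form, i.e. a form $\gamma_{GL}$ with $\gamma_{GL}\wedge\bigwedge_{i=1}^{l-1}df_i=\bigwedge_{k=1}^{n}dx_k$. For a (continuous) character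 $\chi$ of $R_K^\times$ and $z\in K$ put $$Z_\Phi(s,\chi)=\int_{V^{(l-1)}}\Phi(x)\,\chi(\mathrm{ac}\,f_l(x))\,|f_l(x)|_K^{s}\,|\gamma_{GL}(x)|,\qquad E_\Phi(z)=\int_{V^{(l-1)}}\Phi(x)\,\Psi(zf_l(x))\,|\gamma_{GL}(x)|,$$ where the integrand of $Z_\Phi$ is taken to be $0$ where $f_l=0$. Both integrals converge absolutely, that of $Z_\Phi(s,\chi)$ for $\mathrm{Re}(s)\ge 0$, and $Z_\Phi(0,\chi_{\mathrm{triv}})$ is the limit of $Z_\Phi(s,\chi_{\mathrm{triv}})$ as $s\to 0$ in $\mathrm{Re}(s)>0$. As functions on $\mathrm{Re}(s)>0$, each $Z_\Phi(s,\chi)$, and also $\frac{(t-q)Z_\Phi(s,\chi_{\mathrm{triv}})}{(q-1)(1-t)}$, has an expansion $\sum_{k}c_kt^k$ in $t=q^{-s}$, $0<|t|<1$, with at most finitely many terms of negative degree; write $\mathrm{Coeff}_{t^k}$ for its coefficient $c_k$. Then for all $u\in R_K^\times$ and $m\in\mathbb{Z}$, $$E_\Phi(u\pi^{-m})=Z_\Phi(0,\chi_{\mathrm{triv}})+\mathrm{Coeff}_{t^{m-1}}\frac{(t-q)Z_\Phi(s,\chi_{\mathrm{triv}})}{(q-1)(1-t)}+\sum_{\chi\neq\chi_{\mathrm{triv}}}g_{\chi^{-1}}\,\chi(u)\,\mathrm{Coeff}_{t^{m-c(\chi)}}Z_\Phi(s,\chi),$$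 where the sum has only finitely many nonzero terms, $c(\chi)$ is the conductor of $\chi$ (the least $c\ge 1$ such that $\chi$ is trivial on $1+P_K^{c}$), and $$g_\chi=(q-1)^{-1}q^{1-c(\chi)}\sum_{v\in(R_K/P_K^{c(\chi)})^\times}\chi(v)\,\Psi\!\left(v/\pi^{c(\chi)}\right).$$ -/

import Mathlib

open MeasureTheory Filter
open scoped Topology

namespace LocalZeta

/-! ### `p`-adic fields -/

/-- A `p`-adic field: a finite extension of `ℚ_[p]` for some prime `p`. The norm of `K` is a
multiplicative norm extending the `p`-adic absolute value, hence the unique such extension. -/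
class IsPAdicField (K : Type*) [NontriviallyNormedField K] : Prop where
  exists_padic : ∃ (p : ℕ) (_ : Fact p.Prime) (_ : NormedAlgebra ℚ_[p] K),
    FiniteDimensional ℚ_[p] K

instance isUltrametricDist_of_isPAdicField (K : Type*) [NontriviallyNormedField K]
    [h : IsPAdicField K] : IsUltrametricDist K := by
  obtain ⟨p, _, _, _⟩ := h.exists_padic
  exact IsUltrametricDist.of_normedAlgebra ℚ_[p]

instance properSpace_of_isPAdicField (K : Type*) [NontriviallyNormedField K]
    [h : IsPAdicField K] : ProperSpace K := by
  obtain ⟨p, _, _, _⟩ := h.exists_padic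
  exact FiniteDimensional.proper ℚ_[p] K

noncomputable section

section Field

variable (K : Type*) [NontriviallyNormedField K] [IsPAdicField K]

/-- The valuation ring `R_K = {x | ‖x‖ ≤ 1}`. -/
abbrev RK : ValuationSubring K := (NormedField.valuation (K := K)).valuationSubring

/-- The cardinality `q` of the residue field of `K`. -/
def resCard : ℕ := Nat.card (IsLocalRing.ResidueField (RK K))

/-- The Haar measure of `K`, normalized so that `R_K` has measure one. -/
def haarK [MeasurableSpace K] [BorelSpace K] : Measure K :=
  Measure.addHaarMeasure
    ⟨⟨Metric.closedBall (0 : K) 1, isCompact_closedBall 0 1⟩,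
      ⟨0, mem_interior_iff_mem_nhds.mpr (Metric.closedBall_mem_nhds (0 : K) one_pos)⟩⟩

variable {K}

/-- The order of `x ≠ 0` (with respect to the uniformizer `ϖ`): the unique integer `k` with
`‖x‖ = ‖ϖ‖ ^ k`. -/
def ordK (ϖ : RK K) (x : K) : ℤ := Classical.epsilon fun k : ℤ => ‖x‖ = ‖(ϖ : K)‖ ^ k

open Classical in
/-- The normalized absolute value `|x|_K = q ^ (-ord x)`, `|0|_K = 0`. -/
def absK (ϖ : RK K) (x : K) : ℝ := if x = 0 then 0 else (resCard K : ℝ) ^ (-ordK ϖ x)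

/-- The angular component `ac x = x ϖ ^ (-ord x)`, with `ac 0 = 0`. -/
def acK (ϖ : RK K) (x : K) : K := x * (ϖ : K) ^ (-ordK ϖ x)

/-- An element of norm one, as a unit of `R_K`. -/
def toUnit (y : K) (h : ‖y‖ = 1) : (RK K)ˣ where
  val := ⟨y, by
    rw [Valuation.mem_valuationSubring_iff, NormedField.valuation_apply, ← NNReal.coe_le_coe]
    simp [h]⟩
  inv := ⟨y⁻¹, by
    rw [Valuation.mem_valuationSubring_iff, NormedField.valuation_apply, ← NNReal.coe_le_coe]
    simp [h]⟩
  val_inv := by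
    have : y ≠ 0 := by rintro rfl; simp at h
    ext; simp [this]
  inv_val := by
    have : y ≠ 0 := by rintro rfl; simp at h
    ext; simp [this]

/-! ### Characters, conductors and Gaussian sums -/

variable (K) in
/-- The characters of `R_K^×`. The trivial one is `1`, and `χ⁻¹` is the inverse character. -/
abbrev UnitChar : Type _ := (RK K)ˣ →ₜ* Circle

open Classical in
/-- The value of a character of `R_K^×` at `y ∈ R_K^×`, extended by zero to `K`. -/
def charVal (χ : UnitChar K) (y : K) : ℂ :=
  if h : ‖y‖ = 1 then (χ (toUnit y h) : ℂ) else 0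

/-- The conductor `c(χ)`: the least `c ≥ 1` such that `χ` is trivial on `1 + P_K ^ c`. -/
def charConductor (χ : UnitChar K) : ℕ :=
  sInf {c : ℕ | 1 ≤ c ∧
    ∀ v : (RK K)ˣ, (v : RK K) - 1 ∈ (IsLocalRing.maximalIdeal (RK K)) ^ c → χ v = 1}

/-- `Ψ` is a standard additive character: trivial on `R_K`, but not on `P_K⁻¹ = ϖ⁻¹ R_K`. -/
def IsStandardAddChar (ϖ : RK K) (Ψ : AddChar K Circle) : Prop :=
  (∀ x : K, ‖x‖ ≤ 1 → Ψ x = 1) ∧ ∃ x : K, ‖(ϖ : K) * x‖ ≤ 1 ∧ Ψ x ≠ 1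

/-- The Gaussian sum
`g_χ = (q - 1)⁻¹ q ^ (1 - c(χ)) ∑_{v ∈ (R_K / P_K ^ c(χ))^×} χ(v) Ψ(v / ϖ ^ c(χ))`; each class `v`
is evaluated at a representative. -/
def gaussianSum (ϖ : RK K) (Ψ : AddChar K Circle) (χ : UnitChar K) : ℂ :=
  ((resCard K : ℂ) - 1)⁻¹ * (resCard K : ℂ) ^ (1 - (charConductor χ : ℤ)) *
    ∑ᶠ v : (RK K ⧸ (IsLocalRing.maximalIdeal (RK K)) ^ charConductor χ)ˣ,
      charVal χ ((Quotient.out (v : RK K ⧸ (IsLocalRing.maximalIdeal (RK K)) ^ charConductor χ) :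
        RK K) : K) *
      (Ψ (((Quotient.out (v : RK K ⧸ (IsLocalRing.maximalIdeal (RK K)) ^ charConductor χ) :
        RK K) : K) / (ϖ : K) ^ charConductor χ) : ℂ)

/-- The quasicharacter `ω(x) = χ(ac x) |x|_K ^ s` of `K^×`, extended by `ω(0) = 0`. -/
def quasiChar (ϖ : RK K) (χ : UnitChar K) (s : ℂ) (x : K) : ℂ :=
  charVal χ (acK ϖ x) * (absK ϖ x : ℂ) ^ s

/-! ### Power series, Newton polyhedra, non-degeneracy -/

variable {n : ℕ}

/-- The sum at `x` of the power series `f`. -/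
def evalSeries (f : MvPowerSeries (Fin n) K) (x : Fin n → K) : K :=
  ∑' m : Fin n →₀ ℕ, MvPowerSeries.coeff m f * ∏ i, x i ^ m i

/-- The power series `f` converges at every point of `U`. -/
def ConvergesOn (f : MvPowerSeries (Fin n) K) (U : Set (Fin n → K)) : Prop :=
  ∀ x ∈ U, Summable fun m : Fin n →₀ ℕ => MvPowerSeries.coeff m f * ∏ i, x i ^ m i

/-- The Jacobian matrix `[∂g_i/∂x_j (x)]`. -/
def jacobian {r : ℕ} (g : Fin r → (Fin n → K) → K) (x : Fin n → K) : Matrix (Fin r) (Fin n) K :=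
  Matrix.of fun i j => fderiv K (g i) x (Pi.single j 1)

/-- The Newton polyhedron `Γ(f)` at the origin: the convex hull of `⋃_{m ∈ supp f} (m + ℝ₊ⁿ)`. -/
def newtonPolyhedron (f : MvPowerSeries (Fin n) K) : Set (Fin n → ℝ) :=
  convexHull ℝ {y | ∃ m : Fin n →₀ ℕ, MvPowerSeries.coeff m f ≠ 0 ∧ ∀ i, (m i : ℝ) ≤ y i}

/-- The first meet locus `F(a, Γ)`: the points of `Γ` at which `⟨a, ·⟩` is minimal on `Γ`. -/
def firstMeetLocus (a : Fin n → ℝ) (Γ : Set (Fin n → ℝ)) : Set (Fin n → ℝ) :=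
  {x | x ∈ Γ ∧ ∀ y ∈ Γ, a ⬝ᵥ x ≤ a ⬝ᵥ y}

open Classical in
/-- The face function `f_a = ∑_{m ∈ F(a, Γ(f))} c_m x^m` of `f = ∑_m c_m x^m`. -/
def faceFunction (f : MvPowerSeries (Fin n) K) (a : Fin n → ℝ) : MvPowerSeries (Fin n) K :=
  fun m => if (fun i => (m i : ℝ)) ∈ firstMeetLocus a (newtonPolyhedron f)
    then MvPowerSeries.coeff m f else 0

/-- `(f_1, …, f_j)` is non-degenerate on `U` with respect to `(Γ(f_1), …, Γ(f_j))` at the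
origin. -/
def NonDegenerate {j : ℕ} (f : Fin j → MvPowerSeries (Fin n) K) (U : Set (Fin n → K)) : Prop :=
  ∀ a : Fin n → ℝ, (∀ i, 0 < a i) → ∀ z ∈ U, (∀ i, z i ≠ 0) →
    (∀ i, evalSeries (faceFunction (f i) a) z = 0) →
    (jacobian (fun i => evalSeries (faceFunction (f i) a)) z).rank = min j n

/-- `f` is convenient: for every `k` some power of `x_k` occurs in `f`. -/
def Convenient (f : MvPowerSeries (Fin n) K) : Prop :=
  ∀ k : Fin n, ∃ N : ℕ, MvPowerSeries.coeff (Finsupp.single k N) f ≠ 0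

/-! ### The measure induced by a Gel'fand-Leray form -/

/-- The common zeros in `U` of `g_1, …, g_r`. -/
def zeroSet {r : ℕ} (U : Set (Fin n → K)) (g : Fin r → (Fin n → K) → K) : Set (Fin n → K) :=
  {x | x ∈ U ∧ ∀ i, g i x = 0}

/-- The minor of the Jacobian matrix of `g` on the columns `e(1) < … < e(r)`. -/
def minorDet {r : ℕ} (g : Fin r → (Fin n → K) → K) (e : Fin r ↪o Fin n) (x : Fin n → K) : K :=
  ((jacobian g x).submatrix id e).det

/-- The projection of `Kⁿ` to the coordinates that are not among `e(1), …, e(r)`. -/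
def projCompl {r : ℕ} (e : Fin r ↪o Fin n) (x : Fin n → K) : {j : Fin n // j ∉ Set.range e} → K :=
  fun j => x j

/-- `A ⊆ V` is a measurable set on which the coordinates `x_j`, `j ∉ {e(1), …, e(r)}`, are local
coordinates of `V = {g_1 = … = g_r = 0}` that separate points, the minor of `e` being nonzero and
of largest absolute value among all minors. Around each point at which the Jacobian matrix has
rank `r`, the set `V` is covered by finitely many such sets, with various `e`. -/
def IsChartDomain [MeasurableSpace K] {r : ℕ} (g : Fin r → (Fin n → K) → K)
    (V : Set (Fin n → K)) (e : Fin r ↪o Fin n) (A : Set (Fin n → K)) : Prop :=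
  MeasurableSet A ∧ A ⊆ V ∧ Set.InjOn (projCompl e) A ∧
    ∀ x ∈ A, minorDet g e x ≠ 0 ∧ ∀ e' : Fin r ↪o Fin n, ‖minorDet g e' x‖ ≤ ‖minorDet g e x‖

/-- The measure on a chart domain `A` given there by the form `γ` with
`γ ∧ dg_1 ∧ … ∧ dg_r = dx_1 ∧ … ∧ dx_n`: up to sign, `γ` restricts to
`(minor of e)⁻¹ ⋀_{j ∉ {e(1), …, e(r)}} dx_j`. -/
def chartMeasure [MeasurableSpace K] [BorelSpace K] (ϖ : RK K) {r : ℕ}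
    (g : Fin r → (Fin n → K) → K) (e : Fin r ↪o Fin n) (A : Set (Fin n → K)) :
    Measure (Fin n → K) :=
  ((Measure.comap (fun x : A => projCompl e (x : Fin n → K)) (Measure.pi fun _ => haarK K)).map
    Subtype.val).withDensity fun x => ENNReal.ofReal (absK ϖ (minorDet g e x))⁻¹

/-- The measure `|γ_GL|` on `V = {g_1 = … = g_r = 0}`, as a measure on `Kⁿ` carried by `V`. By the
change of variables formula the chart measures agree wherever two chart domains overlap, so that
their least upper bound is the measure which restricts to the chart measure on each of them. -/
def gelfandLeray [MeasurableSpace K] [BorelSpace K] (ϖ : RK K) {r : ℕ}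
    (g : Fin r → (Fin n → K) → K) (V : Set (Fin n → K)) : Measure (Fin n → K) :=
  ⨆ (e : Fin r ↪o Fin n) (A : Set (Fin n → K)) (_ : IsChartDomain g V e A), chartMeasure ϖ g e A

/-! ### Zeta functions, oscillatory integrals, expansions in `t = q ^ (-s)` -/

/-- A Bruhat-Schwartz function on `Kⁿ`. -/
def IsBruhatSchwartz (Φ : (Fin n → K) → ℂ) : Prop :=
  IsLocallyConstant Φ ∧ HasCompactSupport Φ

/-- The analytic map `(f_1, …, f_j)` given by power series. -/
def evalMap {j : ℕ} (f : Fin j → MvPowerSeries (Fin n) K) : Fin j → (Fin n → K) → K :=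
  fun i => evalSeries (f i)

/-- All but the last one of `f_1, …, f_l`, `l = r + 1`. -/
def butLast {r : ℕ} (f : Fin (r + 1) → MvPowerSeries (Fin n) K) :
    Fin r → MvPowerSeries (Fin n) K :=
  fun i => f i.castSucc

/-- The analytic function `f_l`, the last one of `f_1, …, f_l`, `l = r + 1`. -/
def lastFun {r : ℕ} (f : Fin (r + 1) → MvPowerSeries (Fin n) K) : (Fin n → K) → K :=
  evalSeries (f (Fin.last r))

/-- The measure `|γ_GL|` on `V^(l-1) = {x ∈ U | f_1(x) = … = f_{l-1}(x) = 0}`, `l = r + 1`. -/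
def glMeasure [MeasurableSpace K] [BorelSpace K] (ϖ : RK K) (U : Set (Fin n → K)) {r : ℕ}
    (f : Fin (r + 1) → MvPowerSeries (Fin n) K) : Measure (Fin n → K) :=
  gelfandLeray ϖ (evalMap (butLast f)) (zeroSet U (evalMap (butLast f)))

/-- `Z_Φ(s, χ) = ∫_{V^(l-1)} Φ(x) χ(ac f_l(x)) |f_l(x)|_K ^ s |γ_GL(x)|`. -/
def zetaInt [MeasurableSpace K] [BorelSpace K] (ϖ : RK K) (U : Set (Fin n → K)) {r : ℕ}
    (f : Fin (r + 1) → MvPowerSeries (Fin n) K) (Φ : (Fin n → K) → ℂ)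
    (χ : UnitChar K) (s : ℂ) : ℂ :=
  ∫ x, Φ x * quasiChar ϖ χ s (lastFun f x) ∂(glMeasure ϖ U f)

/-- `E_Φ(z) = ∫_{V^(l-1)} Φ(x) Ψ(z f_l(x)) |γ_GL(x)|`. -/
def oscInt [MeasurableSpace K] [BorelSpace K] (ϖ : RK K) (Ψ : AddChar K Circle)
    (U : Set (Fin n → K)) {r : ℕ} (f : Fin (r + 1) → MvPowerSeries (Fin n) K)
    (Φ : (Fin n → K) → ℂ) (z : K) : ℂ :=
  ∫ x, Φ x * (Ψ (z * lastFun f x) : ℂ) ∂(glMeasure ϖ U f)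

end Field

/-- `F(s) = ∑_k c_k t ^ k` with `t = q ^ (-s)` for `Re s > 0`, i.e. for `0 < |t| < 1`, with only
finitely many nonzero `c_k` of negative index. -/
def HasExpansion (q : ℕ) (F : ℂ → ℂ) (c : ℤ → ℂ) : Prop :=
  (∃ N : ℤ, ∀ k < N, c k = 0) ∧
    ∀ s : ℂ, 0 < s.re → HasSum (fun k : ℤ => c k * ((q : ℂ) ^ (-s)) ^ k) (F s)

open Classical in
/-- `Coeff_{t^k} F(s)`: the `k`-th coefficient of the expansion of `F` in `t = q ^ (-s)`, which is
unique if it exists. -/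
def coeffT (q : ℕ) (F : ℂ → ℂ) (k : ℤ) : ℂ :=
  if h : ∃ c, HasExpansion q F c then h.choose k else 0

/-- `((t - q) / ((q - 1) (1 - t))) F(s)` with `t = q ^ (-s)`. -/
def trivTerm (q : ℕ) (F : ℂ → ℂ) (s : ℂ) : ℂ :=
  (((q : ℂ) ^ (-s) - q) * F s) / (((q : ℂ) - 1) * (1 - (q : ℂ) ^ (-s)))

end

end LocalZeta

open LocalZeta

set_option linter.unusedSectionVars false

/-! Slice the integral by the order of `f_l`. Let `a_χ(k)` be the integral of `Φ χ(ac f_l)` over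
`{ord f_l = k}`, so that `Z_Φ(s, χ) = ∑ a_χ(k) t^k`. For `z = u ϖ^(-m)` the factor `Ψ(z f_l)` is `1`
where `ord f_l ≥ m`. Where `ord f_l = m - c` with `c ≥ 1` it equals `Ψ(u ac(f_l) / ϖ^c)`, and
Fourier inversion on `(R_K / P_K^c)^×` gives `Ψ(w / ϖ^c) = ∑ g_{χ⁻¹} χ(w)`, the sum running over the
`χ` of conductor exactly `c`: characters of smaller conductor have vanishing sums at level `c`
(`charSum_eq_zero`). Hence each `χ` occurs on the single slice `k = m - c(χ)`. The trivial character
has conductor `1` and `g = -1/(q-1)`. Together with the slices `k ≥ m` it contributes `Z(0) -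
∑_{k<m} a_1(k) - a_1(m-1)/(q-1)`. Division by `1 - t` forms partial sums, so the last two terms are
the coefficient of `t^(m-1)` in `(t-q) Z / ((q-1)(1-t))`. This is `integral_addChar_eq`, which holds
for a measurable `h` on any measure space, provided that `Φ` is integrable, `ord h` is bounded below
and `Φ` vanishes almost everywhere on `{h = 0}`. Geometry supplies these conditions. Near a point of
`V` the measure `|γ_GL|` is bounded by finitely many Haar measures in coordinates
(`gelfandLeray_le`), hence is finite on compact sets. Where the full Jacobian has rank `l`, the
function `f_l` can replace one of the coordinates of `V`, so its zeros are null by Fubini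
(`exists_nhds_gelfandLeray_zeros`); the origin alone is null as well. It remains that the Jacobian
has rank `l` at the common zeros other than `0` near `0` (`eventually_rank_jacobian`). Otherwise,
along an ultrafilter of bad points tending to `0`, the `f_i` divided by their dominant monomials
converge to rescaled values of face functions, for one common weight, at a point `w` with nonzero
coordinates (`exists_point_and_weight`); convenience leaves only finitely many competing monomials.
The same holds for the logarithmic derivatives `x_j ∂f_i/∂x_j`. So `w` is a zero of the face
functions, non-degeneracy gives rank `l` there, and full rank is an open condition. -/

namespace LocalZeta

/-! ### The valuation ring, its uniformizer, and the finite quotients `R_K / P_K^c`. -/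

section FieldBasics

variable {K : Type*} [NontriviallyNormedField K] [IsPAdicField K]

lemma mem_RK {x : K} : x ∈ RK K ↔ ‖x‖ ≤ 1 := by
  rw [Valuation.mem_valuationSubring_iff, NormedField.valuation_apply, ← NNReal.coe_le_coe]
  simp

lemma norm_RK_le_one (x : RK K) : ‖(x : K)‖ ≤ 1 := mem_RK.1 x.2

lemma norm_unit (v : (RK K)ˣ) : ‖((v : RK K) : K)‖ = 1 := by
  refine le_antisymm (norm_RK_le_one _) ?_
  have h : ((v : RK K) : K) * (((v⁻¹ : (RK K)ˣ) : RK K) : K) = 1 := by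
    rw [← MulMemClass.coe_mul, Units.mul_inv]; rfl
  have h1 := norm_RK_le_one ((v⁻¹ : (RK K)ˣ) : RK K)
  have h2 : ‖((v : RK K) : K)‖ * ‖(((v⁻¹ : (RK K)ˣ) : RK K) : K)‖ = 1 := by
    rw [← norm_mul, h, norm_one]
  nlinarith [norm_nonneg ((v : RK K) : K)]

lemma isUnit_iff_norm {x : RK K} : IsUnit x ↔ ‖(x : K)‖ = 1 := by
  constructor
  · rintro ⟨v, rfl⟩; exact norm_unit v
  · intro h; exact ⟨toUnit (x : K) h, by ext; rfl⟩

@[simp] lemma toUnit_val (y : K) (h : ‖y‖ = 1) : ((toUnit y h : RK K) : K) = y := rfl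

variable {ϖ : RK K}

lemma unif_ne_zero (hϖ : Irreducible ϖ) : (ϖ : K) ≠ 0 := by
  intro h; exact hϖ.ne_zero (Subtype.ext h)

lemma norm_unif_pos (hϖ : Irreducible ϖ) : 0 < ‖(ϖ : K)‖ := norm_pos_iff.2 (unif_ne_zero hϖ)

lemma norm_unif_lt_one (hϖ : Irreducible ϖ) : ‖(ϖ : K)‖ < 1 :=
  lt_of_le_of_ne (norm_RK_le_one ϖ) fun h => hϖ.not_isUnit (isUnit_iff_norm.2 h)

/-- Irreducibility makes the value group discrete: in `ϖ = x (ϖ / x)` the second factor has norm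
below `1`, so the first must be a unit. -/
lemma norm_eq_one_of_unif_lt (hϖ : Irreducible ϖ) {x : K} (h : ‖(ϖ : K)‖ < ‖x‖) (h' : ‖x‖ ≤ 1) :
    ‖x‖ = 1 := by
  have hx : 0 < ‖x‖ := (norm_nonneg _).trans_lt h
  have hx0 : x ≠ 0 := norm_pos_iff.1 hx
  have hy : ‖(ϖ : K) / x‖ < 1 := by rw [norm_div, div_lt_one hx]; exact h
  have := hϖ.isUnit_or_isUnit (a := ⟨x, mem_RK.2 h'⟩) (b := ⟨(ϖ : K) / x, mem_RK.2 hy.le⟩)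
    (by ext; simp [mul_div_cancel₀, hx0])
  rcases this with h1 | h1
  · exact isUnit_iff_norm.1 h1
  · exact absurd (isUnit_iff_norm.1 h1) hy.ne

lemma exists_norm_eq_zpow (hϖ : Irreducible ϖ) {x : K} (hx : x ≠ 0) :
    ∃ k : ℤ, ‖x‖ = ‖(ϖ : K)‖ ^ k := by
  have hp := norm_unif_pos hϖ
  obtain ⟨k, hk1, hk2⟩ := exists_mem_Ioc_zpow (norm_pos_iff.2 hx)
    ((one_lt_inv₀ hp).2 (norm_unif_lt_one hϖ))
  -- Here `‖ϖ‖^(-k) < ‖x‖ ≤ ‖ϖ‖^(-(k+1))`, so `x ϖ^(k+1)` has norm in `(‖ϖ‖, 1]` and therefore norm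
  -- `1`.
  refine ⟨-(k + 1), ?_⟩
  have hy : ‖x * (ϖ : K) ^ (k + 1)‖ = 1 := by
    rw [inv_zpow] at hk1 hk2
    refine norm_eq_one_of_unif_lt hϖ ?_ ?_
    · rw [norm_mul, norm_zpow, zpow_add_one₀ hp.ne', ← mul_assoc]
      refine lt_mul_of_one_lt_left hp ?_
      rwa [inv_lt_iff_one_lt_mul₀ (zpow_pos hp _)] at hk1
    · rw [norm_mul, norm_zpow]
      exact (le_inv_mul_iff₀' (zpow_pos hp _)).1 (by simpa using hk2)
  rw [norm_mul, norm_zpow] at hy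
  rw [zpow_neg]
  exact eq_inv_of_mul_eq_one_left hy

lemma norm_eq_zpow_ordK (hϖ : Irreducible ϖ) {x : K} (hx : x ≠ 0) :
    ‖x‖ = ‖(ϖ : K)‖ ^ ordK ϖ x :=
  Classical.epsilon_spec (exists_norm_eq_zpow hϖ hx)

lemma ordK_eq_of_norm (hϖ : Irreducible ϖ) {x : K} {k : ℤ} (h : ‖x‖ = ‖(ϖ : K)‖ ^ k) :
    ordK ϖ x = k := by
  have hx : x ≠ 0 := norm_pos_iff.1 (h ▸ zpow_pos (norm_unif_pos hϖ) k)
  exact zpow_right_injective₀ (norm_unif_pos hϖ) (norm_unif_lt_one hϖ).ne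
    ((norm_eq_zpow_ordK hϖ hx).symm.trans h)

lemma norm_le_zpow_iff (hϖ : Irreducible ϖ) {x : K} (hx : x ≠ 0) {k : ℤ} :
    ‖x‖ ≤ ‖(ϖ : K)‖ ^ k ↔ k ≤ ordK ϖ x := by
  rw [norm_eq_zpow_ordK hϖ hx]
  exact zpow_le_zpow_iff_right_of_lt_one₀ (norm_unif_pos hϖ) (norm_unif_lt_one hϖ)

lemma norm_acK (hϖ : Irreducible ϖ) {x : K} (hx : x ≠ 0) : ‖acK ϖ x‖ = 1 := by
  have hp := norm_unif_pos hϖ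
  rw [acK, norm_mul, norm_zpow, zpow_neg, ← norm_eq_zpow_ordK hϖ hx,
    mul_inv_cancel₀ (norm_ne_zero_iff.2 hx)]

lemma acK_zero : acK ϖ (0 : K) = 0 := by simp [acK]

lemma mem_maximalIdeal_iff {x : RK K} :
    x ∈ IsLocalRing.maximalIdeal (RK K) ↔ ‖(x : K)‖ < 1 := by
  rw [IsLocalRing.mem_maximalIdeal, mem_nonunits_iff, isUnit_iff_norm]
  exact ⟨fun h => lt_of_le_of_ne (norm_RK_le_one x) h, fun h => h.ne⟩

lemma dvd_iff_norm_le {x y : RK K} : x ∣ y ↔ ‖(y : K)‖ ≤ ‖(x : K)‖ := by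
  constructor
  · rintro ⟨z, rfl⟩
    rw [MulMemClass.coe_mul, norm_mul]
    exact mul_le_of_le_one_right (norm_nonneg _) (norm_RK_le_one z)
  · intro h
    rcases eq_or_ne (x : K) 0 with hx | hx
    · rw [hx, norm_zero, norm_le_zero_iff] at h
      rw [show y = 0 from Subtype.ext h]; exact dvd_zero _
    · refine ⟨⟨(y : K) / x, mem_RK.2 ?_⟩, ?_⟩
      · rw [norm_div]; exact div_le_one_of_le₀ h (norm_nonneg _)
      · ext; simp [mul_div_cancel₀, hx]

lemma maximalIdeal_eq_span (hϖ : Irreducible ϖ) :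
    IsLocalRing.maximalIdeal (RK K) = Ideal.span {ϖ} := by
  ext x
  rw [mem_maximalIdeal_iff, Ideal.mem_span_singleton, dvd_iff_norm_le]
  refine ⟨fun h => ?_, fun h => h.trans_lt (norm_unif_lt_one hϖ)⟩
  by_contra! h'
  exact h.ne (norm_eq_one_of_unif_lt hϖ h' h.le)

lemma mem_maximalIdeal_pow_iff (hϖ : Irreducible ϖ) {x : RK K} {c : ℕ} :
    x ∈ IsLocalRing.maximalIdeal (RK K) ^ c ↔ ‖(x : K)‖ ≤ ‖(ϖ : K)‖ ^ c := by
  rw [maximalIdeal_eq_span hϖ, Ideal.span_singleton_pow, Ideal.mem_span_singleton, dvd_iff_norm_le]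
  simp

lemma isDiscreteValuationRing_RK (hϖ : Irreducible ϖ) : IsDiscreteValuationRing (RK K) := by
  refine IsDiscreteValuationRing.ofHasUnitMulPowIrreducibleFactorization ⟨ϖ, hϖ, fun {x} hx => ?_⟩
  have hx' : (x : K) ≠ 0 := fun h => hx (Subtype.ext h)
  have h0 : 0 ≤ ordK ϖ (x : K) := by
    rw [← norm_le_zpow_iff hϖ hx']; simpa using norm_RK_le_one x
  obtain ⟨k, hk⟩ := Int.eq_ofNat_of_zero_le h0
  refine ⟨k, ?_⟩
  have := norm_eq_zpow_ordK hϖ hx'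
  rw [hk, zpow_natCast] at this
  exact associated_of_dvd_dvd (dvd_iff_norm_le.2 (by simp [this])) (dvd_iff_norm_le.2 (by simp [this]))

instance compactSpace_RK : CompactSpace (RK K) := by
  have : ((RK K : Set K)) = Metric.closedBall (0 : K) 1 := by
    ext x; rw [SetLike.mem_coe, mem_RK, mem_closedBall_zero_iff]
  refine isCompact_iff_compactSpace.1 ?_
  rw [this]; exact isCompact_closedBall 0 1

lemma isOpen_maximalIdeal_pow (hϖ : Irreducible ϖ) (c : ℕ) :
    IsOpen ((IsLocalRing.maximalIdeal (RK K) ^ c : Ideal (RK K)) : Set (RK K)) := by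
  have : ((IsLocalRing.maximalIdeal (RK K) ^ c : Ideal (RK K)) : Set (RK K)) =
      Subtype.val ⁻¹' Metric.closedBall (0 : K) (‖(ϖ : K)‖ ^ c) := by
    ext x; simp [mem_maximalIdeal_pow_iff hϖ]
  rw [this]
  exact (IsUltrametricDist.isOpen_closedBall (0 : K)
    (pow_pos (norm_unif_pos hϖ) c).ne').preimage continuous_subtype_val

lemma finite_quotient_pow (hϖ : Irreducible ϖ) (c : ℕ) :
    Finite (RK K ⧸ IsLocalRing.maximalIdeal (RK K) ^ c) :=
  AddSubgroup.quotient_finite_of_isOpen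
    (IsLocalRing.maximalIdeal (RK K) ^ c : Ideal (RK K)).toAddSubgroup
    (isOpen_maximalIdeal_pow hϖ c)

lemma card_quotient_pow (hϖ : Irreducible ϖ) (c : ℕ) :
    Nat.card (RK K ⧸ IsLocalRing.maximalIdeal (RK K) ^ c) = resCard K ^ c := by
  have := isDiscreteValuationRing_RK hϖ
  have h := cardQuot_pow_of_prime (P := IsLocalRing.maximalIdeal (RK K)) (i := c)
    (IsDiscreteValuationRing.not_a_field _)
  rw [Submodule.cardQuot_apply, Submodule.cardQuot_apply] at h
  exact h

lemma finite_residueField (hϖ : Irreducible ϖ) : Finite (IsLocalRing.ResidueField (RK K)) := by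
  have := finite_quotient_pow hϖ 1
  rw [pow_one] at this
  exact this

lemma one_lt_resCard (hϖ : Irreducible ϖ) : 1 < resCard K := by
  have := finite_residueField hϖ
  exact Finite.one_lt_card

/-- Reduction of units modulo `P_K ^ c`. -/
noncomputable def redUnit (K : Type*) [NontriviallyNormedField K] [IsPAdicField K] (c : ℕ) :
    (RK K)ˣ →* (RK K ⧸ IsLocalRing.maximalIdeal (RK K) ^ c)ˣ :=
  Units.map (Ideal.Quotient.mk (IsLocalRing.maximalIdeal (RK K) ^ c) : RK K →* _)

lemma isUnit_of_isUnit_mk {c : ℕ} (hc : 1 ≤ c) {x : RK K}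
    (h : IsUnit (Ideal.Quotient.mk (IsLocalRing.maximalIdeal (RK K) ^ c) x)) : IsUnit x := by
  obtain ⟨y, hy⟩ := h.exists_right_inv
  obtain ⟨y, rfl⟩ := Ideal.Quotient.mk_surjective y
  rw [← map_mul, ← map_one (Ideal.Quotient.mk _), Ideal.Quotient.eq] at hy
  have hy' := Ideal.pow_le_self (by omega) hy
  by_contra hx
  have hx' : x * y ∈ IsLocalRing.maximalIdeal (RK K) :=
    Ideal.mul_mem_right _ _ ((IsLocalRing.mem_maximalIdeal _).2 hx)
  have : (1 : RK K) ∈ IsLocalRing.maximalIdeal (RK K) := by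
    have := Ideal.sub_mem _ hx' hy'
    rwa [sub_sub_cancel] at this
  exact (Ideal.ne_top_iff_one _).1 (IsLocalRing.maximalIdeal.isMaximal _).ne_top this

lemma norm_out_unit {c : ℕ} (hc : 1 ≤ c) (v : (RK K ⧸ IsLocalRing.maximalIdeal (RK K) ^ c)ˣ) :
    ‖((Quotient.out (v : RK K ⧸ IsLocalRing.maximalIdeal (RK K) ^ c) : RK K) : K)‖ = 1 := by
  refine isUnit_iff_norm.1 (isUnit_of_isUnit_mk hc ?_)
  have : Ideal.Quotient.mk (IsLocalRing.maximalIdeal (RK K) ^ c)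
    (Quotient.out (v : RK K ⧸ IsLocalRing.maximalIdeal (RK K) ^ c)) = v := Ideal.Quotient.mk_out _
  rw [this]; exact v.isUnit

lemma redUnit_toUnit_out {c : ℕ} (hc : 1 ≤ c)
    (v : (RK K ⧸ IsLocalRing.maximalIdeal (RK K) ^ c)ˣ) :
    redUnit K c (toUnit _ (norm_out_unit hc v)) = v := by
  ext
  exact Ideal.Quotient.mk_out _

lemma redUnit_surjective {c : ℕ} (hc : 1 ≤ c) : Function.Surjective (redUnit K c) :=
  fun v => ⟨_, redUnit_toUnit_out hc v⟩

lemma redUnit_eq_iff {c : ℕ} {v w : (RK K)ˣ} :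
    redUnit K c v = redUnit K c w ↔
      (v : RK K) - w ∈ IsLocalRing.maximalIdeal (RK K) ^ c := by
  rw [Units.ext_iff]; exact Ideal.Quotient.eq

lemma redUnit_eq_one_iff {c : ℕ} {v : (RK K)ˣ} :
    redUnit K c v = 1 ↔ (v : RK K) - 1 ∈ IsLocalRing.maximalIdeal (RK K) ^ c := by
  rw [← map_one (redUnit K c), redUnit_eq_iff]; rfl

/-- The units are the complement of the kernel of `R_K / P_K^c → R_K / P_K`, and that kernel has
`q^(c-1)` elements. -/
lemma card_units_quotient (hϖ : Irreducible ϖ) {c : ℕ} (hc : 1 ≤ c) :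
    Nat.card (RK K ⧸ IsLocalRing.maximalIdeal (RK K) ^ c)ˣ =
      (resCard K - 1) * resCard K ^ (c - 1) := by
  have := finite_quotient_pow hϖ c
  set P := IsLocalRing.maximalIdeal (RK K) with hP
  let g : RK K ⧸ P ^ c →+* RK K ⧸ P := Ideal.Quotient.factor (Ideal.pow_le_self (by omega))
  have hg : Function.Surjective g := Ideal.Quotient.factor_surjective _
  have hu : ∀ x : RK K ⧸ P ^ c, IsUnit x ↔ g x ≠ 0 := by
    intro x
    obtain ⟨x, rfl⟩ := Ideal.Quotient.mk_surjective x
    rw [show g (Ideal.Quotient.mk _ x) = Ideal.Quotient.mk P x from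
      Ideal.Quotient.factor_mk _ _, Ne, Ideal.Quotient.eq_zero_iff_mem, hP,
      IsLocalRing.mem_maximalIdeal, mem_nonunits_iff, not_not]
    exact ⟨isUnit_of_isUnit_mk hc, fun h => h.map _⟩
  have hker : Nat.card g.toAddMonoidHom.ker * resCard K = resCard K ^ c := by
    have h1 := AddSubgroup.card_eq_card_quotient_mul_card_addSubgroup g.toAddMonoidHom.ker
    have h2 : Nat.card ((RK K ⧸ P ^ c) ⧸ g.toAddMonoidHom.ker) = resCard K :=
      Nat.card_congr (QuotientAddGroup.quotientKerEquivOfSurjective g.toAddMonoidHom hg).toEquiv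
    rw [card_quotient_pow hϖ, h2] at h1
    rw [h1, mul_comm]
  have hq := one_lt_resCard hϖ
  have hker' : Nat.card g.toAddMonoidHom.ker = resCard K ^ (c - 1) := by
    obtain ⟨d, rfl⟩ : ∃ d, c = d + 1 := ⟨c - 1, by omega⟩
    rw [Nat.add_sub_cancel]
    exact Nat.eq_of_mul_eq_mul_right (by omega) (hker.trans (pow_succ _ _))
  have h3 : Nat.card (RK K ⧸ P ^ c)ˣ = Nat.card {x : RK K ⧸ P ^ c // g x ≠ 0} := by
    refine Nat.card_congr ⟨fun v => ⟨v, (hu _).1 v.isUnit⟩, fun x => ((hu _).2 x.2).unit,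
      fun v => by ext; rfl, fun x => by ext; rfl⟩
  have h4 : Nat.card {x : RK K ⧸ P ^ c // g x = 0} + Nat.card {x : RK K ⧸ P ^ c // ¬ g x = 0} =
      Nat.card (RK K ⧸ P ^ c) := by
    classical
    rw [← Nat.card_sum]; exact Nat.card_congr (Equiv.sumCompl _)
  have h5 : Nat.card {x : RK K ⧸ P ^ c // g x = 0} = Nat.card g.toAddMonoidHom.ker := rfl
  rw [h5, hker', card_quotient_pow hϖ] at h4
  rw [h3]
  obtain ⟨d, rfl⟩ : ∃ d, c = d + 1 := ⟨c - 1, by omega⟩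
  simp only [Nat.add_sub_cancel] at h4 ⊢
  rw [Nat.sub_mul, one_mul, ← pow_succ']
  simp only [ne_eq]
  omega

end FieldBasics

/-! ### Characters of `R_K^×` and their conductors. -/

/-- The circle has no small subgroups: since `|w^2 - 1| = |w - 1| |w + 1|` and `|w + 1| ≥ 3/2` near
`1`, repeated squaring would drive `z ≠ 1` away from `1` geometrically. -/
lemma circle_eq_one_of_pow_near_one {z : Circle} (h : ∀ n : ℕ, ‖((z ^ n : Circle) : ℂ) - 1‖ ≤ 1 / 2) :
    z = 1 := by
  have key : ∀ n : ℕ, (3 / 2 : ℝ) ^ n * ‖(z : ℂ) - 1‖ ≤ ‖((z ^ 2 ^ n : Circle) : ℂ) - 1‖ := by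
    intro n
    induction n with
    | zero => simp
    | succ n ih =>
      have h1 : ((z ^ 2 ^ (n + 1) : Circle) : ℂ) - 1 =
          (((z ^ 2 ^ n : Circle) : ℂ) - 1) * (((z ^ 2 ^ n : Circle) : ℂ) + 1) := by
        rw [pow_succ, pow_mul]; push_cast; ring
      have h2 : 3 / 2 ≤ ‖((z ^ 2 ^ n : Circle) : ℂ) + 1‖ := by
        have h3 : ‖(2 : ℂ)‖ ≤ ‖((z ^ 2 ^ n : Circle) : ℂ) + 1‖ + ‖((z ^ 2 ^ n : Circle) : ℂ) - 1‖ := by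
          refine le_trans (le_of_eq ?_) (norm_sub_le _ _)
          congr 1; ring
        have h4 := h (2 ^ n)
        rw [Complex.norm_ofNat] at h3
        linarith
      rw [h1, norm_mul, pow_succ]
      nlinarith [norm_nonneg (((z ^ 2 ^ n : Circle) : ℂ) - 1)]
  by_contra hz
  have hpos : 0 < ‖(z : ℂ) - 1‖ := by
    rw [norm_pos_iff, sub_ne_zero]
    intro h'; exact hz (Circle.ext (by simpa using h'))
  obtain ⟨n, hn⟩ := pow_unbounded_of_one_lt ((1 / 2 : ℝ) / ‖(z : ℂ) - 1‖) (by norm_num : (1 : ℝ) < 3 / 2)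
  rw [div_lt_iff₀ hpos] at hn
  linarith [key n, h (2 ^ n)]

section Characters

variable {K : Type*} [NontriviallyNormedField K] [IsPAdicField K] {ϖ : RK K}

/-- `χ` is trivial on `1 + P_K ^ c`. -/
def TrivialAt (χ : UnitChar K) (c : ℕ) : Prop :=
  ∀ v : (RK K)ˣ, (v : RK K) - 1 ∈ (IsLocalRing.maximalIdeal (RK K)) ^ c → χ v = 1

lemma TrivialAt.mono {χ : UnitChar K} {c d : ℕ} (h : TrivialAt χ c) (hcd : c ≤ d) :
    TrivialAt χ d := fun v hv => h v (Ideal.pow_le_pow_right hcd hv)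

/-- By continuity `χ` maps `1 + P_K^c` close to `1` for large `c`. That set is closed under powers,
so its image is trivial. This makes the infimum defining the conductor a minimum. -/
lemma exists_trivialAt (hϖ : Irreducible ϖ) (χ : UnitChar K) : ∃ c, 1 ≤ c ∧ TrivialAt χ c := by
  have hnhds : {v : (RK K)ˣ | ‖((χ v : Circle) : ℂ) - 1‖ ≤ 1 / 2} ∈ 𝓝 (1 : (RK K)ˣ) := by
    have hc : Continuous fun v : (RK K)ˣ => ‖((χ v : Circle) : ℂ) - 1‖ := by
      have := χ.continuous_toFun
      exact ((continuous_subtype_val.comp this).sub continuous_const).norm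
    have h0 : ‖((χ 1 : Circle) : ℂ) - 1‖ < 1 / 2 := by
      rw [map_one, Circle.coe_one, sub_self, norm_zero]; norm_num
    filter_upwards [hc.continuousAt.eventually_lt continuousAt_const h0] with v hv
    exact hv.le
  rw [Units.isEmbedding_embedProduct.isInducing.nhds_eq_comap, mem_comap] at hnhds
  obtain ⟨T, hT, hTs⟩ := hnhds
  rw [show Units.embedProduct (RK K) 1 = (1, 1) from rfl, nhds_prod_eq, mem_prod_iff] at hT
  obtain ⟨A, hA, B, hB, hAB⟩ := hT
  rw [← MulOpposite.op_one] at hB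
  have hB' : MulOpposite.op ⁻¹' B ∈ 𝓝 (1 : RK K) :=
    MulOpposite.continuous_op.continuousAt.preimage_mem_nhds hB
  obtain ⟨ε, hε, hball⟩ := Metric.mem_nhds_iff.1 (inter_mem hA hB')
  obtain ⟨c, hc⟩ := exists_pow_lt_of_lt_one hε (norm_unif_lt_one hϖ)
  have hmem : ∀ v : (RK K)ˣ, (v : RK K) - 1 ∈ (IsLocalRing.maximalIdeal (RK K)) ^ (c + 1) →
      ‖((χ v : Circle) : ℂ) - 1‖ ≤ 1 / 2 := by
    -- The topology of the unit group is induced by `v ↦ (v, v⁻¹)`, so `v` and `v⁻¹` must both be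
    -- close to `1`.
    have aux : ∀ v : (RK K)ˣ, (v : RK K) - 1 ∈ (IsLocalRing.maximalIdeal (RK K)) ^ (c + 1) →
        (v : RK K) ∈ A ∩ MulOpposite.op ⁻¹' B := by
      intro v hv
      apply hball
      have h1 := (mem_maximalIdeal_pow_iff hϖ).1 (Ideal.pow_le_pow_right (Nat.le_succ c) hv)
      rw [Metric.mem_ball, Subtype.dist_eq, dist_eq_norm]
      exact lt_of_le_of_lt h1 hc
    intro v hv
    refine hTs (hAB ⟨(aux v hv).1, ?_⟩)
    refine (aux v⁻¹ ?_).2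
    have : ((v⁻¹ : (RK K)ˣ) : RK K) - 1 = -(((v⁻¹ : (RK K)ˣ) : RK K) * ((v : RK K) - 1)) := by
      rw [mul_sub, Units.inv_mul]; ring
    rw [this]
    exact neg_mem (Ideal.mul_mem_left _ _ hv)
  refine ⟨c + 1, by omega, fun v hv => circle_eq_one_of_pow_near_one fun n => ?_⟩
  rw [← map_pow]
  refine hmem _ ?_
  rw [Units.val_pow_eq_pow_val]
  obtain ⟨y, hy⟩ := sub_one_dvd_pow_sub_one (v : RK K) n
  rw [hy]
  exact Ideal.mul_mem_right _ _ hv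
where
  sub_one_dvd_pow_sub_one (x : RK K) (n : ℕ) : x - 1 ∣ x ^ n - 1 := by
    simpa using sub_dvd_pow_sub_pow x 1 n

lemma charConductor_spec (hϖ : Irreducible ϖ) (χ : UnitChar K) :
    1 ≤ charConductor χ ∧ TrivialAt χ (charConductor χ) :=
  Nat.sInf_mem (s := {c : ℕ | 1 ≤ c ∧ TrivialAt χ c}) (exists_trivialAt hϖ χ)

lemma charConductor_le_iff (hϖ : Irreducible ϖ) {χ : UnitChar K} {c : ℕ} (hc : 1 ≤ c) :
    charConductor χ ≤ c ↔ TrivialAt χ c :=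
  ⟨fun h => (charConductor_spec hϖ χ).2.mono h,
    fun h => Nat.sInf_le (s := {c : ℕ | 1 ≤ c ∧ TrivialAt χ c}) ⟨hc, h⟩⟩

lemma unitChar_inv_apply (χ : UnitChar K) (v : (RK K)ˣ) : χ⁻¹ v = (χ v)⁻¹ := rfl

lemma charConductor_inv (χ : UnitChar K) : charConductor χ⁻¹ = charConductor χ := by
  unfold charConductor
  congr 1
  ext c
  refine and_congr_right fun _ => forall₂_congr fun v _ => ?_
  rw [unitChar_inv_apply, inv_eq_one]

lemma charConductor_one (hϖ : Irreducible ϖ) : charConductor (1 : UnitChar K) = 1 :=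
  le_antisymm ((charConductor_le_iff hϖ le_rfl).2 fun _ _ => rfl) (charConductor_spec hϖ 1).1

lemma TrivialAt.apply_eq {χ : UnitChar K} {c : ℕ} (h : TrivialAt χ c) {v w : (RK K)ˣ}
    (hvw : redUnit K c v = redUnit K c w) : χ v = χ w := by
  have : χ (v * w⁻¹) = 1 := by
    apply h
    rw [← redUnit_eq_one_iff, map_mul, map_inv, hvw, mul_inv_cancel]
  rw [map_mul, map_inv] at this
  exact mul_inv_eq_one.1 this

lemma charVal_of_norm (χ : UnitChar K) {y : K} (h : ‖y‖ = 1) :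
    charVal χ y = (χ (toUnit y h) : ℂ) := dif_pos h

lemma charVal_zero (χ : UnitChar K) : charVal χ 0 = 0 := by simp [charVal]

lemma norm_charVal_le (χ : UnitChar K) (y : K) : ‖charVal χ y‖ ≤ 1 := by
  unfold charVal
  split_ifs
  · exact (Circle.norm_coe _).le
  · simp

/-- The character of `R_K^×` given by a character of `(R_K / P_K ^ c)^×`. -/
noncomputable def pullChar (hϖ : Irreducible ϖ) (c : ℕ)
    (ψ : AddChar (Additive (RK K ⧸ IsLocalRing.maximalIdeal (RK K) ^ c)ˣ) Circle) : UnitChar K where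
  toFun v := ψ (Additive.ofMul (redUnit K c v))
  map_one' := by simp
  map_mul' v w := by simp [AddChar.map_add_eq_mul]
  continuous_toFun := by
    refine continuous_iff_continuousAt.2 fun v => ?_
    refine ContinuousAt.congr (f := fun _ => ψ (Additive.ofMul (redUnit K c v)))
      continuousAt_const ?_
    have h1 : {w : (RK K)ˣ | (w : RK K) - v ∈ IsLocalRing.maximalIdeal (RK K) ^ c} ∈ 𝓝 v := by
      refine IsOpen.mem_nhds ((isOpen_maximalIdeal_pow hϖ c).preimage
        (Units.continuous_val.sub continuous_const)) ?_
      simp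
    filter_upwards [h1] with w hw
    rw [redUnit_eq_iff.2 hw]

lemma pullChar_apply (hϖ : Irreducible ϖ) (c : ℕ)
    (ψ : AddChar (Additive (RK K ⧸ IsLocalRing.maximalIdeal (RK K) ^ c)ˣ) Circle) (v : (RK K)ˣ) :
    pullChar hϖ c ψ v = ψ (Additive.ofMul (redUnit K c v)) := rfl

lemma pullChar_injective (hϖ : Irreducible ϖ) {c : ℕ} (hc : 1 ≤ c) :
    Function.Injective (pullChar (K := K) hϖ c) := by
  intro ψ φ h
  ext g
  obtain ⟨v, hv⟩ := redUnit_surjective hc g.toMul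
  have := DFunLike.congr_fun h v
  rw [pullChar_apply, pullChar_apply, hv] at this
  exact congrArg _ this

lemma range_pullChar (hϖ : Irreducible ϖ) {c : ℕ} (hc : 1 ≤ c) (χ : UnitChar K) :
    χ ∈ Set.range (pullChar (K := K) hϖ c) ↔ charConductor χ ≤ c := by
  rw [charConductor_le_iff hϖ hc]
  constructor
  · rintro ⟨ψ, rfl⟩ v hv
    rw [pullChar_apply, redUnit_eq_one_iff.2 hv]; simp
  · intro h
    let σ := Function.surjInv (redUnit_surjective (K := K) hc)
    have hσ : ∀ g, redUnit K c (σ g) = g := Function.surjInv_eq _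
    refine ⟨{ toFun := fun g => χ (σ g.toMul), map_zero_eq_one' := ?_, map_add_eq_mul' := ?_ }, ?_⟩
    · rw [toMul_zero, ← map_one χ]
      apply h.apply_eq; rw [hσ, map_one]
    · intro a b
      rw [← map_mul]
      apply h.apply_eq; rw [map_mul, hσ, hσ, hσ]; rfl
    · ext v
      exact congrArg _ (h.apply_eq (hσ _))

lemma finite_addChar_circle {α : Type*} [AddCommGroup α] [Finite α] :
    Finite (AddChar α Circle) :=
  Finite.of_equiv _ (AddChar.circleEquivComplex (α := α)).symm.toEquiv

lemma finite_charConductor_le (hϖ : Irreducible ϖ) (c : ℕ) :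
    {χ : UnitChar K | charConductor χ ≤ c}.Finite := by
  have := finite_quotient_pow (K := K) hϖ (c + 1)
  have := finite_addChar_circle
    (α := Additive (RK K ⧸ IsLocalRing.maximalIdeal (RK K) ^ (c + 1))ˣ)
  refine (Set.finite_range (pullChar (K := K) hϖ (c + 1))).subset fun χ hχ => ?_
  rw [range_pullChar hϖ (by omega)]
  exact le_trans hχ (by omega)

open Classical in
/-- Orthogonality of the characters of conductor at most `c`. -/
lemma sum_pullChar (hϖ : Irreducible ϖ) {c : ℕ}
    [Fintype (AddChar (Additive (RK K ⧸ IsLocalRing.maximalIdeal (RK K) ^ c)ˣ) Circle)]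
    (w : (RK K)ˣ) :
    ∑ ψ, ((pullChar (K := K) hϖ c ψ w : Circle) : ℂ) =
      if redUnit K c w = 1 then
        (Nat.card (RK K ⧸ IsLocalRing.maximalIdeal (RK K) ^ c)ˣ : ℂ) else 0 := by
  have := finite_quotient_pow (K := K) hϖ c
  have := Fintype.ofFinite (Additive (RK K ⧸ IsLocalRing.maximalIdeal (RK K) ^ c)ˣ)
  have h := AddChar.sum_apply_eq_ite (Additive.ofMul (redUnit K c w))
  rw [← Equiv.sum_comp (AddChar.circleEquivComplex
    (α := Additive (RK K ⧸ IsLocalRing.maximalIdeal (RK K) ^ c)ˣ)).toEquiv] at h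
  simp only [ofMul_eq_zero, ← Nat.card_eq_fintype_card] at h
  exact h

end Characters

/-! ### Gaussian sums and the Fourier expansion of `Ψ(w / ϖ^c)` on units. -/

section GaussSums

variable {K : Type*} [NontriviallyNormedField K] [IsPAdicField K] {ϖ : RK K} {Ψ : AddChar K Circle}

lemma IsStandardAddChar.apply_eq (hΨ : IsStandardAddChar ϖ Ψ) {x y : K} (h : ‖x - y‖ ≤ 1) :
    Ψ x = Ψ y := by
  have : x = y + (x - y) := by ring
  rw [this, AddChar.map_add_eq_mul, hΨ.1 _ h, mul_one]

lemma norm_div_pow_le (hϖ : Irreducible ϖ) {c : ℕ} {x : RK K}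
    (h : x ∈ IsLocalRing.maximalIdeal (RK K) ^ c) : ‖(x : K) / (ϖ : K) ^ c‖ ≤ 1 := by
  rw [norm_div, norm_pow]
  exact div_le_one_of_le₀ ((mem_maximalIdeal_pow_iff hϖ).1 h) (by positivity)

lemma addChar_div_eq (hϖ : Irreducible ϖ) (hΨ : IsStandardAddChar ϖ Ψ) {c : ℕ} {x y : RK K}
    (h : Ideal.Quotient.mk (IsLocalRing.maximalIdeal (RK K) ^ c) x = Ideal.Quotient.mk _ y) :
    Ψ ((x : K) / (ϖ : K) ^ c) = Ψ ((y : K) / (ϖ : K) ^ c) := by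
  apply hΨ.apply_eq
  rw [← sub_div]
  exact norm_div_pow_le hϖ (Ideal.Quotient.eq.1 h)

/-- A nontrivial character of the residue field sums to zero. Translation by a class `y0` with `Ψ(u
y0 / ϖ) ≠ 1` multiplies the sum by that value. -/
lemma sum_addChar_residue (hϖ : Irreducible ϖ) (hΨ : IsStandardAddChar ϖ Ψ)
    [Fintype (RK K ⧸ IsLocalRing.maximalIdeal (RK K) ^ 1)] (u : (RK K)ˣ) :
    ∑ y : RK K ⧸ IsLocalRing.maximalIdeal (RK K) ^ 1,
      ((Ψ (((u : RK K) : K) * (Quotient.out y : RK K) / (ϖ : K) ^ 1) : Circle) : ℂ) = 0 := by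
  set F : RK K ⧸ IsLocalRing.maximalIdeal (RK K) ^ 1 → ℂ := fun y =>
    ((Ψ (((u : RK K) : K) * (Quotient.out y : RK K) / (ϖ : K) ^ 1) : Circle) : ℂ) with hF
  have hmk : ∀ x : RK K, F (Ideal.Quotient.mk _ x) =
      ((Ψ (((u : RK K) : K) * x / (ϖ : K) ^ 1) : Circle) : ℂ) := by
    intro x
    simp only [hF]
    have := addChar_div_eq hϖ hΨ (c := 1) (x := u * Quotient.out
      (Ideal.Quotient.mk (IsLocalRing.maximalIdeal (RK K) ^ 1) x)) (y := u * x) (by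
        rw [map_mul, map_mul]; congr 1; exact Ideal.Quotient.mk_out _)
    exact congrArg _ this
  obtain ⟨x, hx, hx1⟩ := hΨ.2
  set y0 : RK K := (u⁻¹ : (RK K)ˣ) * ⟨(ϖ : K) * x, mem_RK.2 hx⟩ with hy0
  have hval : F (Ideal.Quotient.mk _ y0) = (Ψ x : ℂ) := by
    rw [hmk]
    congr 2
    have : ((u : RK K) : K) * (y0 : K) = ((u * y0 : RK K) : K) := rfl
    rw [this, hy0, Units.mul_inv_cancel_left, pow_one, mul_div_cancel_left₀ _ (unif_ne_zero hϖ)]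
  have hadd : ∀ y, F (y + Ideal.Quotient.mk _ y0) = F y * Ψ x := by
    intro y
    obtain ⟨y, rfl⟩ := Ideal.Quotient.mk_surjective y
    rw [← hval, ← map_add, hmk, hmk, hmk, ← Circle.coe_mul, ← AddChar.map_add_eq_mul]
    congr 2
    push_cast; ring
  have h1 : ∑ y, F y = (∑ y, F y) * Ψ x := by
    rw [Finset.sum_mul, ← Equiv.sum_comp (Equiv.addRight (Ideal.Quotient.mk _ y0)) F]
    exact Finset.sum_congr rfl fun y _ => hadd y
  have h2 : (∑ y, F y) * ((Ψ x : ℂ) - 1) = 0 := by rw [mul_sub, ← h1]; ring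
  rcases mul_eq_zero.1 h2 with h | h
  · exact h
  · exact absurd (Circle.ext (by simpa [sub_eq_zero] using h)) hx1

/-- The sum of `χ(v) Ψ(v / ϖ ^ c)` over `(R_K / P_K ^ c)^×`. -/
noncomputable def charSum (ϖ : RK K) (Ψ : AddChar K Circle) (c : ℕ) (χ : UnitChar K) : ℂ :=
  ∑ᶠ v : (RK K ⧸ (IsLocalRing.maximalIdeal (RK K)) ^ c)ˣ,
      charVal χ ((Quotient.out (v : RK K ⧸ (IsLocalRing.maximalIdeal (RK K)) ^ c) :
        RK K) : K) *
      (Ψ (((Quotient.out (v : RK K ⧸ (IsLocalRing.maximalIdeal (RK K)) ^ c) :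
        RK K) : K) / (ϖ : K) ^ c) : ℂ)

/-- The normalizing factor `(q - 1)⁻¹ q^(1 - c)` is the inverse of the order of `(R_K / P_K^c)^×`,
so `g_χ` is a Fourier coefficient. -/
lemma gaussianSum_eq_charSum (hϖ : Irreducible ϖ) (χ : UnitChar K) :
    gaussianSum ϖ Ψ χ = (Nat.card (RK K ⧸ IsLocalRing.maximalIdeal (RK K) ^ charConductor χ)ˣ : ℂ)⁻¹ *
      charSum ϖ Ψ (charConductor χ) χ := by
  unfold gaussianSum charSum
  congr 1
  have hq := one_lt_resCard hϖ
  have h1 := (charConductor_spec hϖ χ).1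
  rw [card_units_quotient hϖ h1, Nat.cast_mul, mul_inv, Nat.cast_sub hq.le, Nat.cast_pow]
  rw [← zpow_natCast, ← zpow_neg, Nat.cast_one]
  congr 2
  push_cast [h1]; ring

/-- The sum of `χ(v) Ψ(v / ϖ ^ c)` as a sum over units of `R_K`. -/
lemma charSum_eq (hϖ : Irreducible ϖ) (hΨ : IsStandardAddChar ϖ Ψ) {c : ℕ} (hc : 1 ≤ c)
    {χ : UnitChar K} (hχ : TrivialAt χ c)
    [Fintype (RK K ⧸ IsLocalRing.maximalIdeal (RK K) ^ c)ˣ]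
    {τ : (RK K ⧸ IsLocalRing.maximalIdeal (RK K) ^ c)ˣ → (RK K)ˣ}
    (hτ : ∀ g, redUnit K c (τ g) = g) :
    charSum ϖ Ψ c χ = ∑ g, (χ (τ g) : ℂ) * Ψ (((τ g : RK K) : K) / (ϖ : K) ^ c) := by
  rw [charSum, finsum_eq_sum_of_fintype]
  refine Finset.sum_congr rfl fun g _ => ?_
  rw [charVal_of_norm χ (norm_out_unit hc g)]
  congr 2
  · exact hχ.apply_eq (by rw [redUnit_toUnit_out hc, hτ])
  · apply addChar_div_eq hϖ hΨ
    rw [Ideal.Quotient.mk_out]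
    exact congrArg Units.val (hτ g).symm

/-- Replacing `v` by `v (1 + ϖ^c y)` leaves `χ(v)` unchanged and multiplies `Ψ(v / ϖ^(c+1))` by `Ψ(v
y / ϖ)`. Averaging over `y` in the residue field then annihilates every term. -/
lemma charSum_eq_zero (hϖ : Irreducible ϖ) (hΨ : IsStandardAddChar ϖ Ψ) {c : ℕ} (hc : 1 ≤ c)
    {χ : UnitChar K} (hχ : charConductor χ ≤ c) : charSum ϖ Ψ (c + 1) χ = 0 := by
  classical
  have := finite_quotient_pow (K := K) hϖ (c + 1)
  have := finite_quotient_pow (K := K) hϖ 1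
  have := Fintype.ofFinite (RK K ⧸ IsLocalRing.maximalIdeal (RK K) ^ (c + 1))ˣ
  have := Fintype.ofFinite (RK K ⧸ IsLocalRing.maximalIdeal (RK K) ^ 1)
  have hχc := (charConductor_le_iff hϖ hc).1 hχ
  have hχc' := hχc.mono (Nat.le_succ c)
  set σ := Function.surjInv (redUnit_surjective (K := K) (Nat.le_add_left 1 c)) with hσd
  have hσ : ∀ g, redUnit K (c + 1) (σ g) = g := Function.surjInv_eq _
  have hbase := charSum_eq hϖ hΨ (Nat.le_add_left 1 c) hχc' hσ
  have hshift : ∀ y : RK K, charSum ϖ Ψ (c + 1) χ =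
      ∑ g, (χ (σ g) : ℂ) * Ψ (((σ g : RK K) : K) / (ϖ : K) ^ (c + 1)) *
        Ψ (((σ g : RK K) : K) * y / (ϖ : K) ^ 1) := by
    intro y
    have hunit : IsUnit (1 + ϖ ^ c * y) := by
      rw [isUnit_iff_norm]
      have hlt : ‖((ϖ ^ c * y : RK K) : K)‖ < 1 := by
        rw [MulMemClass.coe_mul, norm_mul]
        refine mul_lt_one_of_nonneg_of_lt_one_left (norm_nonneg _) ?_ (norm_RK_le_one y)
        rw [SubmonoidClass.coe_pow, norm_pow]
        exact pow_lt_one₀ (norm_nonneg _) (norm_unif_lt_one hϖ) (by omega)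
      have : ((1 + ϖ ^ c * y : RK K) : K) = 1 + ((ϖ ^ c * y : RK K) : K) := rfl
      rw [this, IsUltrametricDist.norm_add_eq_max_of_norm_ne_norm (by rw [norm_one]; exact hlt.ne'),
        norm_one, max_eq_left hlt.le]
    obtain ⟨t, ht⟩ := hunit
    have hχt : χ t = 1 := by
      apply hχc
      rw [ht, add_sub_cancel_left, mem_maximalIdeal_pow_iff hϖ, MulMemClass.coe_mul, norm_mul,
        SubmonoidClass.coe_pow, norm_pow]
      exact mul_le_of_le_one_right (by positivity) (norm_RK_le_one y)
    -- The sum does not depend on the representatives, so each one may be chosen as a multiple of `t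
    -- = 1 + ϖ^c y`.
    rw [charSum_eq hϖ hΨ (Nat.le_add_left 1 c) hχc'
      (τ := fun g => σ (g * (redUnit K (c + 1) t)⁻¹) * t)
      (fun g => by rw [map_mul, hσ, inv_mul_cancel_right]),
      ← Equiv.sum_comp (Equiv.mulRight (redUnit K (c + 1) t))]
    refine Finset.sum_congr rfl fun g _ => ?_
    simp only [Equiv.coe_mulRight, mul_inv_cancel_right, map_mul, hχt, mul_one]
    rw [mul_assoc]
    congr 1
    rw [← Circle.coe_mul, ← AddChar.map_add_eq_mul]
    congr 2
    rw [Units.val_mul, ht]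
    have h0 := unif_ne_zero hϖ
    push_cast
    field_simp
    ring
  have hsum : (Fintype.card (RK K ⧸ IsLocalRing.maximalIdeal (RK K) ^ 1) : ℂ) *
      charSum ϖ Ψ (c + 1) χ = 0 := by
    rw [← nsmul_eq_mul, ← Finset.card_univ, ← Finset.sum_const]
    rw [Finset.sum_congr rfl fun (y : RK K ⧸ IsLocalRing.maximalIdeal (RK K) ^ 1) _ =>
      hshift (Quotient.out y), Finset.sum_comm]
    refine Finset.sum_eq_zero fun g _ => ?_
    rw [← Finset.mul_sum, sum_addChar_residue hϖ hΨ, mul_zero]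
  refine (mul_eq_zero.1 hsum).resolve_left ?_
  exact Nat.cast_ne_zero.2 Fintype.card_ne_zero

/-- The sum of `Ψ(v / ϖ)` over all residues vanishes and the zero residue contributes `1`, so the
nonzero residues contribute `-1`. -/
lemma gaussianSum_one (hϖ : Irreducible ϖ) (hΨ : IsStandardAddChar ϖ Ψ) :
    gaussianSum ϖ Ψ 1 = -((resCard K : ℂ) - 1)⁻¹ := by
  classical
  have := finite_quotient_pow (K := K) hϖ 1
  have := Fintype.ofFinite (RK K ⧸ IsLocalRing.maximalIdeal (RK K) ^ 1)ˣ
  have := Fintype.ofFinite (RK K ⧸ IsLocalRing.maximalIdeal (RK K) ^ 1)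
  have hq := one_lt_resCard hϖ
  rw [gaussianSum_eq_charSum hϖ, charConductor_one hϖ, card_units_quotient hϖ le_rfl]
  simp only [Nat.sub_self, pow_zero, mul_one, Nat.cast_sub hq.le, Nat.cast_one]
  rw [← mul_neg_one]
  congr 1
  rw [charSum, finsum_eq_sum_of_fintype]
  have h := sum_addChar_residue hϖ hΨ (1 : (RK K)ˣ)
  have hnz : ∀ x : RK K ⧸ IsLocalRing.maximalIdeal (RK K) ^ 1, x ≠ 0 ↔ IsUnit x := by
    intro x
    obtain ⟨x, rfl⟩ := Ideal.Quotient.mk_surjective x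
    rw [Ne, Ideal.Quotient.eq_zero_iff_mem, pow_one, IsLocalRing.mem_maximalIdeal,
      mem_nonunits_iff, not_not]
    refine ⟨fun h => h.map _, fun h => isUnit_of_isUnit_mk (c := 1) le_rfl (by rw [pow_one]; exact h)⟩
  rw [← Finset.add_sum_erase _ _ (Finset.mem_univ 0)] at h
  have h0 : Ψ (((1 : (RK K)ˣ) : RK K) * ((Quotient.out (0 : RK K ⧸ IsLocalRing.maximalIdeal (RK K) ^ 1) :
      RK K) : K) / (ϖ : K) ^ 1) = 1 := by
    have := addChar_div_eq hϖ hΨ (c := 1) (x := Quotient.out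
      (0 : RK K ⧸ IsLocalRing.maximalIdeal (RK K) ^ 1)) (y := 0) (by
        rw [Ideal.Quotient.mk_out, map_zero])
    rw [Units.val_one, OneMemClass.coe_one, one_mul, this]; simp
  rw [h0, Circle.coe_one, add_comm] at h
  rw [← eq_neg_of_add_eq_zero_left h]
  refine Finset.sum_bij (fun v _ => (v : RK K ⧸ IsLocalRing.maximalIdeal (RK K) ^ 1)) ?_ ?_ ?_ ?_
  · intro v _
    simpa using (hnz _).2 v.isUnit
  · intro v _ w _ h; exact Units.ext h
  · intro x hx
    exact ⟨((hnz x).1 (by simpa using hx)).unit, Finset.mem_univ _, rfl⟩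
  · intro v _
    rw [charVal_of_norm _ (norm_out_unit le_rfl v)]
    simp

/-- The expansion of `w ↦ Ψ(w / ϖ ^ c)` on `R_K^×` in characters. -/
lemma exists_gaussianSum_expansion (hϖ : Irreducible ϖ) (hΨ : IsStandardAddChar ϖ Ψ) {c : ℕ}
    (hc : 1 ≤ c) : ∃ E : Finset (UnitChar K), (∀ χ, χ ∈ E ↔ charConductor χ = c) ∧
      ∀ w : (RK K)ˣ, ((Ψ (((w : RK K) : K) / (ϖ : K) ^ c) : Circle) : ℂ) =
        ∑ χ ∈ E, gaussianSum ϖ Ψ χ⁻¹ * (χ w : ℂ) := by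
  classical
  have hfin := finite_quotient_pow (K := K) hϖ c
  have := finite_addChar_circle (α := Additive (RK K ⧸ IsLocalRing.maximalIdeal (RK K) ^ c)ˣ)
  have := Fintype.ofFinite (AddChar (Additive (RK K ⧸ IsLocalRing.maximalIdeal (RK K) ^ c)ˣ) Circle)
  have := Fintype.ofFinite (RK K ⧸ IsLocalRing.maximalIdeal (RK K) ^ c)ˣ
  set X : Finset (UnitChar K) := Finset.univ.map ⟨pullChar (K := K) hϖ c, pullChar_injective hϖ hc⟩
  have hX : ∀ χ, χ ∈ X ↔ charConductor χ ≤ c := by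
    intro χ
    rw [← range_pullChar hϖ hc]; simp [X]
  refine ⟨X.filter fun χ => charConductor χ = c, fun χ => ?_, fun w => ?_⟩
  · rw [Finset.mem_filter, hX]; exact ⟨fun h => h.2, fun h => ⟨h.le, h⟩⟩
  set N : ℂ := (Nat.card (RK K ⧸ IsLocalRing.maximalIdeal (RK K) ^ c)ˣ : ℂ) with hN
  have hN0 : N ≠ 0 := Nat.cast_ne_zero.2 Nat.card_pos.ne'
  -- The characters of conductor below `c` may be added at no cost, their sums at level `c` being
  -- zero; then `X` is the full dual of `(R_K / P_K^c)^×`.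
  have h1 : ∑ χ ∈ X.filter (fun χ => charConductor χ = c), gaussianSum ϖ Ψ χ⁻¹ * (χ w : ℂ) =
      ∑ χ ∈ X, N⁻¹ * charSum ϖ Ψ c χ⁻¹ * (χ w : ℂ) := by
    rw [Finset.sum_filter]
    refine Finset.sum_congr rfl fun χ hχ => ?_
    split_ifs with h
    · rw [gaussianSum_eq_charSum hϖ, charConductor_inv, h]
    · have h2 : charConductor χ < c := lt_of_le_of_ne ((hX χ).1 hχ) h
      have h3 := (charConductor_spec hϖ χ).1
      obtain ⟨d, rfl⟩ : ∃ d, c = d + 1 := ⟨c - 1, by omega⟩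
      rw [charSum_eq_zero hϖ hΨ (c := d) (by omega) (by rw [charConductor_inv]; omega)]
      simp
  rw [h1]
  set σ := Function.surjInv (redUnit_surjective (K := K) hc) with hσd
  have hσ : ∀ g, redUnit K c (σ g) = g := Function.surjInv_eq _
  have h2 : ∀ χ ∈ X, N⁻¹ * charSum ϖ Ψ c χ⁻¹ * (χ w : ℂ) =
      ∑ g, N⁻¹ * Ψ (((σ g : RK K) : K) / (ϖ : K) ^ c) * (χ (w * (σ g)⁻¹) : ℂ) := by
    intro χ hχ
    rw [charSum_eq hϖ hΨ hc ((charConductor_le_iff hϖ hc).1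
      (by rw [charConductor_inv]; exact (hX χ).1 hχ)) hσ, Finset.mul_sum, Finset.sum_mul]
    refine Finset.sum_congr rfl fun g _ => ?_
    rw [map_mul, map_inv, unitChar_inv_apply, Circle.coe_mul]
    ring
  rw [Finset.sum_congr rfl h2, Finset.sum_comm]
  -- Orthogonality of characters isolates the class of `w`.
  have h3 : ∀ g, ∑ χ ∈ X, N⁻¹ * (Ψ (((σ g : RK K) : K) / (ϖ : K) ^ c) : ℂ) * (χ (w * (σ g)⁻¹) : ℂ) =
      if g = redUnit K c w then (Ψ (((σ g : RK K) : K) / (ϖ : K) ^ c) : ℂ) else 0 := by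
    intro g
    rw [← Finset.mul_sum, Finset.sum_map]
    have := sum_pullChar hϖ (c := c) (w * (σ g)⁻¹)
    simp only [Function.Embedding.coeFn_mk]
    rw [this, ← hN]
    have hiff : redUnit K c (w * (σ g)⁻¹) = 1 ↔ g = redUnit K c w := by
      rw [map_mul, map_inv, hσ, mul_inv_eq_one, eq_comm]
    by_cases hg : g = redUnit K c w
    · rw [if_pos (hiff.2 hg), if_pos hg]
      field_simp
    · rw [if_neg (fun h => hg (hiff.1 h)), if_neg hg, mul_zero]
  rw [Finset.sum_congr rfl fun g _ => h3 g, Finset.sum_ite_eq' Finset.univ, if_pos (Finset.mem_univ _)]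
  congr 1
  apply addChar_div_eq hϖ hΨ
  exact congrArg Units.val (hσ (redUnit K c w)).symm

end GaussSums

/-! ### Expansions in `t = q^(-s)`: uniqueness and multiplication by the rational factor. -/

section Expansions

lemma hasSum_int_iff_nat {c : ℤ → ℂ} {N : ℤ} (hc : ∀ k < N, c k = 0) {a : ℂ} :
    HasSum (fun j : ℕ => c (N + j)) a ↔ HasSum c a := by
  refine Function.Injective.hasSum_iff (f := c) (g := fun j : ℕ => N + (j : ℤ))
    (fun i j h => by simpa using h) fun k hk => hc k ?_
  by_contra! h
  exact hk ⟨(k - N).toNat, by beta_reduce; omega⟩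

/-- Only the points `t = q^(-n)` are needed: as `n` grows the terms of positive degree tend to zero
together, being dominated by the absolutely convergent series at `t = q^(-1)`. -/
lemma coeff_zero_of_hasSum_zero {q : ℕ} (hq : 1 < q) {a : ℕ → ℂ}
    (h : ∀ s : ℂ, 0 < s.re → HasSum (fun j : ℕ => a j * ((q : ℂ) ^ (-s)) ^ j) 0) : a 0 = 0 := by
  have hq0 : (q : ℂ) ≠ 0 := by exact_mod_cast (by omega : q ≠ 0)
  have h' : ∀ n : ℕ, 1 ≤ n → HasSum (fun j : ℕ => a j * (((q : ℂ) ^ n)⁻¹) ^ j) 0 := by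
    intro n hn
    have := h n (by rw [Complex.natCast_re]; exact_mod_cast hn)
    rwa [Complex.cpow_neg, Complex.cpow_natCast] at this
  have hs1 : Summable fun j : ℕ => ‖a (j + 1) * (((q : ℂ) ^ 1)⁻¹) ^ (j + 1)‖ :=
    ((summable_nat_add_iff 1).2 (h' 1 le_rfl).summable).norm
  set B := ∑' j : ℕ, ‖a (j + 1) * (((q : ℂ) ^ 1)⁻¹) ^ (j + 1)‖
  have hqR : (1 : ℝ) < q := by exact_mod_cast hq
  have hbound : ∀ n : ℕ, ‖a 0‖ ≤ ((q : ℝ)⁻¹) ^ n * B := by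
    intro n
    have h1 := (h' (n + 1) (by omega))
    have h2 := h1.tsum_eq
    rw [h1.summable.tsum_eq_zero_add, pow_zero, mul_one] at h2
    rw [eq_neg_of_add_eq_zero_left h2, norm_neg]
    rw [← tsum_mul_left]
    refine tsum_of_norm_bounded (hs1.mul_left _).hasSum fun j => ?_
    simp only [norm_mul, norm_pow, norm_inv, Complex.norm_natCast, pow_one]
    rw [mul_left_comm]
    refine mul_le_mul_of_nonneg_left ?_ (norm_nonneg _)
    rw [← inv_pow, ← pow_mul, ← pow_add]
    refine pow_le_pow_of_le_one (by positivity) (inv_le_one_of_one_le₀ hqR.le) ?_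
    nlinarith
  have hlim : Tendsto (fun n : ℕ => ((q : ℝ)⁻¹) ^ n * B) atTop (𝓝 (0 * B)) :=
    (tendsto_pow_atTop_nhds_zero_of_lt_one (by positivity)
      (inv_lt_one_of_one_lt₀ hqR)).mul_const _
  rw [zero_mul] at hlim
  exact norm_le_zero_iff.1 (ge_of_tendsto' hlim hbound)

lemma HasExpansion.unique {q : ℕ} (hq : 1 < q) {F : ℂ → ℂ} {c d : ℤ → ℂ}
    (hc : HasExpansion q F c) (hd : HasExpansion q F d) : c = d := by
  have hq0 : (q : ℂ) ≠ 0 := by exact_mod_cast (by omega : q ≠ 0)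
  obtain ⟨⟨N, hN⟩, hc⟩ := hc
  obtain ⟨⟨M, hM⟩, hd⟩ := hd
  -- Once all coefficients below an index agree, dividing the difference by the corresponding power
  -- of `t` makes the next coefficient a constant term.
  have key : ∀ n : ℕ, ∀ k < min N M + n, (c - d) k = 0 := by
    intro n
    induction n with
    | zero =>
      intro k hk
      simp only [Nat.cast_zero, add_zero, lt_min_iff] at hk
      simp [hN k hk.1, hM k hk.2]
    | succ n ih =>
      intro k hk
      by_cases hk' : k < min N M + n
      · exact ih k hk'
      obtain rfl : k = min N M + n := by push_cast at hk; omega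
      have := coeff_zero_of_hasSum_zero hq (a := fun j : ℕ => (c - d) (min N M + n + j)) ?_
      · simpa using this
      intro s hs
      have h0 := (hc s hs).sub (hd s hs)
      simp only [sub_self, ← sub_mul] at h0
      have ht : (q : ℂ) ^ (-s) ≠ 0 := by simp [Complex.cpow_eq_zero_iff, hq0]
      have h1 := (hasSum_int_iff_nat (N := min N M + n) (fun k hk => by
        have := ih k hk
        simp only [Pi.sub_apply] at this
        rw [this, zero_mul])).2 h0
      have h2 := h1.mul_left ((((q : ℂ) ^ (-s)) ^ (min N M + (n : ℤ)))⁻¹)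
      rw [mul_zero] at h2
      refine h2.congr_fun fun j => ?_
      rw [zpow_add₀ ht _ (j : ℤ), zpow_natCast, Pi.sub_apply]
      have := zpow_ne_zero (min N M + (n : ℤ)) ht
      field_simp
  funext k
  have := key (k + 1 - min N M).toNat k (by omega)
  exact sub_eq_zero.1 this

lemma HasExpansion.coeffT_eq {q : ℕ} (hq : 1 < q) {F : ℂ → ℂ} {c : ℤ → ℂ}
    (hc : HasExpansion q F c) (k : ℤ) : coeffT q F k = c k := by
  have h : ∃ c, HasExpansion q F c := ⟨c, hc⟩
  rw [coeffT, dif_pos h, h.choose_spec.unique hq hc]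

lemma norm_natCast_cpow_neg_lt_one {q : ℕ} (hq : 1 < q) {s : ℂ} (hs : 0 < s.re) :
    ‖(q : ℂ) ^ (-s)‖ < 1 := by
  rw [Complex.norm_natCast_cpow_of_pos (by omega)]
  exact Real.rpow_lt_one_of_one_lt_of_neg (by exact_mod_cast hq) (by simpa using hs)

/-- Multiplication of an expansion by `(t - q) / ((q - 1) (1 - t))`. -/
lemma HasExpansion.trivTerm {q : ℕ} (hq : 1 < q) {F : ℂ → ℂ} {a b : ℤ → ℂ} {N : ℤ}
    (hF : HasExpansion q F a) (hb0 : ∀ k < N, b k = 0) (hb : ∀ k, b k - b (k - 1) = a k)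
    {B : ℝ} (hB : ∀ k, ‖b k‖ ≤ B) :
    HasExpansion q (trivTerm q F) fun k => (b (k - 1) - q * b k) / ((q : ℂ) - 1) := by
  refine ⟨⟨N, fun k hk => ?_⟩, fun s hs => ?_⟩
  · beta_reduce
    rw [hb0 k hk, hb0 (k - 1) (by omega)]; simp
  have hq0 : (q : ℂ) ≠ 0 := by exact_mod_cast (by omega : q ≠ 0)
  set t : ℂ := (q : ℂ) ^ (-s) with htd
  have ht1 : ‖t‖ < 1 := norm_natCast_cpow_neg_lt_one hq hs
  have ht0 : t ≠ 0 := by simp [htd, Complex.cpow_eq_zero_iff, hq0]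
  -- The series of `b` represents `F / (1 - t)`; bounded coefficients suffice for convergence in `0
  -- < |t| < 1`.
  have hsum : Summable fun k : ℤ => b k * t ^ k := by
    have h1 : Summable fun j : ℕ => b (N + j) * t ^ (N + (j : ℤ)) := by
      refine Summable.of_norm_bounded
        (g := fun j : ℕ => (B * ‖t‖ ^ N) * ‖t‖ ^ j) ?_ fun j => ?_
      · exact (summable_geometric_of_lt_one (norm_nonneg _) ht1).mul_left _
      · rw [norm_mul, norm_zpow, zpow_add₀ (norm_ne_zero_iff.2 ht0), zpow_natCast, ← mul_assoc]
        gcongr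
        exact hB _
    obtain ⟨x, hx⟩ := h1
    exact ⟨x, (hasSum_int_iff_nat (c := fun k : ℤ => b k * t ^ k)
      (fun k hk => by rw [hb0 k hk, zero_mul])).1 hx⟩
  obtain ⟨S, hS⟩ := hsum
  have hS' : HasSum (fun k : ℤ => b (k - 1) * t ^ k) (t * S) := by
    rw [← (Equiv.addRight (1 : ℤ)).hasSum_iff]
    refine (hS.mul_left t).congr_fun fun k => ?_
    simp only [Function.comp_apply, Equiv.coe_addRight, add_sub_cancel_right]
    rw [zpow_add_one₀ ht0]; ring
  have hZ : S - t * S = F s := by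
    refine HasSum.unique (hS.sub hS') ((hF.2 s hs).congr_fun fun k => ?_)
    rw [← sub_mul, hb]
  have hne : 1 - t ≠ 0 := by
    intro h
    rw [sub_eq_zero] at h
    rw [← h, norm_one] at ht1
    exact lt_irrefl _ ht1
  have hq1 : (q : ℂ) - 1 ≠ 0 := by
    rw [sub_ne_zero]; exact_mod_cast hq.ne'
  have hval : LocalZeta.trivTerm q F s = (t * S - q * S) / ((q : ℂ) - 1) := by
    rw [LocalZeta.trivTerm, ← hZ, ← htd]
    field_simp
  rw [hval]
  refine ((hS'.sub (hS.mul_left (q : ℂ))).div_const _).congr_fun fun k => ?_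
  ring

end Expansions

/-! ### Regularity and size of the quasicharacters. -/

section QuasiChar

variable {K : Type*} [NontriviallyNormedField K] [IsPAdicField K] {ϖ : RK K}

lemma absK_of_ne_zero {x : K} (hx : x ≠ 0) : absK ϖ x = (resCard K : ℝ) ^ (-ordK ϖ x) := if_neg hx

lemma quasiChar_zero (χ : UnitChar K) (s : ℂ) : quasiChar ϖ χ s 0 = 0 := by
  rw [quasiChar, acK_zero, charVal_zero, zero_mul]

lemma quasiChar_eq (hϖ : Irreducible ϖ) (χ : UnitChar K) (s : ℂ) {x : K} (hx : x ≠ 0) :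
    quasiChar ϖ χ s x = charVal χ (acK ϖ x) * ((resCard K : ℂ) ^ (-s)) ^ ordK ϖ x := by
  have hq := one_lt_resCard hϖ
  have hq0 : (0 : ℝ) < resCard K := by exact_mod_cast (by omega : 0 < resCard K)
  have hqC : (resCard K : ℂ) ≠ 0 := by exact_mod_cast (by omega : resCard K ≠ 0)
  rw [quasiChar, absK_of_ne_zero hx]
  congr 1
  have h1 : (0 : ℝ) < (resCard K : ℝ) ^ (-ordK ϖ x) := zpow_pos hq0 _
  rw [Complex.cpow_def_of_ne_zero (by exact_mod_cast h1.ne'), Complex.cpow_def_of_ne_zero hqC,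
    ← Complex.ofReal_log h1.le, Real.log_zpow, ← Complex.exp_int_mul, ← Complex.natCast_log]
  congr 1
  push_cast; ring

lemma quasiChar_eq_zero_mul (hϖ : Irreducible ϖ) (χ : UnitChar K) (s : ℂ) {x : K} (hx : x ≠ 0) :
    quasiChar ϖ χ s x = quasiChar ϖ χ 0 x * ((resCard K : ℂ) ^ (-s)) ^ ordK ϖ x := by
  rw [quasiChar_eq hϖ χ s hx, quasiChar_eq hϖ χ 0 hx]; simp

lemma norm_quasiChar_le (hϖ : Irreducible ϖ) (χ : UnitChar K) {s : ℂ} (hs : 0 ≤ s.re) {x : K}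
    {M : ℕ} (hx : x ≠ 0 → -(M : ℤ) ≤ ordK ϖ x) :
    ‖quasiChar ϖ χ s x‖ ≤ ((resCard K : ℝ) ^ M) ^ s.re := by
  have hq := one_lt_resCard hϖ
  have hq0 : (0 : ℝ) < resCard K := by exact_mod_cast (by omega : 0 < resCard K)
  rcases eq_or_ne x 0 with rfl | h0
  · rw [quasiChar_zero, norm_zero]; positivity
  rw [quasiChar, norm_mul, absK_of_ne_zero h0,
    Complex.norm_cpow_eq_rpow_re_of_pos (zpow_pos hq0 _)]
  refine (mul_le_of_le_one_left (by positivity) (norm_charVal_le _ _)).trans ?_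
  refine Real.rpow_le_rpow (by positivity) ?_ hs
  rw [← zpow_natCast]
  exact zpow_le_zpow_right₀ (by exact_mod_cast hq.le) (by have := hx h0; omega)

lemma norm_eq_of_norm_sub_lt {x y : K} (h : ‖y - x‖ < ‖x‖) : ‖y‖ = ‖x‖ := by
  have : y = (y - x) + x := by ring
  rw [this, IsUltrametricDist.norm_add_eq_max_of_norm_ne_norm h.ne, max_eq_right h.le]

/-- A quasicharacter is locally constant away from `0`: on the ball of radius `‖ϖ‖^c ‖x‖` both the
order and the class of `ac` modulo `P_K^c` are constant. -/
lemma continuousAt_quasiChar (hϖ : Irreducible ϖ) (χ : UnitChar K) (s : ℂ) {x : K} (hx : x ≠ 0) :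
    ContinuousAt (quasiChar ϖ χ s) x := by
  obtain ⟨c, hc, hχ⟩ := exists_trivialAt hϖ χ
  have hp := norm_unif_pos hϖ
  have hx' := norm_pos_iff.2 hx
  refine ContinuousAt.congr (f := fun _ => quasiChar ϖ χ s x) continuousAt_const ?_
  filter_upwards [Metric.ball_mem_nhds x (show 0 < ‖(ϖ : K)‖ ^ c * ‖x‖ by positivity)] with y hy
  rw [Metric.mem_ball, dist_eq_norm] at hy
  have hlt : ‖y - x‖ < ‖x‖ := hy.trans_le (mul_le_of_le_one_left hx'.le
    (pow_le_one₀ hp.le (norm_unif_lt_one hϖ).le))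
  have hn := norm_eq_of_norm_sub_lt hlt
  have hy0 : y ≠ 0 := norm_pos_iff.1 (hn ▸ hx')
  have ho : ordK ϖ y = ordK ϖ x := ordK_eq_of_norm hϖ (hn.trans (norm_eq_zpow_ordK hϖ hx))
  rw [quasiChar_eq hϖ χ s hx, quasiChar_eq hϖ χ s hy0, ho, charVal_of_norm _ (norm_acK hϖ hx),
    charVal_of_norm _ (norm_acK hϖ hy0)]
  congr 2
  apply hχ.apply_eq
  rw [redUnit_eq_iff, mem_maximalIdeal_pow_iff hϖ]
  have : (((toUnit _ (norm_acK hϖ hx) : (RK K)ˣ) - (toUnit _ (norm_acK hϖ hy0) : (RK K)ˣ) : RK K) : K) =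
      (x - y) * (ϖ : K) ^ (-ordK ϖ x) := by
    push_cast
    rw [toUnit_val, toUnit_val, acK, acK, ho]; ring
  rw [this, norm_mul, norm_zpow, zpow_neg, ← norm_eq_zpow_ordK hϖ hx, norm_sub_rev,
    ← div_eq_mul_inv, div_le_iff₀ hx']
  exact hy.le

variable [MeasurableSpace K] [BorelSpace K]

lemma measurable_quasiChar (hϖ : Irreducible ϖ) (χ : UnitChar K) (s : ℂ) :
    Measurable (quasiChar ϖ χ s) :=
  measurable_of_continuousOn_compl_singleton 0 fun _ hx =>
    (continuousAt_quasiChar hϖ χ s hx).continuousWithinAt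

lemma IsStandardAddChar.continuous {Ψ : AddChar K Circle} (hΨ : IsStandardAddChar ϖ Ψ) :
    Continuous fun x => (Ψ x : ℂ) := by
  refine continuous_iff_continuousAt.2 fun x => ?_
  refine ContinuousAt.congr (f := fun _ => (Ψ x : ℂ)) continuousAt_const ?_
  filter_upwards [Metric.ball_mem_nhds x one_pos] with y hy
  rw [hΨ.apply_eq]
  rw [Metric.mem_ball, dist_comm, dist_eq_norm] at hy
  exact hy.le

end QuasiChar

/-! ### The formula for oscillatory integrals on an abstract measure space. -/

section Oscillatory

variable {K : Type*} [NontriviallyNormedField K] [IsPAdicField K] [MeasurableSpace K] [BorelSpace K]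
  {ϖ : RK K} {Ψ : AddChar K Circle} {X : Type*} [MeasurableSpace X] {μ : Measure X}
  {Φ : X → ℂ} {h : X → K} {M : ℕ}

/-- The set of points where `h` has order `k`. -/
def shell (ϖ : RK K) (h : X → K) (k : ℤ) : Set X := {x | ‖h x‖ = ‖(ϖ : K)‖ ^ k}

lemma measurableSet_shell (hh : Measurable h) (k : ℤ) : MeasurableSet (shell ϖ h k) :=
  measurableSet_eq_fun hh.norm measurable_const

lemma shell_disjoint (hϖ : Irreducible ϖ) :
    Pairwise (Function.onFun Disjoint (shell ϖ h)) := by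
  intro i j hij
  refine Set.disjoint_left.2 fun x hi hj => hij ?_
  exact (ordK_eq_of_norm hϖ hi).symm.trans (ordK_eq_of_norm hϖ hj)

lemma ne_zero_of_mem_shell (hϖ : Irreducible ϖ) {k : ℤ} {x : X} (hx : x ∈ shell ϖ h k) :
    h x ≠ 0 := norm_pos_iff.1 (by rw [hx]; exact zpow_pos (norm_unif_pos hϖ) _)

lemma iUnion_shell (hϖ : Irreducible ϖ) : ⋃ k, shell ϖ h k = {x | h x ≠ 0} := by
  ext x
  rw [Set.mem_iUnion]
  exact ⟨fun ⟨k, hk⟩ => ne_zero_of_mem_shell hϖ hk, fun hx => exists_norm_eq_zpow hϖ hx⟩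

/-- The integral of `Φ χ(ac h)` over the points where `h` has order `k`. -/
noncomputable def shellInt (ϖ : RK K) (μ : Measure X) (Φ : X → ℂ) (h : X → K) (χ : UnitChar K)
    (k : ℤ) : ℂ := ∫ x in shell ϖ h k, Φ x * quasiChar ϖ χ 0 (h x) ∂μ

lemma integrable_mul_quasiChar (hϖ : Irreducible ϖ) (hΦ : Integrable Φ μ) (hh : Measurable h)
    (hM : ∀ x, h x ≠ 0 → -(M : ℤ) ≤ ordK ϖ (h x)) (χ : UnitChar K) {s : ℂ} (hs : 0 ≤ s.re) :
    Integrable (fun x => Φ x * quasiChar ϖ χ s (h x)) μ :=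
  hΦ.mul_bdd (c := ((resCard K : ℝ) ^ M) ^ s.re)
    ((measurable_quasiChar hϖ χ s).comp hh).aestronglyMeasurable
    (Eventually.of_forall fun x => norm_quasiChar_le hϖ χ hs (hM x))

lemma integrable_mul_addChar (hΨ : IsStandardAddChar ϖ Ψ) (hΦ : Integrable Φ μ)
    (hh : Measurable h) (z : K) : Integrable (fun x => Φ x * (Ψ (z * h x) : ℂ)) μ :=
  hΦ.mul_bdd (c := 1)
    (hΨ.continuous.measurable.comp (hh.const_mul z)).aestronglyMeasurable
    (Eventually.of_forall fun _ => (Circle.norm_coe _).le)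

/-- The shells cover only `{h ≠ 0}`. For zeta integrands the vanishing at `h = 0` is built in, while
for `Ψ(z h)`, which is `1` there, it has to come from the zeros of `h` being negligible for `Φ`. -/
lemma hasSum_setIntegral_shell (hϖ : Irreducible ϖ) (hh : Measurable h) {F : X → ℂ}
    (hF : Integrable F μ) (h0 : ∀ᵐ x ∂μ, h x = 0 → F x = 0) :
    HasSum (fun k => ∫ x in shell ϖ h k, F x ∂μ) (∫ x, F x ∂μ) := by
  have h1 := hasSum_integral_iUnion (μ := μ) (f := F) (measurableSet_shell (ϖ := ϖ) hh)
    (shell_disjoint hϖ) hF.integrableOn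
  rw [iUnion_shell hϖ] at h1
  rwa [setIntegral_eq_integral_of_ae_compl_eq_zero] at h1
  filter_upwards [h0] with x hx hx'
  exact hx (by simpa using hx')

lemma hasSum_shellInt (hϖ : Irreducible ϖ) (hΦ : Integrable Φ μ) (hh : Measurable h)
    (hM : ∀ x, h x ≠ 0 → -(M : ℤ) ≤ ordK ϖ (h x)) (χ : UnitChar K) {s : ℂ} (hs : 0 ≤ s.re) :
    HasSum (fun k : ℤ => shellInt ϖ μ Φ h χ k * ((resCard K : ℂ) ^ (-s)) ^ k)
      (∫ x, Φ x * quasiChar ϖ χ s (h x) ∂μ) := by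
  have h1 := hasSum_setIntegral_shell hϖ hh (integrable_mul_quasiChar hϖ hΦ hh hM χ hs)
    (Eventually.of_forall fun x hx => by rw [hx, quasiChar_zero, mul_zero])
  refine h1.congr_fun fun k => ?_
  rw [shellInt, ← integral_mul_const]
  refine setIntegral_congr_fun (measurableSet_shell hh k) fun x hx => ?_
  rw [quasiChar_eq_zero_mul hϖ χ s (ne_zero_of_mem_shell hϖ hx), ordK_eq_of_norm hϖ hx, mul_assoc]

lemma shellInt_eq_zero (hϖ : Irreducible ϖ)
    (hM : ∀ x, h x ≠ 0 → -(M : ℤ) ≤ ordK ϖ (h x)) (χ : UnitChar K) {k : ℤ} (hk : k < -(M : ℤ)) :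
    shellInt ϖ μ Φ h χ k = 0 := by
  have : shell ϖ h k = ∅ := by
    refine Set.eq_empty_of_forall_notMem fun x hx => ?_
    have := hM x (ne_zero_of_mem_shell hϖ hx)
    rw [ordK_eq_of_norm hϖ hx] at this
    omega
  rw [shellInt, this]; simp

lemma hasExpansion_integral (hϖ : Irreducible ϖ) (hΦ : Integrable Φ μ) (hh : Measurable h)
    (hM : ∀ x, h x ≠ 0 → -(M : ℤ) ≤ ordK ϖ (h x)) (χ : UnitChar K) :
    HasExpansion (resCard K) (fun s => ∫ x, Φ x * quasiChar ϖ χ s (h x) ∂μ)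
      (shellInt ϖ μ Φ h χ) :=
  ⟨⟨-(M : ℤ), fun _ hk => shellInt_eq_zero hϖ hM χ hk⟩,
    fun _ hs => hasSum_shellInt hϖ hΦ hh hM χ hs.le⟩

lemma tendsto_integral_quasiChar (hϖ : Irreducible ϖ) (hΦ : Integrable Φ μ) (hh : Measurable h)
    (hM : ∀ x, h x ≠ 0 → -(M : ℤ) ≤ ordK ϖ (h x)) (χ : UnitChar K) :
    Tendsto (fun s => ∫ x, Φ x * quasiChar ϖ χ s (h x) ∂μ) (𝓝[{s : ℂ | 0 < s.re}] 0)
      (𝓝 (∫ x, Φ x * quasiChar ϖ χ 0 (h x) ∂μ)) := by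
  have hq := one_lt_resCard hϖ
  have hq1 : (1 : ℝ) ≤ (resCard K : ℝ) ^ M := one_le_pow₀ (by exact_mod_cast hq.le)
  have hre : ∀ᶠ s : ℂ in 𝓝[{s : ℂ | 0 < s.re}] 0, 0 < s.re ∧ s.re < 1 := by
    have h1 : ∀ᶠ s : ℂ in 𝓝 0, s.re < 1 :=
      Complex.continuous_re.continuousAt.eventually_lt continuousAt_const (by simp)
    filter_upwards [self_mem_nhdsWithin, nhdsWithin_le_nhds h1] with s hs hs1
    exact ⟨hs, hs1⟩
  refine tendsto_integral_filter_of_dominated_convergence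
    (fun x => ‖Φ x‖ * (resCard K : ℝ) ^ M) ?_ ?_ (hΦ.norm.mul_const _) ?_
  · filter_upwards [hre] with s hs
    exact (integrable_mul_quasiChar hϖ hΦ hh hM χ hs.1.le).aestronglyMeasurable
  · filter_upwards [hre] with s hs
    refine Eventually.of_forall fun x => ?_
    rw [norm_mul]
    gcongr
    refine (norm_quasiChar_le hϖ χ hs.1.le (hM x)).trans ?_
    exact (Real.rpow_le_rpow_of_exponent_le hq1 hs.2.le).trans (Real.rpow_one _).le
  · refine Eventually.of_forall fun x => ?_
    refine tendsto_const_nhds.mul ?_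
    rcases eq_or_ne (h x) 0 with h0 | h0
    · simp only [h0, quasiChar_zero]; exact tendsto_const_nhds
    · refine tendsto_nhdsWithin_of_tendsto_nhds ?_
      unfold quasiChar
      refine tendsto_const_nhds.mul ?_
      refine (continuousAt_const_cpow ?_).tendsto
      rw [absK_of_ne_zero h0]
      have : (0 : ℝ) < (resCard K : ℝ) ^ (-ordK ϖ (h x)) :=
        zpow_pos (by exact_mod_cast (by omega : 0 < resCard K)) _
      exact_mod_cast this.ne'

lemma addChar_eq_one (hϖ : Irreducible ϖ) (hΨ : IsStandardAddChar ϖ Ψ) (u : (RK K)ˣ) {m k : ℤ}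
    (hmk : m ≤ k) {y : K} (hy : ‖y‖ = ‖(ϖ : K)‖ ^ k) :
    Ψ (((u : RK K) : K) * (ϖ : K) ^ (-m) * y) = 1 := by
  apply hΨ.1
  have hp := norm_unif_pos hϖ
  rw [norm_mul, norm_mul, norm_unit, one_mul, hy, norm_zpow, ← zpow_add₀ hp.ne']
  obtain ⟨d, hd⟩ := Int.eq_ofNat_of_zero_le (show 0 ≤ -m + k by omega)
  rw [hd, zpow_natCast]
  exact pow_le_one₀ hp.le (norm_unif_lt_one hϖ).le

lemma setIntegral_shell_of_le (hϖ : Irreducible ϖ) (hΨ : IsStandardAddChar ϖ Ψ) (hh : Measurable h)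
    (u : (RK K)ˣ) {m k : ℤ} (hmk : m ≤ k) :
    ∫ x in shell ϖ h k, Φ x * (Ψ (((u : RK K) : K) * (ϖ : K) ^ (-m) * h x) : ℂ) ∂μ =
      shellInt ϖ μ Φ h 1 k := by
  refine setIntegral_congr_fun (measurableSet_shell hh k) fun x hx => ?_
  rw [addChar_eq_one hϖ hΨ u hmk hx, quasiChar_eq hϖ 1 0 (ne_zero_of_mem_shell hϖ hx),
    charVal_of_norm _ (norm_acK hϖ (ne_zero_of_mem_shell hϖ hx))]
  simp

lemma setIntegral_shell_of_lt (hϖ : Irreducible ϖ)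
    (hΦ : Integrable Φ μ) (hh : Measurable h)
    (hM : ∀ x, h x ≠ 0 → -(M : ℤ) ≤ ordK ϖ (h x))
    (u : (RK K)ˣ) {m : ℤ} {c : ℕ} {E : Finset (UnitChar K)}
    (hE : ∀ w : (RK K)ˣ, ((Ψ (((w : RK K) : K) / (ϖ : K) ^ c) : Circle) : ℂ) =
        ∑ χ ∈ E, gaussianSum ϖ Ψ χ⁻¹ * (χ w : ℂ)) :
    ∫ x in shell ϖ h (m - c), Φ x * (Ψ (((u : RK K) : K) * (ϖ : K) ^ (-m) * h x) : ℂ) ∂μ =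
      ∑ χ ∈ E, gaussianSum ϖ Ψ χ⁻¹ * (χ u : ℂ) * shellInt ϖ μ Φ h χ (m - c) := by
  have h1 : ∀ χ ∈ E, gaussianSum ϖ Ψ χ⁻¹ * (χ u : ℂ) * shellInt ϖ μ Φ h χ (m - c) =
      ∫ x in shell ϖ h (m - c), gaussianSum ϖ Ψ χ⁻¹ * (χ u : ℂ) *
        (Φ x * quasiChar ϖ χ 0 (h x)) ∂μ := by
    intro χ _
    rw [shellInt, integral_const_mul]
  rw [Finset.sum_congr rfl h1, ← integral_finsetSum]
  · refine setIntegral_congr_fun (measurableSet_shell hh _) fun x hx => ?_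
    have hx0 := ne_zero_of_mem_shell hϖ hx
    have hn := norm_acK hϖ hx0
    have hord := ordK_eq_of_norm hϖ hx
    -- On the shell of order `m - c` one has `h = ac(h) ϖ^(m-c)`, so the argument of `Ψ` is the unit
    -- `u ac(h)` over `ϖ^c`.
    have harg : ((u : RK K) : K) * (ϖ : K) ^ (-m) * h x =
        (((u * toUnit _ hn : (RK K)ˣ) : RK K) : K) / (ϖ : K) ^ c := by
      rw [Units.val_mul, MulMemClass.coe_mul, toUnit_val, acK, hord]
      have h0 := unif_ne_zero hϖ
      rw [neg_sub, zpow_sub₀ h0, zpow_natCast, zpow_neg]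
      field_simp
    rw [harg, hE, Finset.mul_sum]
    refine Finset.sum_congr rfl fun χ _ => ?_
    rw [quasiChar_eq hϖ χ 0 hx0, charVal_of_norm _ hn, map_mul, Circle.coe_mul]
    simp only [neg_zero, Complex.cpow_zero, one_zpow, mul_one]
    ring
  · intro χ _
    exact ((integrable_mul_quasiChar hϖ hΦ hh hM χ (by simp)).integrableOn).const_mul _

/-- Oscillatory integrals in terms of zeta functions, for a measurable function `h` on a measure
space. -/
theorem integral_addChar_eq (hϖ : Irreducible ϖ) (hΨ : IsStandardAddChar ϖ Ψ)
    (hΦ : Integrable Φ μ) (hh : Measurable h)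
    (hM : ∀ x, h x ≠ 0 → -(M : ℤ) ≤ ordK ϖ (h x)) (h0 : ∀ᵐ x ∂μ, h x = 0 → Φ x = 0)
    {Z : UnitChar K → ℂ → ℂ} (hZ : Z = fun χ s => ∫ x, Φ x * quasiChar ϖ χ s (h x) ∂μ) :
    (∃ c, HasExpansion (resCard K) (trivTerm (resCard K) (Z 1)) c) ∧
    ∀ (u : (RK K)ˣ) (m : ℤ),
      {χ : UnitChar K | χ ≠ 1 ∧ gaussianSum ϖ Ψ χ⁻¹ * (χ u : ℂ) *
        coeffT (resCard K) (Z χ) (m - charConductor χ) ≠ 0}.Finite ∧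
      ∫ x, Φ x * (Ψ (((u : RK K) : K) * (ϖ : K) ^ (-m) * h x) : ℂ) ∂μ =
        Z 1 0 + coeffT (resCard K) (trivTerm (resCard K) (Z 1)) (m - 1) +
        ∑ᶠ (χ : UnitChar K) (_ : χ ≠ 1), gaussianSum ϖ Ψ χ⁻¹ * (χ u : ℂ) *
          coeffT (resCard K) (Z χ) (m - charConductor χ) := by
  classical
  have hq := one_lt_resCard hϖ
  have hqC : (resCard K : ℂ) - 1 ≠ 0 := by rw [sub_ne_zero]; exact_mod_cast hq.ne'
  set a : UnitChar K → ℤ → ℂ := fun χ => shellInt ϖ μ Φ h χ with ha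
  have hexp : ∀ χ, HasExpansion (resCard K) (Z χ) (a χ) := fun χ => by
    rw [hZ]; exact hasExpansion_integral hϖ hΦ hh hM χ
  have ha0 : ∀ χ, ∀ k < -(M : ℤ), a χ k = 0 := fun χ k hk => shellInt_eq_zero hϖ hM χ hk
  have hsum0 : HasSum (a 1) (Z 1 0) := by
    have := hasSum_shellInt (μ := μ) hϖ hΦ hh hM 1 (s := 0) (by simp)
    simpa [hZ, ha] using this
  -- Partial sums of the coefficients of `Z(s, 1)`, that is, the coefficients of `Z(s, 1) / (1 -
  -- t)`. Their bound comes from absolute convergence at `s = 0`.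
  set b : ℤ → ℂ := fun j => ∑ k ∈ Finset.Ico (-(M : ℤ)) (j + 1), a 1 k with hb
  have hbd : ∀ k, b k - b (k - 1) = a 1 k := by
    intro k
    simp only [hb, sub_add_cancel]
    by_cases hk : -(M : ℤ) ≤ k
    · have : Finset.Ico (-(M : ℤ)) (k + 1) = insert k (Finset.Ico (-(M : ℤ)) k) := by
        ext j; simp only [Finset.mem_Ico, Finset.mem_insert]; omega
      rw [this, Finset.sum_insert (by simp)]; ring
    · rw [Finset.Ico_eq_empty (by omega), Finset.Ico_eq_empty (by omega), ha0 1 k (by omega)]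
      simp
  have hb0 : ∀ k < -(M : ℤ), b k = 0 := by
    intro k hk
    simp only [hb]
    rw [Finset.Ico_eq_empty (by omega), Finset.sum_empty]
  have hB : ∀ k, ‖b k‖ ≤ ∑' k, ‖a 1 k‖ := fun k =>
    (norm_sum_le _ _).trans (hsum0.summable.norm.sum_le_tsum _ fun _ _ => norm_nonneg _)
  have htriv := HasExpansion.trivTerm hq (hexp 1) hb0 hbd hB
  refine ⟨⟨_, htriv⟩, fun u m => ?_⟩
  simp only [fun χ => (hexp χ).coeffT_eq hq, htriv.coeffT_eq hq]
  set G : UnitChar K → ℂ := fun χ =>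
    gaussianSum ϖ Ψ χ⁻¹ * (χ u : ℂ) * a χ (m - charConductor χ) with hG
  -- The slice `m - c(χ)` is empty once it lies below `-M`. If `m + M < 0` the truncation to `0` is
  -- harmless, since conductors are at least `1`.
  set T : Finset (UnitChar K) := (finite_charConductor_le (K := K) hϖ (m + M).toNat).toFinset
  have hT : ∀ χ, χ ∈ T ↔ charConductor χ ≤ (m + M).toNat := fun χ => by simp [T]
  have hGT : ∀ χ, G χ ≠ 0 → χ ∈ T := by
    intro χ hχ
    rw [hT]
    by_contra! hlt
    exact hχ (by simp only [hG]; rw [ha0 χ _ (by omega), mul_zero])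
  have hG1 : G 1 = -((resCard K : ℂ) - 1)⁻¹ * a 1 (m - 1) := by
    simp only [hG]
    rw [inv_one, gaussianSum_one hϖ hΨ, charConductor_one hϖ]
    have : ((1 : UnitChar K) u) = 1 := rfl
    rw [this]; simp
  refine ⟨T.finite_toSet.subset fun χ hχ => hGT χ hχ.2, ?_⟩
  have hfs : ∑ᶠ (χ : UnitChar K) (_ : χ ≠ 1), G χ = (∑ χ ∈ T, G χ) - G 1 := by
    rw [finsum_cond_eq_sum_of_cond_iff (t := T.erase 1) G fun {χ} hχ => by
      simp [hGT χ hχ]]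
    by_cases h1 : (1 : UnitChar K) ∈ T
    · rw [← Finset.add_sum_erase _ _ h1]; ring
    · rw [Finset.erase_eq_of_notMem h1]
      have : G 1 = 0 := by by_contra h; exact h1 (hGT 1 h)
      rw [this, sub_zero]
  set e : ℤ → ℂ := fun k =>
    ∫ x in shell ϖ h k, Φ x * (Ψ (((u : RK K) : K) * (ϖ : K) ^ (-m) * h x) : ℂ) ∂μ with he
  have hesum := hasSum_setIntegral_shell hϖ hh
    (integrable_mul_addChar hΨ hΦ hh (((u : RK K) : K) * (ϖ : K) ^ (-m)))
    (h0.mono fun x hx hx' => by rw [hx hx', zero_mul])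
  -- Outside the window `-M ≤ k < m` the oscillatory slice equals the slice of `Z(0, 1)`: either
  -- both are empty or `Ψ` is identically `1`. Thus `E - Z(0)` is a finite sum.
  have hdiff : ∀ k ∉ Finset.Ico (-(M : ℤ)) m, e k - a 1 k = 0 := by
    intro k hk
    rw [Finset.mem_Ico, not_and_or, not_le, not_lt] at hk
    rw [sub_eq_zero]
    rcases hk with hk | hk
    · rw [ha0 1 k hk]
      have : shell ϖ h k = ∅ := by
        refine Set.eq_empty_of_forall_notMem fun x hx => ?_
        have := hM x (ne_zero_of_mem_shell hϖ hx)
        rw [ordK_eq_of_norm hϖ hx] at this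
        omega
      simp only [he]
      rw [this]; simp
    · exact setIntegral_shell_of_le hϖ hΨ hh u hk
  have hmain := (hesum.sub hsum0).unique (hasSum_sum_of_ne_finset_zero hdiff)
  rw [Finset.sum_sub_distrib] at hmain
  -- Grouping the characters by conductor matches them with the slices, the slice `m - c` receiving
  -- those of conductor `c`.
  have hE : ∑ k ∈ Finset.Ico (-(M : ℤ)) m, e k = ∑ χ ∈ T, G χ := by
    have hmaps : ∀ χ ∈ T, m - (charConductor χ : ℤ) ∈ Finset.Ico (-(M : ℤ)) m := by
      intro χ hχ
      have h1 := (hT χ).1 hχ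
      have h2 := (charConductor_spec hϖ χ).1
      rw [Finset.mem_Ico]; omega
    rw [← Finset.sum_fiberwise_of_maps_to hmaps]
    refine Finset.sum_congr rfl fun k hk => ?_
    rw [Finset.mem_Ico] at hk
    obtain ⟨c, hc⟩ := Int.eq_ofNat_of_zero_le (show 0 ≤ m - k by omega)
    obtain rfl : k = m - c := by omega
    have hc1 : 1 ≤ c := by omega
    obtain ⟨E, hE1, hE2⟩ := exists_gaussianSum_expansion hϖ hΨ hc1
    simp only [he]
    rw [setIntegral_shell_of_lt hϖ hΦ hh hM u hE2]
    have hEeq : E = T.filter fun χ => m - (charConductor χ : ℤ) = m - c := by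
      ext χ
      rw [Finset.mem_filter, hE1, hT]
      omega
    rw [hEeq]
    refine Finset.sum_congr rfl fun χ hχ => ?_
    simp only [hG]
    rw [(Finset.mem_filter.1 hχ).2]
  rw [hE] at hmain
  have hbm : ∑ k ∈ Finset.Ico (-(M : ℤ)) m, a 1 k = b (m - 1) := by
    simp only [hb, sub_add_cancel]
  rw [hbm] at hmain
  have hgoal : ∫ x, Φ x * (Ψ (((u : RK K) : K) * (ϖ : K) ^ (-m) * h x) : ℂ) ∂μ =
      Z 1 0 + (∑ χ ∈ T, G χ - b (m - 1)) := by rw [← hmain]; ring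
  -- What remains is `-b(m-1) - a_1(m-1)/(q-1) = (b(m-2) - q b(m-1))/(q-1)`, where `a_1(m-1) =
  -- b(m-1) - b(m-2)`.
  rw [hgoal, hfs, hG1, ← hbd (m - 1)]
  field_simp
  ring

end Oscillatory

/-! ### Minors, and exchanging a coordinate for a linear form. -/

section LinearAlgebra

variable {K : Type*} [Field K] {n r : ℕ}

lemma exists_minor_ne_zero {J : Matrix (Fin r) (Fin n) K} (h : J.rank = r) :
    ∃ e : Fin r ↪o Fin n, (J.submatrix id e).det ≠ 0 := by
  classical
  obtain ⟨κ, a, ha, hspan, hli⟩ := exists_linearIndependent' K J.col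
  have hfin : Finite κ := Finite.of_injective a ha
  have := Fintype.ofFinite κ
  have hcard : Fintype.card κ = r := by
    rw [← finrank_span_eq_card hli, hspan, ← Matrix.rank_eq_finrank_span_cols, h]
  have hcard' : (Finset.univ.map ⟨a, ha⟩).card = r := by
    rw [Finset.card_map, Finset.card_univ, hcard]
  refine ⟨(Finset.univ.map ⟨a, ha⟩).orderEmbOfFin hcard', ?_⟩
  set e := (Finset.univ.map ⟨a, ha⟩).orderEmbOfFin hcard'
  have hmem : ∀ i, ∃ k, a k = e i := by
    intro i
    obtain ⟨k, -, hk⟩ := Finset.mem_map.1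
      (Finset.orderEmbOfFin_mem (Finset.univ.map ⟨a, ha⟩) hcard' i)
    exact ⟨k, hk⟩
  choose b hb using hmem
  have hbinj : Function.Injective b := by
    intro i j hij
    exact e.injective (by rw [← hb i, ← hb j, hij])
  have hli2 := hli.comp b hbinj
  rw [← isUnit_iff_ne_zero, ← Matrix.isUnit_iff_isUnit_det,
    ← Matrix.linearIndependent_cols_iff_isUnit]
  have heq : (J.submatrix id e).col = (J.col ∘ a) ∘ b := by
    funext i
    ext k
    change J k (e i) = J k (a (b i))
    rw [hb]
  rw [heq]
  exact hli2

/-- When the minor of `e` is nonzero, the coordinates outside the range of `e` separate the vectors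
of the kernel, which is the tangent space of `V`. -/
lemma eq_zero_of_minor_ne_zero {J : Matrix (Fin r) (Fin n) K} {e : Fin r ↪o Fin n}
    (he : (J.submatrix id e).det ≠ 0) {v : Fin n → K} (hv : J.mulVec v = 0)
    (hv' : ∀ j ∉ Set.range e, v j = 0) : v = 0 := by
  have h1 : (J.submatrix id e).mulVec (v ∘ e) = 0 := by
    rw [← hv]
    ext i
    simp only [Matrix.mulVec, dotProduct, Matrix.submatrix_apply, id, Function.comp_apply]
    refine Finset.sum_of_injOn e e.injective.injOn (by simp) ?_ (fun _ _ => rfl)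
    intro j _ hj
    rw [hv' j (by simpa using hj), mul_zero]
  have h2 := Matrix.eq_zero_of_mulVec_eq_zero he h1
  funext j
  by_cases hj : j ∈ Set.range e
  · obtain ⟨i, rfl⟩ := hj
    exact congrFun h2 i
  · exact hv' j hj

/-- Exchange argument: if no free coordinate could be traded for `ℓ`, each `j` would give a vector
of `ker J ∩ ker ℓ` whose only nonzero free coordinate is the `j`-th. These vectors span `ker J`, so
`ℓ` would vanish on `ker J`. -/
lemma exists_extra_coordinate {J : Matrix (Fin r) (Fin n) K} {e : Fin r ↪o Fin n}
    (he : (J.submatrix id e).det ≠ 0) {ℓ : Fin n → K}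
    (hℓ : ∃ v, J.mulVec v = 0 ∧ ℓ ⬝ᵥ v ≠ 0) :
    ∃ j ∉ Set.range e, ∀ v : Fin n → K, J.mulVec v = 0 → ℓ ⬝ᵥ v = 0 →
      (∀ k ∉ Set.range e, k ≠ j → v k = 0) → v = 0 := by
  classical
  by_contra! hcon
  choose! w hw1 hw2 hw3 hw4 using hcon
  have hwj : ∀ j ∉ Set.range e, w j j ≠ 0 := by
    intro j hj h0
    refine hw4 j hj (eq_zero_of_minor_ne_zero he (hw1 j hj) fun k hk => ?_)
    by_cases hkj : k = j
    · rw [hkj, h0]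
    · exact hw3 j hj k hk hkj
  obtain ⟨v, hv1, hv2⟩ := hℓ
  set S : Finset (Fin n) := Finset.univ.filter fun j => j ∉ Set.range e with hS
  have hmem : ∀ j, j ∈ S ↔ j ∉ Set.range e := fun j => by simp [hS]
  have h0 : v - ∑ j ∈ S, (v j / w j j) • w j = 0 := by
    refine eq_zero_of_minor_ne_zero he ?_ fun k hk => ?_
    · rw [Matrix.mulVec_sub, hv1, Matrix.mulVec_sum, zero_sub, neg_eq_zero]
      refine Finset.sum_eq_zero fun j hj => ?_
      rw [Matrix.mulVec_smul, hw1 j ((hmem j).1 hj), smul_zero]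
    · rw [Pi.sub_apply, Finset.sum_apply, Finset.sum_eq_single k]
      · rw [Pi.smul_apply, smul_eq_mul, div_mul_cancel₀ _ (hwj k hk), sub_self]
      · intro j hj hjk
        rw [Pi.smul_apply, hw3 j ((hmem j).1 hj) k hk (Ne.symm hjk), smul_zero]
      · intro h; exact absurd ((hmem k).2 hk) h
  apply hv2
  rw [sub_eq_zero.1 h0, dotProduct_sum]
  refine Finset.sum_eq_zero fun j hj => ?_
  rw [dotProduct_smul, hw2 j ((hmem j).1 hj), smul_zero]

lemma exists_mulVec_of_rank {J : Matrix (Fin (r + 1)) (Fin n) K} (h : J.rank = r + 1) :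
    ∃ v, (J.submatrix Fin.castSucc id).mulVec v = 0 ∧ J (Fin.last r) ⬝ᵥ v ≠ 0 := by
  have hr : LinearMap.range J.mulVecLin = ⊤ := by
    apply Submodule.eq_top_of_finrank_eq
    rw [Module.finrank_fin_fun]; exact h
  obtain ⟨v, hv⟩ := LinearMap.range_eq_top.1 hr (Pi.single (Fin.last r) 1)
  refine ⟨v, ?_, ?_⟩
  · ext i
    have := congrFun hv i.castSucc
    rw [Pi.single_eq_of_ne (Fin.castSucc_lt_last i).ne] at this
    exact this
  · have := congrFun hv (Fin.last r)
    rw [Pi.single_eq_same] at this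
    intro h0
    exact one_ne_zero (this.symm.trans h0)

end LinearAlgebra

/-! ### Consequences of strict differentiability. -/

section Calculus

variable {K : Type*} [NontriviallyNormedField K] {n r : ℕ}

/-- Near `x` the map `f - f'(x)` is Lipschitz with an arbitrarily small constant, and that constant
bounds the norm of its derivative `f'(y) - f'(x)`. -/
lemma continuousAt_fderiv_of_strict {E F : Type*} [NormedAddCommGroup E] [NormedSpace K E]
    [NormedAddCommGroup F] [NormedSpace K F] {f : E → F} {x : E}
    (h : ∀ᶠ y in 𝓝 x, HasStrictFDerivAt f (fderiv K f y) y) :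
    ContinuousAt (fderiv K f) x := by
  rw [Metric.continuousAt_iff']
  intro ε hε
  have hx := h.self_of_nhds
  obtain ⟨c, hc⟩ : ∃ c : NNReal, (c : ℝ) = ε / 2 := ⟨⟨ε / 2, by positivity⟩, rfl⟩
  obtain ⟨s, hs, hlip⟩ := hx.approximates_deriv_on_nhds (c := c)
    (Or.inr (by rw [← NNReal.coe_pos, hc]; exact half_pos hε))
  filter_upwards [h, eventually_mem_nhds_iff.2 hs] with y hy hys
  have h1 : HasFDerivAt (f - ⇑(fderiv K f x)) (fderiv K f y - fderiv K f x) y :=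
    hy.hasFDerivAt.sub (fderiv K f x).hasFDerivAt
  have h2 := h1.le_of_lipschitzOn hys hlip.lipschitzOnWith
  rw [dist_eq_norm]
  refine h2.trans_lt ?_
  rw [hc]; linarith

lemma fderiv_apply_eq_jacobian (g : Fin r → (Fin n → K) → K) (x v : Fin n → K) (i : Fin r) :
    fderiv K (g i) x v = (jacobian g x).mulVec v i := by
  classical
  have : v = ∑ j, v j • (Pi.single j 1 : Fin n → K) := by
    ext k; simp [Finset.sum_apply, Pi.single_apply]
  conv_lhs => rw [this]
  rw [map_sum]
  simp only [map_smul, smul_eq_mul, Matrix.mulVec, dotProduct, jacobian, Matrix.of_apply]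
  exact Finset.sum_congr rfl fun j _ => mul_comm _ _

variable [CompleteSpace K]

/-- Local injectivity of a strictly differentiable map completed by coordinates. -/
lemma exists_nhds_injective {m : ℕ} {G : Fin m → (Fin n → K) → K} {x0 : Fin n → K}
    (hG : ∀ i, HasStrictFDerivAt (G i) (fderiv K (G i) x0) x0) {T : Set (Fin n)}
    (hinj : ∀ v : Fin n → K, (jacobian G x0).mulVec v = 0 → (∀ j ∈ T, v j = 0) → v = 0) :
    ∃ O ∈ 𝓝 x0, ∀ x ∈ O, ∀ y ∈ O, (∀ i, G i x = G i y) → (∀ j ∈ T, x j = y j) → x = y := by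
  classical
  let H : (Fin n → K) → (Fin m → K) × (T → K) := fun x => (fun i => G i x, fun j => x j)
  let H' : (Fin n → K) →L[K] (Fin m → K) × (T → K) :=
    (ContinuousLinearMap.pi fun i => fderiv K (G i) x0).prod
      (ContinuousLinearMap.pi fun j : T => ContinuousLinearMap.proj (j : Fin n))
  have hH : HasStrictFDerivAt H H' x0 := by
    refine HasStrictFDerivAt.prodMk (hasStrictFDerivAt_pi.2 hG) (hasStrictFDerivAt_pi.2 fun j => ?_)
    exact (ContinuousLinearMap.proj (R := K) (φ := fun _ : Fin n => K) (j : Fin n)).hasStrictFDerivAt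
  have hker : LinearMap.ker H'.toLinearMap = ⊥ := by
    refine LinearMap.ker_eq_bot'.2 fun v hv => hinj v ?_ ?_
    · ext i
      rw [← fderiv_apply_eq_jacobian]
      exact congrFun (congrArg Prod.fst hv) i
    · intro j hj
      exact congrFun (congrArg Prod.snd hv) ⟨j, hj⟩
  -- The target may have larger dimension than the source. Composing with a linear left inverse of
  -- the derivative makes the derivative the identity, and the inverse function theorem applies.
  obtain ⟨P, hP⟩ := LinearMap.exists_leftInverse_of_injective _ hker
  let P' := LinearMap.toContinuousLinearMap P
  have hcomp : HasStrictFDerivAt (P' ∘ H)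
      ((ContinuousLinearEquiv.refl K (Fin n → K) : (Fin n → K) ≃L[K] (Fin n → K)) :
        (Fin n → K) →L[K] (Fin n → K)) x0 := by
    have h1 := P'.hasStrictFDerivAt.comp x0 hH
    have heq : ((ContinuousLinearEquiv.refl K (Fin n → K) : (Fin n → K) ≃L[K] (Fin n → K)) :
        (Fin n → K) →L[K] (Fin n → K)) = P'.comp H' := by
      ext1 v
      exact (LinearMap.congr_fun hP v).symm
    rw [heq]
    exact h1
  refine ⟨(hcomp.toOpenPartialHomeomorph _).source,
    (hcomp.toOpenPartialHomeomorph _).open_source.mem_nhds hcomp.mem_toOpenPartialHomeomorph_source,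
    fun x hx y hy h1 h2 => (hcomp.toOpenPartialHomeomorph _).injOn hx hy ?_⟩
  have : H x = H y := Prod.ext (funext h1) (funext fun j => h2 j j.2)
  change P' (H x) = P' (H y)
  rw [this]

end Calculus

/-! ### Upper bounds for the Gel'fand-Leray measure in coordinates. -/

section Slices

variable {K : Type*} [NontriviallyNormedField K] [IsPAdicField K] [MeasurableSpace K] [BorelSpace K]

instance isAddHaarMeasure_haarK : Measure.IsAddHaarMeasure (haarK K) := by
  unfold haarK; infer_instance

instance sigmaFinite_haarK : SigmaFinite (haarK K) := inferInstance

instance nullSingletonClass_haarK : NullSingletonClass (haarK K) := inferInstance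

/-- A measurable set with at most one point on each line parallel to a coordinate axis is null. -/
lemma pi_haarK_eq_zero {ι : Type*} [Fintype ι] {P : Set (ι → K)} (hP : MeasurableSet P) (j : ι)
    (hinj : ∀ x ∈ P, ∀ y ∈ P, (∀ k, k ≠ j → x k = y k) → x = y) :
    Measure.pi (fun _ : ι => haarK K) P = 0 := by
  classical
  rw [← lintegral_indicator_one hP]
  -- Fubini in the `j`-th variable: each line meets `P` in at most one point, and points are
  -- Haar-null.
  have h := lintegral_eq_of_lmarginal_eq (μ := fun _ : ι => haarK K) {j}
    (f := P.indicator 1) (g := fun _ => 0) (measurable_one.indicator hP) measurable_const ?_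
  · rw [h, lintegral_zero]
  funext x
  rw [lmarginal_singleton, lmarginal_singleton, lintegral_zero]
  have hsub : {t : K | Function.update x j t ∈ P}.Subsingleton := by
    intro t ht t' ht'
    have := hinj _ ht _ ht' fun k hk => by
      rw [Function.update_of_ne hk, Function.update_of_ne hk]
    simpa using congrFun this j
  have hzero : haarK K {t : K | Function.update x j t ∈ P} = 0 := hsub.measure_zero _
  beta_reduce
  have hm : Measurable fun t => P.indicator (1 : (ι → K) → ENNReal) (Function.update x j t) :=
    (measurable_one.indicator hP).comp (measurable_update x)
  rw [lintegral_eq_zero_iff hm]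
  have : ∀ᵐ t ∂haarK K, t ∉ {t : K | Function.update x j t ∈ P} := measure_eq_zero_iff_ae_notMem.1 hzero
  filter_upwards [this] with t ht
  exact Set.indicator_of_notMem ht _

variable {n r : ℕ}

lemma continuous_projCompl (e : Fin r ↪o Fin n) : Continuous (projCompl (K := K) e) :=
  continuous_pi fun j => continuous_apply (j : Fin n)

/-- The image of Haar measure under the inverse of a coordinate projection injective on `A`. -/
noncomputable def sliceMeasure (e : Fin r ↪o Fin n) (A : Set (Fin n → K)) : Measure (Fin n → K) :=
  (Measure.comap (fun x : A => projCompl e (x : Fin n → K)) (Measure.pi fun _ => haarK K)).map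
    Subtype.val

lemma sliceMeasure_apply {e : Fin r ↪o Fin n} {A S : Set (Fin n → K)} (hA : MeasurableSet A)
    (hinj : Set.InjOn (projCompl e) A) (hS : MeasurableSet S) :
    sliceMeasure e A S = Measure.pi (fun _ => haarK K) (projCompl e '' (S ∩ A)) := by
  have := hA.standardBorel
  -- By Lusin-Souslin, an injective continuous map on a standard Borel space is a measurable
  -- embedding.
  have hemb : MeasurableEmbedding (fun x : A => projCompl e (x : Fin n → K)) :=
    ((continuous_projCompl e).comp continuous_subtype_val).measurable.measurableEmbedding
      (Set.injOn_iff_injective.1 hinj)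
  rw [sliceMeasure, Measure.map_apply measurable_subtype_coe hS, hemb.comap_apply]
  congr 1
  ext y
  constructor
  · rintro ⟨x, hx, rfl⟩; exact ⟨x, ⟨hx, x.2⟩, rfl⟩
  · rintro ⟨x, ⟨hx, hxA⟩, rfl⟩; exact ⟨⟨x, hxA⟩, hx, rfl⟩

lemma chartMeasure_le {ϖ : RK K} {g : Fin r → (Fin n → K) → K} {V : Set (Fin n → K)}
    {e : Fin r ↪o Fin n} {A D S : Set (Fin n → K)} (hA : IsChartDomain g V e A)
    (hD : MeasurableSet D) (hinj : Set.InjOn (projCompl e) D) (hS : MeasurableSet S)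
    (hSD : S ∩ A ⊆ D) {C : ENNReal}
    (hC : ∀ x ∈ S ∩ A, ENNReal.ofReal (absK ϖ (minorDet g e x))⁻¹ ≤ C) :
    chartMeasure ϖ g e A S ≤ C * sliceMeasure e D S := by
  have hnull : sliceMeasure e A Aᶜ = 0 := by
    rw [sliceMeasure_apply hA.1 hA.2.2.1 hA.1.compl]; simp
  have hae : ∀ᵐ x ∂(sliceMeasure e A).restrict S,
      ENNReal.ofReal (absK ϖ (minorDet g e x))⁻¹ ≤ C := by
    rw [ae_restrict_iff' hS]
    filter_upwards [measure_eq_zero_iff_ae_notMem.1 hnull] with x hx hxS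
    exact hC x ⟨hxS, not_not.1 hx⟩
  change ((sliceMeasure e A).withDensity _) S ≤ _
  rw [withDensity_apply _ hS]
  refine (lintegral_mono_ae hae).trans ?_
  rw [setLIntegral_const]
  refine mul_le_mul_right ?_ C
  rw [sliceMeasure_apply hA.1 hA.2.2.1 hS, sliceMeasure_apply hD hinj hS]
  refine measure_mono (Set.image_mono fun x hx => ⟨hx.1, hSD hx⟩)

/-- A supremum of measures is controlled only through global upper bounds. The restriction of the
supremum to the complement of `O`, plus `ν`, is one, and on `O` only `ν` remains. -/
lemma gelfandLeray_le_of_forall {ϖ : RK K} {g : Fin r → (Fin n → K) → K} {V : Set (Fin n → K)}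
    {O : Set (Fin n → K)} (hO : MeasurableSet O) {ν : Measure (Fin n → K)}
    (h : ∀ e A, IsChartDomain g V e A → ∀ S ⊆ O, MeasurableSet S → chartMeasure ϖ g e A S ≤ ν S)
    {S : Set (Fin n → K)} (hS : S ⊆ O) : gelfandLeray ϖ g V S ≤ ν S := by
  have hle : gelfandLeray ϖ g V ≤ (gelfandLeray ϖ g V).restrict Oᶜ + ν := by
    conv_lhs => unfold gelfandLeray
    refine iSup_le fun e => iSup_le fun A => iSup_le fun hA => ?_
    refine Measure.le_iff.2 fun T hT => ?_
    have h1 : chartMeasure ϖ g e A ≤ gelfandLeray ϖ g V :=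
      le_iSup_of_le e (le_iSup_of_le A (le_iSup_of_le hA le_rfl))
    rw [Measure.add_apply, Measure.restrict_apply hT, ← measure_inter_add_sdiff T hO, add_comm,
      Set.sdiff_eq]
    exact add_le_add (h1 _) ((h e A hA _ Set.inter_subset_right (hT.inter hO)).trans
      (measure_mono Set.inter_subset_left))
  refine (hle S).trans ?_
  rw [Measure.add_apply]
  have : (gelfandLeray ϖ g V).restrict Oᶜ S = 0 := by
    refine le_antisymm ?_ bot_le
    refine (measure_mono hS).trans ?_
    rw [Measure.restrict_apply hO]; simp
  rw [this, zero_add]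

lemma exists_inv_absK_le {ϖ : RK K} (hϖ : Irreducible ϖ) {δ : ℝ} (hδ : 0 < δ) :
    ∃ C : ℝ, ∀ x : K, δ ≤ ‖x‖ → (absK ϖ x)⁻¹ ≤ C := by
  obtain ⟨k, hk⟩ := exists_pow_lt_of_lt_one hδ (norm_unif_lt_one hϖ)
  have hq := one_lt_resCard hϖ
  refine ⟨(resCard K : ℝ) ^ (k : ℤ), fun x hx => ?_⟩
  have hx0 : x ≠ 0 := norm_pos_iff.1 (hδ.trans_le hx)
  rw [absK_of_ne_zero hx0, ← zpow_neg, neg_neg]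
  refine zpow_le_zpow_right₀ (by exact_mod_cast hq.le) ?_
  by_contra! hlt
  have := (norm_le_zpow_iff hϖ hx0 (k := (k : ℤ))).2 hlt.le
  rw [zpow_natCast] at this
  linarith

variable {ϖ : RK K} {g : Fin r → (Fin n → K) → K} {W : Set (Fin n → K)}

lemma continuousAt_minorDet (hW : IsOpen W)
    (hg : ∀ x ∈ W, ∀ i, HasStrictFDerivAt (g i) (fderiv K (g i) x) x) (e : Fin r ↪o Fin n)
    {x0 : Fin n → K} (hx0 : x0 ∈ W) : ContinuousAt (minorDet g e) x0 := by
  have hJ : ContinuousAt (jacobian g) x0 := by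
    refine continuousAt_pi.2 fun i => continuousAt_pi.2 fun j => ?_
    have := continuousAt_fderiv_of_strict (K := K) (f := g i) (x := x0)
      (by filter_upwards [hW.mem_nhds hx0] with y hy using hg y hy i)
    exact this.clm_apply continuousAt_const
  have hcont : Continuous fun J : Matrix (Fin r) (Fin n) K => (J.submatrix id e).det :=
    (continuous_id.matrix_submatrix id e).matrix_det
  exact hcont.continuousAt.comp hJ

open Classical in
/-- Near a point of `V` at which the Jacobian matrix has full rank, the measure given by a
Gel'fand-Leray form is bounded by Haar measure in finitely many systems of coordinates. -/
lemma gelfandLeray_le (hϖ : Irreducible ϖ) (hW : IsOpen W)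
    (hg : ∀ x ∈ W, ∀ i, HasStrictFDerivAt (g i) (fderiv K (g i) x) x)
    {x0 : Fin n → K} (hx0 : x0 ∈ zeroSet W g) (hrank : (jacobian g x0).rank = r) :
    ∃ δ > 0, Metric.closedBall x0 δ ⊆ W ∧ ∃ C : ENNReal, C ≠ ⊤ ∧
      ∀ S ⊆ Metric.closedBall x0 δ, MeasurableSet S →
        gelfandLeray ϖ g (zeroSet W g) S ≤ ∑ e : Fin r ↪o Fin n, if minorDet g e x0 = 0 then 0
          else C * Measure.pi (fun _ => haarK K) (projCompl e '' (S ∩ zeroSet W g)) := by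
  have hx0W := hx0.1
  obtain ⟨e0, he0⟩ := exists_minor_ne_zero hrank
  change minorDet g e0 x0 ≠ 0 at he0
  have hd := norm_pos_iff.2 he0
  set d := ‖minorDet g e0 x0‖ with hdd
  have h1 : ∀ᶠ x in 𝓝 x0, d / 2 < ‖minorDet g e0 x‖ :=
    continuousAt_const.eventually_lt (continuousAt_minorDet hW hg e0 hx0W).norm
      (by rw [← hdd]; linarith)
  -- A minor vanishing at `x0` is not of largest norm anywhere near `x0`, so no chart domain for
  -- that `e` meets the neighbourhood.
  have h2 : ∀ᶠ x in 𝓝 x0, ∀ e, minorDet g e x0 = 0 → ‖minorDet g e x‖ < d / 2 := by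
    refine eventually_all.2 fun e => ?_
    by_cases he : minorDet g e x0 = 0
    · have := (continuousAt_minorDet hW hg e hx0W).norm.eventually_lt
        (continuousAt_const (y := d / 2)) (by rw [he, norm_zero]; linarith)
      filter_upwards [this] with x hx _ using hx
    · exact Eventually.of_forall fun x hx => absurd hx he
  have h3 : ∀ e : Fin r ↪o Fin n, ∃ O ∈ 𝓝 x0, minorDet g e x0 ≠ 0 → ∀ x ∈ O, ∀ y ∈ O,
      (∀ i, g i x = g i y) → (∀ j ∈ (Set.range e)ᶜ, x j = y j) → x = y := by
    intro e
    by_cases he : minorDet g e x0 = 0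
    · exact ⟨Set.univ, univ_mem, fun h => absurd he h⟩
    · obtain ⟨O, hO, h⟩ := exists_nhds_injective (T := (Set.range e)ᶜ) (hg x0 hx0W)
        fun v hv hv' => eq_zero_of_minor_ne_zero he hv hv'
      exact ⟨O, hO, fun _ => h⟩
  choose O hO hOinj using h3
  have h4 : ∀ᶠ x in 𝓝 x0, ∀ e, x ∈ O e := eventually_all.2 hO
  obtain ⟨δ, hδ, hball⟩ := Metric.nhds_basis_closedBall.mem_iff.1
    (((h1.and h2).and h4).and (hW.mem_nhds hx0W))
  obtain ⟨C, hC⟩ := exists_inv_absK_le (ϖ := ϖ) hϖ (half_pos hd)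
  refine ⟨δ, hδ, fun x hx => (hball hx).2, ENNReal.ofReal C, ENNReal.ofReal_ne_top, ?_⟩
  set D := Metric.closedBall x0 δ ∩ zeroSet W g with hD
  have hDclosed : IsClosed D := by
    have hcont : ContinuousOn (fun x i => g i x) (Metric.closedBall x0 δ) := fun x hx =>
      (continuousAt_pi.2 fun i => (hg x (hball hx).2 i).hasFDerivAt.continuousAt).continuousWithinAt
    have hDeq : D = Metric.closedBall x0 δ ∩ (fun x i => g i x) ⁻¹' {0} := by
      ext x
      simp only [hD, Set.mem_inter_iff, Set.mem_preimage, Set.mem_singleton_iff, funext_iff]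
      exact ⟨fun h => ⟨h.1, h.2.2⟩, fun h => ⟨h.1, (hball h.1).2, h.2⟩⟩
    rw [hDeq]
    exact hcont.preimage_isClosed_of_isClosed Metric.isClosed_closedBall isClosed_singleton
  have hDinj : ∀ e, minorDet g e x0 ≠ 0 → Set.InjOn (projCompl e) D := by
    intro e he x hx y hy hxy
    refine hOinj e he x ((hball hx.1).1.2 e) y ((hball hy.1).1.2 e) (fun i => ?_) fun j hj => ?_
    · rw [hx.2.2 i, hy.2.2 i]
    · exact congrFun hxy ⟨j, hj⟩
  -- The sum over all `e` dominates every chart measure at once. The constant `C` is uniform because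
  -- on a chart domain the maximal minor is at least the one of `e0`, hence exceeds `d / 2`.
  set ν : Measure (Fin n → K) := ∑ e : Fin r ↪o Fin n, if minorDet g e x0 = 0 then 0
    else ENNReal.ofReal C • sliceMeasure e D with hν
  intro S hS hSm
  have hle : gelfandLeray ϖ g (zeroSet W g) S ≤ ν S := by
    refine gelfandLeray_le_of_forall Metric.isClosed_closedBall.measurableSet ?_ hS
    intro e A hA T hT hTm
    by_cases he : minorDet g e x0 = 0
    · have hTA : T ∩ A = ∅ := by
        refine Set.eq_empty_of_forall_notMem fun x hx => ?_
        have hb := (hball (hT hx.1)).1.1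
        have := (hA.2.2.2 x hx.2).2 e0
        have := hb.2 e he
        linarith [hb.1]
      refine (chartMeasure_le hA MeasurableSet.empty (Set.injOn_empty _) hTm hTA.le (C := 0)
        (by rw [hTA]; simp)).trans ?_
      simp
    · refine (chartMeasure_le hA hDclosed.measurableSet (hDinj e he) hTm
        (fun x hx => ⟨hT hx.1, hA.2.1 hx.2⟩) (C := ENNReal.ofReal C) fun x hx => ?_).trans ?_
      · refine ENNReal.ofReal_le_ofReal (hC _ ?_)
        have hb := (hball (hT hx.1)).1.1
        exact hb.1.le.trans ((hA.2.2.2 x hx.2).2 e0)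
      · rw [hν, Measure.finsetSum_apply]
        refine le_trans (le_of_eq ?_) (Finset.single_le_sum (fun _ _ => bot_le)
          (Finset.mem_univ e))
        rw [if_neg he]; rfl
  refine hle.trans (le_of_eq ?_)
  rw [hν, Measure.finsetSum_apply]
  refine Finset.sum_congr rfl fun e _ => ?_
  by_cases he : minorDet g e x0 = 0
  · rw [if_pos he, if_pos he]; rfl
  · rw [if_neg he, if_neg he, Measure.smul_apply, smul_eq_mul,
      sliceMeasure_apply hDclosed.measurableSet (hDinj e he) hSm, hD, ← Set.inter_assoc,
      Set.inter_eq_left.2 hS]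

end Slices

/-! ### Finiteness on compact sets, and nullity of the zeros of the last function. -/

section GelfandLeray

variable {K : Type*} [NontriviallyNormedField K] [IsPAdicField K] [MeasurableSpace K] [BorelSpace K]
  {ϖ : RK K} {n r : ℕ} {W : Set (Fin n → K)}

lemma exists_nhds_gelfandLeray_eq_zero {g : Fin r → (Fin n → K) → K}
    (hg : ∀ x ∈ W, ∀ i, HasStrictFDerivAt (g i) (fderiv K (g i) x) x)
    {x0 : Fin n → K} (hx0 : x0 ∈ W) (hx0' : x0 ∉ zeroSet W g) :
    ∃ O ∈ 𝓝 x0, gelfandLeray ϖ g (zeroSet W g) O = 0 := by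
  obtain ⟨i, hi⟩ : ∃ i, g i x0 ≠ 0 := by
    by_contra! h; exact hx0' ⟨hx0, h⟩
  have hne : ∀ᶠ x in 𝓝 x0, g i x ≠ 0 := (hg x0 hx0 i).hasFDerivAt.continuousAt.eventually_ne hi
  obtain ⟨δ, hδ, hball⟩ := Metric.nhds_basis_closedBall.mem_iff.1 hne
  refine ⟨_, Metric.closedBall_mem_nhds x0 hδ, ?_⟩
  refine le_antisymm (gelfandLeray_le_of_forall (ν := 0)
    Metric.isClosed_closedBall.measurableSet ?_ subset_rfl) bot_le
  intro e A hA S hS hSm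
  have hSA : S ∩ A = ∅ := by
    refine Set.eq_empty_of_forall_notMem fun x hx => ?_
    exact hball (hS hx.1) ((hA.2.1 hx.2).2 i)
  refine (chartMeasure_le hA MeasurableSet.empty (Set.injOn_empty _) hSm hSA.le (C := 0)
    (by rw [hSA]; simp)).trans ?_
  simp

lemma exists_nhds_gelfandLeray_lt_top (hϖ : Irreducible ϖ) {g : Fin r → (Fin n → K) → K}
    (hW : IsOpen W) (hg : ∀ x ∈ W, ∀ i, HasStrictFDerivAt (g i) (fderiv K (g i) x) x)
    (hrank : ∀ x ∈ zeroSet W g, (jacobian g x).rank = r) {x0 : Fin n → K} (hx0 : x0 ∈ W) :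
    ∃ O ∈ 𝓝 x0, gelfandLeray ϖ g (zeroSet W g) O < ⊤ := by
  classical
  by_cases hV : x0 ∈ zeroSet W g
  · obtain ⟨δ, hδ, -, C, hC, h⟩ := gelfandLeray_le hϖ hW hg hV (hrank x0 hV)
    refine ⟨_, Metric.closedBall_mem_nhds x0 hδ,
      (h _ subset_rfl Metric.isClosed_closedBall.measurableSet).trans_lt ?_⟩
    refine ENNReal.sum_lt_top.2 fun e _ => ?_
    split_ifs
    · exact ENNReal.zero_lt_top
    · refine ENNReal.mul_lt_top hC.lt_top ?_
      refine (measure_mono (Set.image_mono Set.inter_subset_left)).trans_lt ?_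
      exact ((isCompact_closedBall x0 δ).image (continuous_projCompl e)).measure_lt_top
  · obtain ⟨O, hO, h⟩ := exists_nhds_gelfandLeray_eq_zero (ϖ := ϖ) hg hx0 hV
    exact ⟨O, hO, by rw [h]; exact ENNReal.zero_lt_top⟩

lemma gelfandLeray_singleton (hϖ : Irreducible ϖ) {g : Fin r → (Fin n → K) → K}
    (hW : IsOpen W) (hg : ∀ x ∈ W, ∀ i, HasStrictFDerivAt (g i) (fderiv K (g i) x) x)
    (hrank : ∀ x ∈ zeroSet W g, (jacobian g x).rank = r) (hrn : r < n)
    {x0 : Fin n → K} (hx0 : x0 ∈ W) :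
    gelfandLeray ϖ g (zeroSet W g) {x0} = 0 := by
  classical
  by_cases hV : x0 ∈ zeroSet W g
  · obtain ⟨δ, hδ, -, C, hC, h⟩ := gelfandLeray_le hϖ hW hg hV (hrank x0 hV)
    refine le_antisymm ((h {x0} (Set.singleton_subset_iff.2 (Metric.mem_closedBall_self hδ.le))
      (measurableSet_singleton _)).trans (le_of_eq ?_)) bot_le
    refine Finset.sum_eq_zero fun e _ => ?_
    split_ifs
    · rfl
    -- A free coordinate exists because `r < n`; without one, the product measure of a point would
    -- be `1`.
    · obtain ⟨j, hj⟩ : ∃ j, j ∉ Set.range e := by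
        by_contra! hsurj
        have := Fintype.card_le_of_surjective e hsurj
        simp only [Fintype.card_fin] at this
        omega
      have hsub : (projCompl e '' ({x0} ∩ zeroSet W g)).Subsingleton :=
        (Set.subsingleton_singleton.anti Set.inter_subset_left).image _
      rw [pi_haarK_eq_zero hsub.measurableSet ⟨j, hj⟩ (fun x hx y hy _ => hsub hx hy), mul_zero]
  · obtain ⟨O, hO, h⟩ := exists_nhds_gelfandLeray_eq_zero (ϖ := ϖ) hg hx0 hV
    exact measure_mono_null (Set.singleton_subset_iff.2 (mem_of_mem_nhds hO)) h

variable {G : Fin (r + 1) → (Fin n → K) → K}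

/-- At full rank the last function may replace a free coordinate `j`. On the common zero set the
remaining coordinates then determine the point, so its projection meets each line in direction `j`
at most once. -/
lemma exists_nhds_gelfandLeray_zeros (hϖ : Irreducible ϖ) (hW : IsOpen W)
    (hG : ∀ x ∈ W, ∀ i, HasStrictFDerivAt (G i) (fderiv K (G i) x) x)
    {x0 : Fin n → K} (hx0 : x0 ∈ zeroSet W fun i : Fin r => G i.castSucc)
    (hr : (jacobian (fun i : Fin r => G i.castSucc) x0).rank = r)
    (hr' : (jacobian G x0).rank = r + 1) :
    ∃ O ∈ 𝓝 x0, gelfandLeray ϖ (fun i : Fin r => G i.castSucc)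
      (zeroSet W fun i : Fin r => G i.castSucc) (O ∩ {x | G (Fin.last r) x = 0}) = 0 := by
  classical
  set g : Fin r → (Fin n → K) → K := fun i => G i.castSucc with hgd
  have hg : ∀ x ∈ W, ∀ i, HasStrictFDerivAt (g i) (fderiv K (g i) x) x :=
    fun x hx i => hG x hx i.castSucc
  obtain ⟨δ, hδ, hδW, C, hC, h⟩ := gelfandLeray_le hϖ hW hg hx0 hr
  have hinj : ∀ e : Fin r ↪o Fin n, ∃ O ∈ 𝓝 x0, minorDet g e x0 ≠ 0 → ∃ j ∉ Set.range e,
      ∀ x ∈ O, ∀ y ∈ O, (∀ i, G i x = G i y) → (∀ k ∉ Set.range e, k ≠ j → x k = y k) → x = y := by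
    intro e
    by_cases he : minorDet g e x0 = 0
    · exact ⟨Set.univ, univ_mem, fun h => absurd he h⟩
    · obtain ⟨j, hj, hjinj⟩ := exists_extra_coordinate (J := jacobian g x0) (e := e) he
        (exists_mulVec_of_rank hr')
      obtain ⟨O, hO, hOinj⟩ := exists_nhds_injective (T := {k | k ∉ Set.range e ∧ k ≠ j})
        (hG x0 hx0.1) fun v hv hv' => hjinj v (funext fun i => congrFun hv i.castSucc)
          (congrFun hv (Fin.last r)) fun k hk hkj => hv' k ⟨hk, hkj⟩
      exact ⟨O, hO, fun _ => ⟨j, hj, fun x hx y hy hxy hk =>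
        hOinj x hx y hy hxy fun k hk' => hk k hk'.1 hk'.2⟩⟩
  choose O hO hOinj using hinj
  obtain ⟨δ', hδ', hball⟩ := Metric.nhds_basis_closedBall.mem_iff.1
    (inter_mem (Metric.closedBall_mem_nhds x0 hδ) (Filter.iInter_mem.2 hO))
  have hcont : ∀ i, ContinuousOn (G i) (Metric.closedBall x0 δ') := fun i x hx =>
    (hG x (hδW (hball hx).1) i).hasFDerivAt.continuousAt.continuousWithinAt
  refine ⟨_, Metric.closedBall_mem_nhds x0 hδ', ?_⟩
  set S := Metric.closedBall x0 δ' ∩ {x | G (Fin.last r) x = 0} with hS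
  have hSclosed : IsClosed S :=
    (hcont (Fin.last r)).preimage_isClosed_of_isClosed Metric.isClosed_closedBall isClosed_singleton
  have hSV : S ∩ zeroSet W g = Metric.closedBall x0 δ' ∩ (fun x i => G i x) ⁻¹' {0} := by
    ext x
    simp only [hS, Set.mem_inter_iff, Set.mem_preimage, Set.mem_singleton_iff, funext_iff]
    constructor
    · rintro ⟨⟨h1, h2⟩, h3⟩
      exact ⟨h1, fun i => Fin.lastCases h2 h3.2 i⟩
    · rintro ⟨h1, h2⟩
      exact ⟨⟨h1, h2 _⟩, hδW (hball h1).1, fun i => h2 _⟩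
  have hSVcompact : IsCompact (S ∩ zeroSet W g) := by
    rw [hSV]
    exact (isCompact_closedBall x0 δ').of_isClosed_subset
      ((continuousOn_pi.2 hcont).preimage_isClosed_of_isClosed Metric.isClosed_closedBall
        isClosed_singleton) Set.inter_subset_left
  refine le_antisymm ((h S (fun x hx => (hball hx.1).1) hSclosed.measurableSet).trans
    (le_of_eq ?_)) bot_le
  refine Finset.sum_eq_zero fun e _ => ?_
  split_ifs with he
  · rfl
  obtain ⟨j, hj, hjinj⟩ := hOinj e he
  rw [pi_haarK_eq_zero (hSVcompact.image (continuous_projCompl e)).isClosed.measurableSet ⟨j, hj⟩,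
    mul_zero]
  rintro _ ⟨x, hx, rfl⟩ _ ⟨y, hy, rfl⟩ hxy
  have hmem : ∀ z ∈ S ∩ zeroSet W g, z ∈ O e := fun z hz =>
    Set.mem_iInter.1 (hball hz.1.1).2 e
  have : x = y := by
    refine hjinj x (hmem x hx) y (hmem y hy) (fun i => ?_) fun k hk hkj => ?_
    · rw [hSV] at hx hy
      exact (congrFun hx.2 i).trans (congrFun hy.2 i).symm
    · exact hxy ⟨k, hk⟩ fun h => hkj (congrArg Subtype.val h)
  rw [this]

/-- The measure given by a Gel'fand-Leray form is finite on compact sets, and the zeros of the last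
function have measure zero. -/
lemma gelfandLeray_compact (hϖ : Irreducible ϖ) (hW : IsOpen W)
    (hG : ∀ x ∈ W, ∀ i, HasStrictFDerivAt (G i) (fderiv K (G i) x) x) (hrn : r < n)
    (hr : ∀ x ∈ zeroSet W fun i : Fin r => G i.castSucc,
      (jacobian (fun i : Fin r => G i.castSucc) x).rank = r)
    (hr' : ∀ x ∈ W, x ≠ 0 → (∀ i, G i x = 0) → (jacobian G x).rank = r + 1)
    {C : Set (Fin n → K)} (hC : IsCompact C) (hCW : C ⊆ W) :
    gelfandLeray ϖ (fun i : Fin r => G i.castSucc)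
      (zeroSet W fun i : Fin r => G i.castSucc) C < ⊤ ∧
    gelfandLeray ϖ (fun i : Fin r => G i.castSucc)
      (zeroSet W fun i : Fin r => G i.castSucc) (C ∩ {x | G (Fin.last r) x = 0}) = 0 := by
  set g : Fin r → (Fin n → K) → K := fun i => G i.castSucc with hgd
  have hg : ∀ x ∈ W, ∀ i, HasStrictFDerivAt (g i) (fderiv K (g i) x) x :=
    fun x hx i => hG x hx i.castSucc
  constructor
  · refine hC.measure_lt_top_of_nhdsWithin fun x hx => ?_
    obtain ⟨O, hO, h⟩ := exists_nhds_gelfandLeray_lt_top hϖ hW hg hr (hCW hx)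
    exact ⟨O, mem_nhdsWithin_of_mem_nhds hO, h⟩
  · have h1 : gelfandLeray ϖ g (zeroSet W g) ((C ∩ {x | G (Fin.last r) x = 0}) \ {0}) = 0 := by
      refine measure_null_of_locally_null _ fun x hx => ?_
      have hxW := hCW hx.1.1
      have hx0 : x ≠ 0 := hx.2
      by_cases hV : x ∈ zeroSet W g
      · obtain ⟨O, hO, h⟩ := exists_nhds_gelfandLeray_zeros hϖ hW hG hV (hr x hV)
          (hr' x hxW hx0 fun i => Fin.lastCases hx.1.2 hV.2 i)
        refine ⟨O ∩ {x | G (Fin.last r) x = 0}, inter_mem (mem_nhdsWithin_of_mem_nhds hO) ?_, h⟩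
        filter_upwards [self_mem_nhdsWithin] with y hy using hy.1.2
      · obtain ⟨O, hO, h⟩ := exists_nhds_gelfandLeray_eq_zero (ϖ := ϖ) hg hxW hV
        exact ⟨O, mem_nhdsWithin_of_mem_nhds hO, h⟩
    by_cases h0 : (0 : Fin n → K) ∈ W
    · refine measure_mono_null (t := ((C ∩ {x | G (Fin.last r) x = 0}) \ {0}) ∪ {0}) ?_
        (measure_union_null h1 (gelfandLeray_singleton hϖ hW hg hr hrn h0))
      intro x hx
      by_cases hx0 : x = 0
      · exact Or.inr hx0
      · exact Or.inl ⟨hx, hx0⟩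
    · refine measure_mono_null (fun x hx => ?_) h1
      exact ⟨hx, fun hx0 => h0 (by rw [← Set.mem_singleton_iff.1 hx0]; exact hCW hx.1)⟩

end GelfandLeray

/-! ### Termwise strict differentiation of series. -/

section StrictDeriv

/-- Dominated convergence for the normalized remainders of the terms: each is at most twice the
Lipschitz constant and tends to `0` at the diagonal point `(x, x)`. -/
lemma hasStrictFDerivAt_tsum {K E F ι : Type*} [NontriviallyNormedField K] [NormedAddCommGroup E]
    [NormedSpace K E] [NormedAddCommGroup F] [NormedSpace K F] [CompleteSpace F]
    {f : ι → E → F} {f' : ι → E →L[K] F} {x : E} {s : Set E} (hs : s ∈ 𝓝 x) {u : ι → NNReal}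
    (hu : Summable fun i => (u i : ℝ)) (hlip : ∀ i, LipschitzOnWith (u i) (f i) s)
    (hf : ∀ i, HasStrictFDerivAt (f i) (f' i) x) (hsum : ∀ y ∈ s, Summable fun i => f i y) :
    HasStrictFDerivAt (fun y => ∑' i, f i y) (∑' i, f' i) x := by
  have hf'norm : ∀ i, ‖f' i‖ ≤ u i := fun i => (hf i).hasFDerivAt.le_of_lipschitzOn hs (hlip i)
  have hf'sum : Summable f' := Summable.of_norm_bounded hu hf'norm
  -- On the diagonal the quotient is `0 / 0 = 0`, so the limit may be taken over a full
  -- neighbourhood of `(x, x)`.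
  set G : ι → E × E → ℝ := fun i p => ‖f i p.1 - f i p.2 - f' i (p.1 - p.2)‖ / ‖p.1 - p.2‖ with hG
  have hs2 : ∀ᶠ p in 𝓝 (x, x), p.1 ∈ s ∧ p.2 ∈ s := by
    rw [nhds_prod_eq]; exact prod_mem_prod hs hs
  have hb : ∀ i, ∀ p : E × E, p.1 ∈ s → p.2 ∈ s →
      ‖f i p.1 - f i p.2 - f' i (p.1 - p.2)‖ ≤ 2 * u i * ‖p.1 - p.2‖ := by
    intro i p h1 h2
    have h3 := (hlip i).norm_sub_le h1 h2
    have h4 := (f' i).le_of_opNorm_le (hf'norm i) (p.1 - p.2)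
    have h5 := norm_sub_le (f i p.1 - f i p.2) (f' i (p.1 - p.2))
    linarith
  have hGb : ∀ p : E × E, p.1 ∈ s → p.2 ∈ s → ∀ i, ‖G i p‖ ≤ 2 * u i := by
    intro p h1 h2 i
    simp only [hG]
    rw [norm_div, norm_norm, norm_norm]
    exact div_le_of_le_mul₀ (norm_nonneg _) (by positivity) (hb i p h1 h2)
  have hlim : Tendsto (fun p => ∑' i, G i p) (𝓝 (x, x)) (𝓝 (∑' _ : ι, (0 : ℝ))) := by
    refine tendsto_tsum_of_dominated_convergence (bound := fun i => 2 * (u i : ℝ))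
      (hu.mul_left 2) (fun i => ?_) (hs2.mono fun p hp => hGb p hp.1 hp.2)
    exact (hf i).isLittleO.norm_norm.tendsto_div_nhds_zero
  rw [tsum_zero] at hlim
  refine HasStrictFDerivAt.of_isLittleO (Asymptotics.isLittleO_iff.2 fun ε hε => ?_)
  filter_upwards [hs2, hlim.eventually_lt_const hε] with p hp hlt
  rcases eq_or_ne (p.1 - p.2) 0 with h0 | h0
  · rw [sub_eq_zero.1 h0]; simp
  have hpos := norm_pos_iff.2 h0
  have happ : (∑' i, f' i) (p.1 - p.2) = ∑' i, f' i (p.1 - p.2) :=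
    ContinuousLinearMap.map_tsum (ContinuousLinearMap.apply K F (p.1 - p.2)) hf'sum
  have happsum : Summable fun i => f' i (p.1 - p.2) :=
    (ContinuousLinearMap.apply K F (p.1 - p.2)).summable hf'sum
  rw [happ, ← (hsum _ hp.1).tsum_sub (hsum _ hp.2), ← ((hsum _ hp.1).sub (hsum _ hp.2)).tsum_sub happsum]
  have hGsum : Summable fun i => G i p :=
    Summable.of_norm_bounded (hu.mul_left 2) (hGb p hp.1 hp.2)
  refine (tsum_of_norm_bounded (hGsum.mul_right ‖p.1 - p.2‖).hasSum fun i => ?_).trans ?_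
  · simp only [hG]; rw [div_mul_cancel₀ _ hpos.ne']
  · rw [tsum_mul_right]
    exact mul_le_mul_of_nonneg_right hlt.le hpos.le

lemma summable_pow_sum {τ : ℝ} (h0 : 0 ≤ τ) (h1 : τ < 1) (n : ℕ) :
    Summable fun m : Fin n → ℕ => τ ^ ∑ i, m i := by
  induction n with
  | zero => exact summable_of_hasFiniteSupport (Set.toFinite _)
  | succ n ih =>
    have h := (summable_geometric_of_lt_one h0 h1).mul_of_nonneg ih (fun _ => pow_nonneg h0 _)
      (fun _ => pow_nonneg h0 _)
    rw [← (Fin.consEquiv fun _ : Fin (n + 1) => ℕ).summable_iff]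
    refine h.congr fun m => ?_
    simp [Fin.consEquiv, Fin.sum_univ_succ, pow_add]

lemma summable_pow_degree {τ : ℝ} (h0 : 0 ≤ τ) (h1 : τ < 1) (n : ℕ) :
    Summable fun m : Fin n →₀ ℕ => τ ^ ∑ i, m i :=
  (summable_pow_sum h0 h1 n).comp_injective (i := fun m : Fin n →₀ ℕ => ⇑m) DFunLike.coe_injective

end StrictDeriv

/-! ### Convergent power series on a polydisc. -/

section PowerSeries

variable {K : Type*} [NontriviallyNormedField K] [IsUltrametricDist K] {n : ℕ}

/-- This is the ultrametric estimate with Lipschitz constant `σ^(k-1)`, multiplied through by `σ` to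
avoid the exponent `k - 1`. -/
lemma norm_pow_sub_le {σ : ℝ} {x y : K} (hx : ‖x‖ ≤ σ) (hy : ‖y‖ ≤ σ) (k : ℕ) :
    ‖x ^ k - y ^ k‖ * σ ≤ σ ^ k * ‖x - y‖ := by
  have hσ : 0 ≤ σ := (norm_nonneg _).trans hx
  induction k with
  | zero => simp
  | succ k ih =>
    have h1 : x ^ (k + 1) - y ^ (k + 1) = (x ^ k - y ^ k) * x + y ^ k * (x - y) := by ring
    rw [h1]
    refine (mul_le_mul_of_nonneg_right (IsUltrametricDist.norm_add_le_max _ _) hσ).trans ?_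
    rw [max_mul_of_nonneg _ _ hσ]
    refine max_le ?_ ?_
    · rw [norm_mul]
      calc ‖x ^ k - y ^ k‖ * ‖x‖ * σ = ‖x ^ k - y ^ k‖ * σ * ‖x‖ := by ring
        _ ≤ σ ^ k * ‖x - y‖ * σ := mul_le_mul ih hx (norm_nonneg _) (by positivity)
        _ = σ ^ (k + 1) * ‖x - y‖ := by ring
    · rw [norm_mul, norm_pow]
      calc ‖y‖ ^ k * ‖x - y‖ * σ ≤ σ ^ k * ‖x - y‖ * σ := by gcongr
        _ = σ ^ (k + 1) * ‖x - y‖ := by ring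

lemma norm_prod_pow_le {σ : ℝ} {x : Fin n → K} (hx : ‖x‖ ≤ σ) (s : Finset (Fin n))
    (m : Fin n → ℕ) : ‖∏ i ∈ s, x i ^ m i‖ ≤ σ ^ ∑ i ∈ s, m i := by
  rw [norm_prod, ← Finset.prod_pow_eq_pow_sum]
  refine Finset.prod_le_prod (fun _ _ => norm_nonneg _) fun i _ => ?_
  rw [norm_pow]
  exact pow_le_pow_left₀ (norm_nonneg _) ((norm_le_pi_norm x i).trans hx) _

lemma norm_prod_pow_sub_le {σ : ℝ} {x y : Fin n → K} (hx : ‖x‖ ≤ σ) (hy : ‖y‖ ≤ σ)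
    (s : Finset (Fin n)) (m : Fin n → ℕ) :
    ‖∏ i ∈ s, x i ^ m i - ∏ i ∈ s, y i ^ m i‖ * σ ≤ σ ^ (∑ i ∈ s, m i) * ‖x - y‖ := by
  have hσ : 0 ≤ σ := (norm_nonneg _).trans hx
  induction s using Finset.cons_induction with
  | empty => simp
  | cons a s ha ih =>
    rw [Finset.prod_cons, Finset.prod_cons, Finset.sum_cons]
    have h1 : x a ^ m a * ∏ i ∈ s, x i ^ m i - y a ^ m a * ∏ i ∈ s, y i ^ m i =
        (x a ^ m a - y a ^ m a) * ∏ i ∈ s, x i ^ m i +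
          y a ^ m a * (∏ i ∈ s, x i ^ m i - ∏ i ∈ s, y i ^ m i) := by ring
    have hxa := (norm_le_pi_norm x a).trans hx
    have hya := (norm_le_pi_norm y a).trans hy
    have hxy : ‖x a - y a‖ ≤ ‖x - y‖ := norm_le_pi_norm (x - y) a
    rw [h1]
    refine (mul_le_mul_of_nonneg_right (IsUltrametricDist.norm_add_le_max _ _) hσ).trans ?_
    rw [max_mul_of_nonneg _ _ hσ]
    refine max_le ?_ ?_
    · rw [norm_mul]
      calc ‖x a ^ m a - y a ^ m a‖ * ‖∏ i ∈ s, x i ^ m i‖ * σ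
          = ‖x a ^ m a - y a ^ m a‖ * σ * ‖∏ i ∈ s, x i ^ m i‖ := by ring
        _ ≤ σ ^ m a * ‖x - y‖ * σ ^ ∑ i ∈ s, m i :=
          mul_le_mul ((norm_pow_sub_le hxa hya _).trans (by gcongr)) (norm_prod_pow_le hx s m)
            (norm_nonneg _) (by positivity)
        _ = σ ^ (m a + ∑ i ∈ s, m i) * ‖x - y‖ := by rw [pow_add]; ring
    · rw [norm_mul, norm_pow, mul_assoc]
      calc ‖y a‖ ^ m a * (‖∏ i ∈ s, x i ^ m i - ∏ i ∈ s, y i ^ m i‖ * σ)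
          ≤ σ ^ m a * (σ ^ (∑ i ∈ s, m i) * ‖x - y‖) := by gcongr
        _ = σ ^ (m a + ∑ i ∈ s, m i) * ‖x - y‖ := by rw [pow_add]; ring

/-- The derivative of a monomial. -/
noncomputable def monomialDeriv (m : Fin n →₀ ℕ) (x : Fin n → K) : (Fin n → K) →L[K] K :=
  ∑ i, (∏ k ∈ Finset.univ.erase i, x k ^ m k) •
    ((m i : K) * x i ^ (m i - 1)) • ContinuousLinearMap.proj (R := K) (φ := fun _ : Fin n => K) i

lemma hasStrictFDerivAt_monomial (m : Fin n →₀ ℕ) (x : Fin n → K) :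
    HasStrictFDerivAt (fun y : Fin n → K => ∏ i, y i ^ m i) (monomialDeriv m x) x := by
  have h1 : ∀ i ∈ Finset.univ, HasStrictFDerivAt (fun y : Fin n → K => y i ^ m i)
      (((m i : K) * x i ^ (m i - 1)) •
        ContinuousLinearMap.proj (R := K) (φ := fun _ : Fin n => K) i) x := by
    intro i _
    have h2 := (ContinuousLinearMap.proj (R := K) (φ := fun _ : Fin n => K) i).hasStrictFDerivAt
      (x := x)
    have h3 := (hasStrictDerivAt_pow (m i) (x i)).comp_hasStrictFDerivAt x h2
    exact h3
  exact HasStrictFDerivAt.finsetProd h1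

lemma monomialDeriv_single (m : Fin n →₀ ℕ) (x : Fin n → K) (j : Fin n) :
    monomialDeriv m x (Pi.single j (x j)) = (m j : K) * ∏ i, x i ^ m i := by
  rw [monomialDeriv, _root_.sum_apply, Finset.sum_eq_single j]
  · rw [← Finset.mul_prod_erase _ _ (Finset.mem_univ j)]
    simp only [_root_.smul_apply, ContinuousLinearMap.proj_apply, Pi.single_eq_same,
      smul_eq_mul]
    rcases Nat.eq_zero_or_pos (m j) with h | h
    · simp [h]
    · have : x j ^ m j = x j ^ (m j - 1) * x j := by rw [← pow_succ, Nat.sub_add_cancel h]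
      rw [this]; ring
  · intro i _ hij
    simp [Pi.single_eq_of_ne hij]
  · simp

/-- The coefficients `d` are bounded on the polydisc of radius `ρ`. -/
def BoundedOn (d : (Fin n →₀ ℕ) → K) (ρ C : ℝ) : Prop := ∀ m, ‖d m‖ * ρ ^ (∑ i, m i) ≤ C

/-- The sum at `x` of the power series with coefficients `d`. -/
noncomputable def seriesSum (d : (Fin n →₀ ℕ) → K) (x : Fin n → K) : K :=
  ∑' m : Fin n →₀ ℕ, d m * ∏ i, x i ^ m i

variable {d : (Fin n →₀ ℕ) → K} {ρ C : ℝ}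

lemma BoundedOn.mul (hd : BoundedOn d ρ C) (hρ : 0 < ρ) {w : (Fin n →₀ ℕ) → K}
    (hw : ∀ m, ‖w m‖ ≤ 1) : BoundedOn (fun m => w m * d m) ρ C := fun m => by
  refine le_trans ?_ (hd m)
  rw [norm_mul]
  gcongr
  exact mul_le_of_le_one_left (norm_nonneg _) (hw m)

lemma BoundedOn.norm_le (hd : BoundedOn d ρ C) (hρ : 0 < ρ) {σ : ℝ} (hσ : 0 ≤ σ)
    (m : Fin n →₀ ℕ) : ‖d m‖ * σ ^ (∑ i, m i) ≤ C * (σ / ρ) ^ ∑ i, m i := by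
  have h := hd m
  have h2 : ‖d m‖ * σ ^ (∑ i, m i) = ‖d m‖ * ρ ^ (∑ i, m i) * (σ / ρ) ^ ∑ i, m i := by
    rw [mul_assoc, ← mul_pow, mul_div_cancel₀ _ hρ.ne']
  rw [h2]
  gcongr

variable [CompleteSpace K]

lemma BoundedOn.summable (hd : BoundedOn d ρ C) (hρ : 0 < ρ) {x : Fin n → K} (hx : ‖x‖ < ρ) :
    Summable fun m : Fin n →₀ ℕ => d m * ∏ i, x i ^ m i := by
  refine Summable.of_norm_bounded ((summable_pow_degree (div_nonneg (norm_nonneg x) hρ.le)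
    ((div_lt_one hρ).2 hx) n).mul_left C) fun m => ?_
  rw [norm_mul]
  refine le_trans ?_ (hd.norm_le hρ (norm_nonneg x) m)
  gcongr
  exact norm_prod_pow_le le_rfl _ _

lemma BoundedOn.hasStrictFDerivAt (hd : BoundedOn d ρ C) (hρ : 0 < ρ) {x : Fin n → K}
    (hx : ‖x‖ < ρ) :
    HasStrictFDerivAt (seriesSum d) (∑' m : Fin n →₀ ℕ, d m • monomialDeriv m x) x ∧
      Summable fun m : Fin n →₀ ℕ => d m • monomialDeriv m x := by
  obtain ⟨σ, hσ1, hσ2⟩ := exists_between hx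
  have hσ0 : 0 < σ := (norm_nonneg x).trans_lt hσ1
  set u : (Fin n →₀ ℕ) → NNReal := fun m =>
    ⟨‖d m‖ * σ ^ (∑ i, m i) / σ, by positivity⟩ with hu
  have hus : Summable fun m => (u m : ℝ) := by
    refine Summable.of_nonneg_of_le (fun m => (u m).2) (fun m => ?_)
      (((summable_pow_degree (div_nonneg hσ0.le hρ.le)
        ((div_lt_one hρ).2 hσ2) n).mul_left C).div_const σ)
    exact div_le_div_of_nonneg_right (hd.norm_le hρ hσ0.le m) hσ0.le
  have hs : Metric.ball (0 : Fin n → K) σ ∈ 𝓝 x := Metric.isOpen_ball.mem_nhds (by simpa using hσ1)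
  have hlip : ∀ m, LipschitzOnWith (u m) (fun y : Fin n → K => d m * ∏ i, y i ^ m i)
      (Metric.ball 0 σ) := by
    refine fun m => LipschitzOnWith.of_dist_le_mul fun y hy z hz => ?_
    rw [mem_ball_zero_iff] at hy hz
    rw [dist_eq_norm, dist_eq_norm, ← mul_sub, norm_mul]
    change _ ≤ ‖d m‖ * σ ^ (∑ i, m i) / σ * ‖y - z‖
    have h1 := norm_prod_pow_sub_le hy.le hz.le Finset.univ m
    rw [← le_div_iff₀ hσ0] at h1
    calc ‖d m‖ * ‖∏ i, y i ^ m i - ∏ i, z i ^ m i‖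
        ≤ ‖d m‖ * (σ ^ (∑ i, m i) * ‖y - z‖ / σ) := by gcongr
      _ = _ := by ring
  have hder : ∀ m, HasStrictFDerivAt (fun y : Fin n → K => d m * ∏ i, y i ^ m i)
      (d m • monomialDeriv m x) x := fun m => (hasStrictFDerivAt_monomial m x).const_mul (d m)
  refine ⟨hasStrictFDerivAt_tsum hs hus hlip hder fun y hy => ?_, ?_⟩
  · rw [mem_ball_zero_iff] at hy
    exact hd.summable hρ (hy.trans hσ2)
  · exact Summable.of_norm_bounded hus fun m =>
      (hder m).hasFDerivAt.le_of_lipschitzOn hs (hlip m)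

lemma BoundedOn.hasStrictFDerivAt_fderiv (hd : BoundedOn d ρ C) (hρ : 0 < ρ) {x : Fin n → K}
    (hx : ‖x‖ < ρ) : HasStrictFDerivAt (seriesSum d) (fderiv K (seriesSum d) x) x := by
  have h := (hd.hasStrictFDerivAt hρ hx).1
  rwa [h.hasFDerivAt.fderiv]

/-- The Euler operator `x_j ∂/∂x_j` keeps the monomials and multiplies coefficients by `m_j`. Since
integers have norm at most `1` here, the bound on the coefficients survives, and `f` and its
logarithmic derivatives can be treated alike. -/
lemma BoundedOn.mul_fderiv_single (hd : BoundedOn d ρ C) (hρ : 0 < ρ) {x : Fin n → K}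
    (hx : ‖x‖ < ρ) (j : Fin n) :
    x j * fderiv K (seriesSum d) x (Pi.single j 1) = seriesSum (fun m => (m j : K) * d m) x := by
  obtain ⟨h1, h2⟩ := hd.hasStrictFDerivAt hρ hx
  have hsingle : (Pi.single j (x j) : Fin n → K) = x j • Pi.single j 1 := by
    rw [← Pi.single_smul, smul_eq_mul, mul_one]
  rw [← smul_eq_mul, ← map_smul, ← hsingle, h1.hasFDerivAt.fderiv]
  have happ := ContinuousLinearMap.map_tsum
    (ContinuousLinearMap.apply K K (Pi.single j (x j) : Fin n → K)) h2
  refine happ.trans (tsum_congr fun m => ?_)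
  rw [ContinuousLinearMap.apply_apply, _root_.smul_apply, monomialDeriv_single,
    smul_eq_mul]
  ring

end PowerSeries

section Convergence

variable {K : Type*} [NontriviallyNormedField K] {n : ℕ}

lemma evalSeries_eq (f : MvPowerSeries (Fin n) K) :
    evalSeries f = seriesSum fun m => MvPowerSeries.coeff m f := rfl

/-- At the point with all coordinates `a`, the terms of the convergent series tend to `0` and so are
bounded. -/
lemma ConvergesOn.boundedOn {f : MvPowerSeries (Fin n) K} {U : Set (Fin n → K)}
    (hf : ConvergesOn f U) {a : K} (ha : (fun _ => a) ∈ U) :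
    ∃ C, BoundedOn (fun m => MvPowerSeries.coeff m f) ‖a‖ C := by
  have h := (hf _ ha).tendsto_cofinite_zero.norm.bddAbove_range_of_cofinite
  obtain ⟨C, hC⟩ := h
  refine ⟨C, fun m => ?_⟩
  have := hC ⟨m, rfl⟩
  simpa [Finset.prod_pow_eq_pow_sum] using this

end Convergence

/-! ### Monomials and truncation of a series to a finite set of them. -/

section Monomials

variable {K : Type*} [NontriviallyNormedField K] {n : ℕ}

/-- The value of the monomial `x ^ m` at `z`. -/
def mono (z : Fin n → K) (m : Fin n →₀ ℕ) : K := ∏ i, z i ^ m i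

lemma mono_add (z : Fin n → K) (a b : Fin n →₀ ℕ) : mono z (a + b) = mono z a * mono z b := by
  simp [mono, pow_add, Finset.prod_mul_distrib]

lemma norm_mono (z : Fin n → K) (m : Fin n →₀ ℕ) : ‖mono z m‖ = ∏ i, ‖z i‖ ^ m i := by
  simp [mono]

lemma mono_ne_zero {z : Fin n → K} {I : Set (Fin n)} (hz : ∀ j ∈ I, z j ≠ 0) {m : Fin n →₀ ℕ}
    (hm : ∀ j ∉ I, m j = 0) : mono z m ≠ 0 := by
  refine Finset.prod_ne_zero_iff.2 fun j _ => ?_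
  by_cases hj : j ∈ I
  · exact pow_ne_zero _ (hz j hj)
  · rw [hm j hj]; simp

lemma mono_eq_zero {z : Fin n → K} {m : Fin n →₀ ℕ} {j : Fin n} (hz : z j = 0) (hm : m j ≠ 0) :
    mono z m = 0 :=
  Finset.prod_eq_zero (Finset.mem_univ j) (by rw [hz, zero_pow hm])

lemma continuous_mono (m : Fin n →₀ ℕ) : Continuous fun z : Fin n → K => mono z m :=
  continuous_finsetProd _ fun i _ => (continuous_apply i).pow _

lemma seriesSum_eq (d : (Fin n →₀ ℕ) → K) (z : Fin n → K) :
    seriesSum d z = ∑' m, d m * mono z m := rfl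

variable [IsUltrametricDist K]

lemma norm_le_of_hasSum {ι : Type*} {g : ι → K} {a : K} (h : HasSum g a) {B : ℝ} (hB : 0 ≤ B)
    (hg : ∀ i, ‖g i‖ ≤ B) : ‖a‖ ≤ B :=
  le_of_tendsto h.norm (Eventually.of_forall fun _ =>
    IsUltrametricDist.norm_sum_le_of_forall_le_of_nonneg hB fun i _ => hg i)

/-- A power series is close to its part supported on `B`, relative to a monomial that dominates. -/
lemma norm_seriesSum_sub_le [CompleteSpace K] {d : (Fin n →₀ ℕ) → K} {ρ C : ℝ}
    (hd : BoundedOn d ρ C) (hρ : 0 < ρ) {z : Fin n → K} (hz : ‖z‖ < ρ) {I : Set (Fin n)}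
    (hzI : ∀ j ∉ I, z j = 0) {N : Fin n → ℕ} {B : Finset (Fin n →₀ ℕ)}
    (hB : ∀ m, d m ≠ 0 → (∀ j ∉ I, m j = 0) → m ∉ B → ∃ j ∈ I, N j < m j)
    {m0 : Fin n →₀ ℕ} (hm0 : ∀ j ∈ I, ‖mono z (Finsupp.single j (N j))‖ ≤ ‖mono z m0‖) :
    ‖seriesSum d z - ∑ b ∈ B, d b * mono z b‖ ≤
      (C * (∑ j, (ρ ^ N j)⁻¹) * ρ⁻¹) * ‖z‖ * ‖mono z m0‖ := by
  classical
  have hC : 0 ≤ C := le_trans (by positivity) (hd 0)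
  have hsum : HasSum (fun m => d m * mono z m) (seriesSum d z) := (hd.summable hρ hz).hasSum
  have hfin : HasSum (fun m => if m ∈ B then d m * mono z m else 0)
      (∑ b ∈ B, d b * mono z b) := by
    have : HasSum (fun m => if m ∈ B then d m * mono z m else 0)
        (∑ b ∈ B, if b ∈ B then d b * mono z b else 0) :=
      hasSum_sum_of_ne_finset_zero fun b hb => if_neg hb
    rwa [Finset.sum_congr rfl fun b hb => if_pos hb] at this
  refine norm_le_of_hasSum (hsum.sub hfin) (by positivity) fun m => ?_
  by_cases hmB : m ∈ B
  · rw [if_pos hmB, sub_self, norm_zero]; positivity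
  rw [if_neg hmB, sub_zero]
  by_cases hdm : d m = 0
  · rw [hdm, zero_mul, norm_zero]; positivity
  by_cases hmI : ∀ j ∉ I, m j = 0
  -- The monomial is `x_j^(N_j)`, which `m0` dominates, times a monomial of degree at least `1`,
  -- which gains the factor `‖z‖ / ρ`. Summing `ρ^(-N_j)` over `j` makes the constant uniform.
  · obtain ⟨j, hj, hNj⟩ := hB m hdm hmI hmB
    obtain ⟨m', rfl⟩ : ∃ m', m = Finsupp.single j (N j) + m' :=
      ⟨m - Finsupp.single j (N j), by
        rw [add_tsub_cancel_of_le]; exact Finsupp.single_le_iff.2 hNj.le⟩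
    have hm' : 1 ≤ ∑ i, m' i := by
      have h1 : m' j ≤ ∑ i, m' i := Finset.single_le_sum (fun _ _ => Nat.zero_le _) (Finset.mem_univ j)
      simp only [Finsupp.add_apply, Finsupp.single_eq_same] at hNj
      omega
    have h1 := hd (Finsupp.single j (N j) + m')
    have h2 : ∑ i, (Finsupp.single j (N j) + m') i = N j + ∑ i, m' i := by
      simp [Finset.sum_add_distrib, Finsupp.single_apply]
    rw [h2, pow_add] at h1
    have h3 : ‖mono z m'‖ ≤ ‖z‖ ^ ∑ i, m' i := norm_prod_pow_le le_rfl _ _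
    have h4 : ‖z‖ ^ (∑ i, m' i) ≤ ρ ^ (∑ i, m' i) * (ρ⁻¹ * ‖z‖) := by
      have h5 : (‖z‖ / ρ) ^ (∑ i, m' i) ≤ ‖z‖ / ρ :=
        pow_le_of_le_one (by positivity) ((div_le_one hρ).2 hz.le) (by omega)
      rw [div_pow, div_le_iff₀ (by positivity)] at h5
      exact h5.trans (le_of_eq (by ring))
    have h6 : (ρ ^ N j)⁻¹ ≤ ∑ j, (ρ ^ N j)⁻¹ :=
      Finset.single_le_sum (f := fun j => (ρ ^ N j)⁻¹) (fun _ _ => by positivity) (Finset.mem_univ j)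
    have hNpos : 0 < ρ ^ N j := by positivity
    rw [mono_add, norm_mul, norm_mul]
    set c := ‖d (Finsupp.single j (N j) + m')‖
    calc c * (‖mono z (Finsupp.single j (N j))‖ * ‖mono z m'‖)
        ≤ c * (‖mono z m0‖ * (ρ ^ (∑ i, m' i) * (ρ⁻¹ * ‖z‖))) := by
          gcongr
          · exact hm0 j hj
          · exact h3.trans h4
      _ = (c * (ρ ^ N j * ρ ^ (∑ i, m' i))) * (ρ ^ N j)⁻¹ * ρ⁻¹ * ‖z‖ * ‖mono z m0‖ := by
          field_simp
      _ ≤ C * (∑ j, (ρ ^ N j)⁻¹) * ρ⁻¹ * ‖z‖ * ‖mono z m0‖ := by gcongr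
  · push Not at hmI
    obtain ⟨j, hj, hmj⟩ := hmI
    rw [mono_eq_zero (hzI j hj) hmj, mul_zero, norm_zero]; positivity

end Monomials

/-! ### Faces of the Newton polyhedron. -/

section Newton

variable {K : Type*} [NontriviallyNormedField K] {n : ℕ}

/-- For a positive weight, neither adding the orthant nor taking the convex hull lowers the minimum,
so it suffices to compare the monomials that occur in `f`. -/
lemma mem_firstMeetLocus_iff {f : MvPowerSeries (Fin n) K} {a : Fin n → ℝ} (ha : ∀ i, 0 < a i)
    {m : Fin n →₀ ℕ} (hm : MvPowerSeries.coeff m f ≠ 0) :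
    (fun i => (m i : ℝ)) ∈ firstMeetLocus a (newtonPolyhedron f) ↔
      ∀ m' : Fin n →₀ ℕ, MvPowerSeries.coeff m' f ≠ 0 →
        ∑ i, a i * (m i : ℝ) ≤ ∑ i, a i * (m' i : ℝ) := by
  have hmem : ∀ m' : Fin n →₀ ℕ, MvPowerSeries.coeff m' f ≠ 0 →
      (fun i => (m' i : ℝ)) ∈ newtonPolyhedron f := fun m' hm' =>
    subset_convexHull ℝ _ ⟨m', hm', fun i => le_rfl⟩
  constructor
  · intro h m' hm'
    exact h.2 _ (hmem m' hm')
  · intro h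
    refine ⟨hmem m hm, fun y hy => ?_⟩
    have hconv : Convex ℝ {y : Fin n → ℝ | a ⬝ᵥ (fun i => (m i : ℝ)) ≤ a ⬝ᵥ y} :=
      convex_halfSpace_ge (f := fun y => a ⬝ᵥ y)
        ⟨fun x y => dotProduct_add a x y, fun c x => dotProduct_smul c a x⟩ _
    refine convexHull_min ?_ hconv hy
    rintro y ⟨m', hm', hy'⟩
    refine (h m' hm').trans (Finset.sum_le_sum fun i _ => ?_)
    exact mul_le_mul_of_nonneg_left (hy' i) (ha i).le

lemma linearIndependent_row_of_rank {l : ℕ} {A : Matrix (Fin l) (Fin n) K} (h : A.rank = l) :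
    LinearIndependent K A.row := by
  rw [linearIndependent_iff_card_eq_finrank_span, Set.finrank, ← Matrix.rank_eq_finrank_span_row, h,
    Fintype.card_fin]

end Newton

/-! ### Limits of monomial ratios and the face they determine. -/

section UltrafilterLimits

variable {K : Type*} [NontriviallyNormedField K] [IsPAdicField K] {n : ℕ}

/-- Finitely many monomials compete, so the ultrafilter selects one that is largest throughout.
Ratios to it lie in the compact unit ball and hence converge. -/
lemma exists_dominant_monomial {𝒰 : Ultrafilter (Fin n → K)} {B : Finset (Fin n →₀ ℕ)}
    (hB : B.Nonempty) (hne : ∀ b ∈ B, ∀ᶠ z in (𝒰 : Filter (Fin n → K)), mono z b ≠ 0) :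
    ∃ m0 ∈ B, ∃ ℓ : (Fin n →₀ ℕ) → K, ℓ m0 = 1 ∧ ∀ b ∈ B,
      (∀ᶠ z in (𝒰 : Filter (Fin n → K)), ‖mono z b‖ ≤ ‖mono z m0‖) ∧
      Tendsto (fun z => mono z b / mono z m0) 𝒰 (𝓝 (ℓ b)) := by
  classical
  obtain ⟨m0, hm0, hmax⟩ := (Ultrafilter.eventually_exists_mem_iff (f := 𝒰) (is := (B : Set _))
    (P := fun m0 z => ∀ b ∈ B, ‖mono z b‖ ≤ ‖mono z m0‖) B.finite_toSet).1
    (Eventually.of_forall fun z => B.exists_max_image (fun b => ‖mono z b‖) hB)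
  have hlim : ∀ b, ∃ x, b ∈ B → Tendsto (fun z : Fin n → K => mono z b / mono z m0) 𝒰 (𝓝 x) := by
    intro b
    by_cases hb : b ∈ B
    · have hmem : Metric.closedBall (0 : K) 1 ∈ 𝒰.map fun z => mono z b / mono z m0 := by
        change ∀ᶠ z in (𝒰 : Filter (Fin n → K)), mono z b / mono z m0 ∈ Metric.closedBall (0 : K) 1
        filter_upwards [hmax] with z hz
        rw [mem_closedBall_zero_iff, norm_div]
        exact div_le_one_of_le₀ (hz b hb) (norm_nonneg _)
      obtain ⟨x, -, hx⟩ := (isCompact_closedBall (0 : K) 1).ultrafilter_le_nhds' _ hmem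
      exact ⟨x, fun _ => hx⟩
    · exact ⟨0, fun h => absurd h hb⟩
  choose ℓ hℓ using hlim
  refine ⟨m0, hm0, ℓ, ?_, fun b hb => ⟨hmax.mono fun z hz => hz b hb, hℓ b hb⟩⟩
  refine tendsto_nhds_unique (hℓ m0 hm0) (tendsto_const_nhds.congr' ?_)
  filter_upwards [hne m0 hm0] with z hz
  rw [div_self hz]

/-- Limits of ratios of monomials along an ultrafilter are realized by a point with nonzero
coordinates, and the non-vanishing ones form faces for a common weight. -/
lemma exists_point_and_weight {ϖ : RK K} (hϖ : Irreducible ϖ) {l : ℕ}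
    {𝒰 : Ultrafilter (Fin n → K)} (h𝒰 : (𝒰 : Filter (Fin n → K)) ≤ 𝓝 0) {I : Set (Fin n)}
    (hI : ∀ j ∈ I, ∀ᶠ z in (𝒰 : Filter (Fin n → K)), z j ≠ 0)
    {B : Fin l → Finset (Fin n →₀ ℕ)} (hBI : ∀ i, ∀ b ∈ B i, ∀ j ∉ I, b j = 0)
    {m0 : Fin l → Fin n →₀ ℕ} (hm0 : ∀ i, m0 i ∈ B i) {ℓ : Fin l → (Fin n →₀ ℕ) → K}
    (hℓ : ∀ i, ∀ b ∈ B i, Tendsto (fun z => mono z b / mono z (m0 i)) 𝒰 (𝓝 (ℓ i b)))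
    {ε : ℝ} (hε : 0 < ε) :
    ∃ w : Fin n → K, ‖w‖ < ε ∧ (∀ j, w j ≠ 0) ∧
      (∀ i, ∀ b ∈ B i, ℓ i b ≠ 0 → mono w b = ℓ i b * mono w (m0 i)) ∧
      ∃ β : Fin n → ℝ, (∀ j, 0 < β j) ∧
        (∀ i, ∀ b ∈ B i, ℓ i b ≠ 0 → ∑ j, β j * (b j : ℝ) = ∑ j, β j * (m0 i j : ℝ)) ∧
        (∀ i, ∀ b ∈ B i, ℓ i b = 0 → ∑ j, β j * (m0 i j : ℝ) < ∑ j, β j * (b j : ℝ)) ∧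
        ∀ i, ∀ j ∉ I, ∑ k, β k * (m0 i k : ℝ) < β j := by
  classical
  have hp := norm_unif_pos hϖ
  have hϖ0 := unif_ne_zero hϖ
  have hnz : ∀ᶠ z in (𝒰 : Filter (Fin n → K)), ∀ j ∈ I, z j ≠ 0 := by
    refine eventually_all.2 fun j => ?_
    by_cases hj : j ∈ I
    · exact (hI j hj).mono fun z hz _ => hz
    · exact Eventually.of_forall fun z h => absurd h hj
  have hsmall : ∀ δ > 0, ∀ᶠ z in (𝒰 : Filter (Fin n → K)), ‖z‖ < δ := fun δ hδ =>
    h𝒰 (by simpa [Metric.ball, dist_zero_right] using Metric.ball_mem_nhds (0 : Fin n → K) hδ)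
  have heq : ∀ᶠ z in (𝒰 : Filter (Fin n → K)), ∀ i, ∀ b ∈ B i, ℓ i b ≠ 0 →
      ‖mono z b / mono z (m0 i)‖ = ‖ℓ i b‖ := by
    refine eventually_all.2 fun i => (Finset.eventually_all _).2 fun b hb => ?_
    by_cases h : ℓ i b = 0
    · exact Eventually.of_forall fun z h' => absurd h h'
    · have := (hℓ i b hb).eventually (Metric.ball_mem_nhds _ (norm_pos_iff.2 h))
      filter_upwards [this] with z hz _
      rw [dist_eq_norm] at hz
      exact norm_eq_of_norm_sub_lt hz
  -- A reference point, already so deep that each ratio with nonzero limit has the norm of its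
  -- limit.
  obtain ⟨z0, ⟨hz0, hz0ε⟩, hz0eq⟩ := ((hnz.and (hsmall ε hε)).and heq).exists
  have hlt : ∀ᶠ z in (𝒰 : Filter (Fin n → K)), ∀ i, ∀ b ∈ B i, ℓ i b = 0 →
      ‖mono z b / mono z (m0 i)‖ < ‖mono z0 b / mono z0 (m0 i)‖ := by
    refine eventually_all.2 fun i => (Finset.eventually_all _).2 fun b hb => ?_
    by_cases h : ℓ i b = 0
    · have hpos : 0 < ‖mono z0 b / mono z0 (m0 i)‖ := norm_pos_iff.2 (div_ne_zero
        (mono_ne_zero hz0 (hBI i b hb)) (mono_ne_zero hz0 (hBI i _ (hm0 i))))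
      have := (hℓ i b hb).norm.eventually_lt_const (by rw [h, norm_zero]; exact hpos)
      filter_upwards [this] with z hz _ using hz
    · exact Eventually.of_forall fun z h' => absurd h' h
  have hlt' : ∀ᶠ z in (𝒰 : Filter (Fin n → K)), ∀ j ∈ I, ‖z j‖ < ‖z0 j‖ := by
    refine eventually_all.2 fun j => ?_
    by_cases hj : j ∈ I
    · filter_upwards [hsmall _ (norm_pos_iff.2 (hz0 j hj))] with z hz _
      exact (norm_le_pi_norm z j).trans_lt hz
    · exact Eventually.of_forall fun z h => absurd h hj
  obtain ⟨κ, hκ0, hκ⟩ := NormedField.exists_norm_lt K hε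
  rw [norm_pos_iff] at hκ0
  -- Multiplying `z` by these powers of `ϖ` restores the coordinate norms of `z0`, so the rescaled
  -- points stay on compact spheres and their limit `w` has nonzero coordinates. Coordinates outside
  -- `I`, absent from all the monomials used, get the arbitrary small value `κ`.
  set lam : (Fin n → K) → Fin n → K := fun z j => (ϖ : K) ^ (ordK ϖ (z0 j) - ordK ϖ (z j)) with hlam
  set v : (Fin n → K) → Fin n → K := fun z j => if j ∈ I then lam z j * z j else κ with hv
  have hlamnorm : ∀ z : Fin n → K, (∀ j ∈ I, z j ≠ 0) → ∀ j ∈ I, ‖lam z j‖ * ‖z j‖ = ‖z0 j‖ := by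
    intro z hz j hj
    simp only [hlam]
    rw [norm_zpow, norm_eq_zpow_ordK hϖ (hz j hj), norm_eq_zpow_ordK hϖ (hz0 j hj),
      ← zpow_add₀ hp.ne', sub_add_cancel]
  have hw : ∀ j, ∃ x, x ≠ 0 ∧ ‖x‖ < ε ∧ Tendsto (fun z => v z j) 𝒰 (𝓝 x) := by
    intro j
    by_cases hj : j ∈ I
    · have hmem : Metric.sphere (0 : K) ‖z0 j‖ ∈ 𝒰.map fun z => v z j := by
        change ∀ᶠ z in (𝒰 : Filter (Fin n → K)), v z j ∈ Metric.sphere (0 : K) ‖z0 j‖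
        filter_upwards [hnz] with z hz
        rw [mem_sphere_zero_iff_norm]
        simp only [hv]
        rw [if_pos hj, norm_mul, hlamnorm z hz j hj]
      obtain ⟨x, hx, hx'⟩ := (isCompact_sphere (0 : K) ‖z0 j‖).ultrafilter_le_nhds' _ hmem
      rw [mem_sphere_zero_iff_norm] at hx
      exact ⟨x, norm_pos_iff.1 (hx ▸ norm_pos_iff.2 (hz0 j hj)),
        hx ▸ (norm_le_pi_norm z0 j).trans_lt hz0ε, hx'⟩
    · refine ⟨κ, hκ0, hκ, ?_⟩
      simp only [hv, if_neg hj]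
      exact tendsto_const_nhds
  choose w hw0 hwε hwlim using hw
  have hvmono : ∀ z, ∀ b : Fin n →₀ ℕ, (∀ j ∉ I, b j = 0) →
      mono (v z) b = mono (lam z) b * mono z b := by
    intro z b hb
    rw [mono, mono, mono, ← Finset.prod_mul_distrib]
    refine Finset.prod_congr rfl fun j _ => ?_
    by_cases hj : j ∈ I
    · simp only [hv]; rw [if_pos hj, mul_pow]
    · rw [hb j hj]; simp
  have hlamzpow : ∀ z, ∀ b : Fin n →₀ ℕ, ∃ k : ℤ, mono (lam z) b = (ϖ : K) ^ k := by
    intro z b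
    refine ⟨∑ j, (ordK ϖ (z0 j) - ordK ϖ (z j)) * b j, ?_⟩
    have hzp : ∀ s : Finset (Fin n), ∀ e : Fin n → ℤ,
        (ϖ : K) ^ (∑ j ∈ s, e j) = ∏ j ∈ s, (ϖ : K) ^ e j := by
      intro s e
      induction s using Finset.cons_induction with
      | empty => simp
      | cons a s ha ih => rw [Finset.sum_cons, Finset.prod_cons, zpow_add₀ hϖ0, ih]
    rw [hzp]
    refine Finset.prod_congr rfl fun j _ => ?_
    simp only [hlam]
    rw [zpow_mul, zpow_natCast]
  have hlammono : ∀ z : Fin n → K, (∀ j ∈ I, z j ≠ 0) → ∀ b : Fin n →₀ ℕ, (∀ j ∉ I, b j = 0) →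
      ‖mono (lam z) b‖ * ‖mono z b‖ = ‖mono z0 b‖ := by
    intro z hz b hb
    rw [norm_mono, norm_mono, norm_mono, ← Finset.prod_mul_distrib]
    refine Finset.prod_congr rfl fun j _ => ?_
    by_cases hj : j ∈ I
    · rw [← mul_pow, hlamnorm z hz j hj]
    · rw [hb j hj]; simp
  have hvlim : Tendsto v 𝒰 (𝓝 w) := tendsto_pi_nhds.2 hwlim
  refine ⟨w, (pi_norm_lt_iff hε).2 hwε, hw0, fun i b hb hb0 => ?_, ?_⟩
  · have hbI := hBI i b hb
    have hmI := hBI i _ (hm0 i)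
    have hmw : mono w (m0 i) ≠ 0 := mono_ne_zero (I := Set.univ) (fun j _ => hw0 j) (by simp)
    have h1 : Tendsto (fun z => mono (v z) b / mono (v z) (m0 i)) 𝒰
        (𝓝 (mono w b / mono w (m0 i))) :=
      (((continuous_mono b).tendsto w).comp hvlim).div
        (((continuous_mono (m0 i)).tendsto w).comp hvlim) hmw
    have h2 : mono w b / mono w (m0 i) = ℓ i b := by
      refine tendsto_nhds_unique h1 ((hℓ i b hb).congr' ?_)
      filter_upwards [hnz, heq] with z hz hzeq
      have hzb := mono_ne_zero hz hbI
      have hzm := mono_ne_zero hz hmI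
      obtain ⟨k1, hk1⟩ := hlamzpow z b
      obtain ⟨k2, hk2⟩ := hlamzpow z (m0 i)
      have hn1 := hlammono z hz b hbI
      have hn2 := hlammono z hz (m0 i) hmI
      have hr : ‖mono z b‖ / ‖mono z (m0 i)‖ = ‖mono z0 b‖ / ‖mono z0 (m0 i)‖ := by
        rw [← norm_div, ← norm_div, hzeq i b hb hb0, hz0eq i b hb hb0]
      -- Both sides are powers of `ϖ`, so equal norms force equality: the rescaling leaves the
      -- ratios with nonzero limit unchanged.
      have hlameq : mono (lam z) b = mono (lam z) (m0 i) := by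
        have hnorm : ‖mono (lam z) b‖ = ‖mono (lam z) (m0 i)‖ := by
          have hA := norm_pos_iff.2 hzb
          have hA' := norm_pos_iff.2 hzm
          have hM : 0 < ‖mono (lam z) (m0 i)‖ := by
            rw [hk2, norm_zpow]; exact zpow_pos hp _
          rw [← hn1, ← hn2] at hr
          field_simp at hr
          linarith
        rw [hk1, hk2, norm_zpow, norm_zpow] at hnorm
        rw [hk1, hk2, zpow_right_injective₀ hp (norm_unif_lt_one hϖ).ne hnorm]
      have hlam0 : mono (lam z) (m0 i) ≠ 0 := by rw [hk2]; exact zpow_ne_zero _ hϖ0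
      rw [hvmono z b hbI, hvmono z _ hmI, hlameq, mul_div_mul_left _ _ hlam0]
    rw [← h2, div_mul_cancel₀ _ hmw]
  -- The weight measures the decay from `z0` to a deeper point `z1`, namely `β_j = log(‖z0 j‖ / ‖z1
  -- j‖)`. Then `⟨β, b - m0⟩` is the logarithmic decay of the ratio: zero if its limit is nonzero,
  -- positive otherwise. Coordinates outside `I` get the weight `L`, larger than that of every
  -- dominant monomial.
  · obtain ⟨z1, ⟨⟨hz1, hz1eq⟩, hz1lt⟩, hz1lt'⟩ := (((hnz.and heq).and hlt).and hlt').exists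
    set L : ℝ := 1 + ∑ i, |Real.log (‖mono z0 (m0 i)‖ / ‖mono z1 (m0 i)‖)| with hL
    have hL0 : 0 < L := by positivity
    set t : Fin n → ℝ := fun j => if j ∈ I then ‖z0 j‖ / ‖z1 j‖ else Real.exp L with ht
    have ht1 : ∀ j, 1 < t j := by
      intro j
      simp only [ht]
      split_ifs with hj
      · rw [one_lt_div (norm_pos_iff.2 (hz1 j hj))]; exact hz1lt' j hj
      · exact Real.one_lt_exp_iff.2 hL0
    have hβ : ∀ b : Fin n →₀ ℕ, (∀ j ∉ I, b j = 0) →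
        ∑ j, Real.log (t j) * (b j : ℝ) = Real.log (‖mono z0 b‖ / ‖mono z1 b‖) := by
      intro b hb
      rw [norm_mono, norm_mono, ← Finset.prod_div_distrib, Real.log_prod]
      · refine Finset.sum_congr rfl fun j _ => ?_
        rw [← div_pow, Real.log_pow, mul_comm]
        by_cases hj : j ∈ I
        · simp only [ht]; rw [if_pos hj]
        · rw [hb j hj]; simp
      · intro j _
        by_cases hj : j ∈ I
        · exact div_ne_zero (pow_ne_zero _ (norm_ne_zero_iff.2 (hz0 j hj)))
            (pow_ne_zero _ (norm_ne_zero_iff.2 (hz1 j hj)))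
        · rw [hb j hj]; simp
    have hpos : ∀ z : Fin n → K, (∀ j ∈ I, z j ≠ 0) → ∀ i, ∀ b ∈ B i, 0 < ‖mono z b‖ :=
      fun z hz i b hb => norm_pos_iff.2 (mono_ne_zero hz (hBI i b hb))
    refine ⟨fun j => Real.log (t j), fun j => Real.log_pos (ht1 j), fun i b hb hb0 => ?_,
      fun i b hb hb0 => ?_, fun i j hj => ?_⟩
    · rw [hβ b (hBI i b hb), hβ _ (hBI i _ (hm0 i))]
      congr 1
      have h0 := hz0eq i b hb hb0
      have h1 := hz1eq i b hb hb0
      rw [← h1, norm_div, norm_div] at h0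
      have a1 := hpos z0 hz0 i b hb
      have a2 := hpos z1 hz1 i b hb
      have a3 := hpos z0 hz0 i _ (hm0 i)
      have a4 := hpos z1 hz1 i _ (hm0 i)
      field_simp at h0 ⊢
      linarith
    · rw [hβ b (hBI i b hb), hβ _ (hBI i _ (hm0 i))]
      have h0 := hz1lt i b hb hb0
      rw [norm_div, norm_div] at h0
      have a1 := hpos z0 hz0 i b hb
      have a2 := hpos z1 hz1 i b hb
      have a3 := hpos z0 hz0 i _ (hm0 i)
      have a4 := hpos z1 hz1 i _ (hm0 i)
      refine Real.log_lt_log (by positivity) ?_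
      rw [div_lt_div_iff₀ a4 a3] at h0
      rw [div_lt_div_iff₀ a4 a2]
      linarith
    · rw [hβ _ (hBI i _ (hm0 i))]
      simp only [ht]
      rw [if_neg hj, Real.log_exp]
      have h1 := Finset.single_le_sum
        (f := fun i => |Real.log (‖mono z0 (m0 i)‖ / ‖mono z1 (m0 i)‖)|)
        (fun _ _ => abs_nonneg _) (Finset.mem_univ i)
      have h2 := le_abs_self (Real.log (‖mono z0 (m0 i)‖ / ‖mono z1 (m0 i)‖))
      beta_reduce at h1
      linarith

end UltrafilterLimits

/-! ### Non-degeneracy on faces implies full rank near the origin. -/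

section NonDegeneracy

variable {K : Type*} [NontriviallyNormedField K] [IsPAdicField K] {n : ℕ}

lemma mul_mul_le_rank {l : ℕ} (u : Fin l → K) (J : Matrix (Fin l) (Fin n) K) (v : Fin n → K) :
    (Matrix.diagonal u * J * Matrix.diagonal v).rank ≤ J.rank :=
  (Matrix.rank_mul_le_left _ _).trans (Matrix.rank_mul_le_right _ _)

lemma rank_diagonal_mul_mul {l : ℕ} {u : Fin l → K} (hu : ∀ i, u i ≠ 0)
    (J : Matrix (Fin l) (Fin n) K) {v : Fin n → K} (hv : ∀ j, v j ≠ 0) :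
    (Matrix.diagonal u * J * Matrix.diagonal v).rank = J.rank := by
  rw [Matrix.rank_mul_eq_left_of_isUnit_det, Matrix.rank_mul_eq_right_of_isUnit_det]
  · rw [Matrix.det_diagonal, isUnit_iff_ne_zero]
    exact Finset.prod_ne_zero_iff.2 fun i _ => hu i
  · rw [Matrix.det_diagonal, isUnit_iff_ne_zero]
    exact Finset.prod_ne_zero_iff.2 fun i _ => hv i

/-- A non-degenerate convenient map has a Jacobian matrix of full rank at all its zeros near the
origin, except possibly the origin itself. -/
theorem eventually_rank_jacobian {ϖ : RK K} (hϖ : Irreducible ϖ) {l : ℕ}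
    {f : Fin l → MvPowerSeries (Fin n) K} {U : Set (Fin n → K)} (hU : U ∈ 𝓝 0) {ρ : ℝ} (hρ : 0 < ρ)
    (hbdd : ∀ i, ∃ C, BoundedOn (fun m => MvPowerSeries.coeff m (f i)) ρ C)
    (hconvenient : ∀ i, Convenient (f i)) (hnd : NonDegenerate f U) (hln : l ≤ n) :
    ∀ᶠ z in 𝓝 (0 : Fin n → K), z ≠ 0 → (∀ i, evalSeries (f i) z = 0) →
      (jacobian (evalMap f) z).rank = l := by
  classical
  by_contra hcon
  rw [Filter.not_eventually] at hcon
  have hneBot := frequently_iff_neBot.1 hcon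
  set 𝒰 : Ultrafilter (Fin n → K) := Ultrafilter.of
    (𝓝 0 ⊓ 𝓟 {z : Fin n → K | ¬(z ≠ 0 → (∀ i, evalSeries (f i) z = 0) →
      (jacobian (evalMap f) z).rank = l)}) with h𝒰def
  have h𝒰 : (𝒰 : Filter (Fin n → K)) ≤ 𝓝 0 := (Ultrafilter.of_le _).trans inf_le_left
  have hbad : ∀ᶠ z in (𝒰 : Filter (Fin n → K)), z ≠ 0 ∧ (∀ i, evalSeries (f i) z = 0) ∧
      (jacobian (evalMap f) z).rank ≠ l := by
    have h1 : (𝒰 : Filter (Fin n → K)) ≤ 𝓟 _ := (Ultrafilter.of_le _).trans inf_le_right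
    filter_upwards [le_principal_iff.1 h1] with z hz
    simpa only [Set.mem_ofPred_eq, Classical.not_imp] using hz
  have hsmall : ∀ δ > 0, ∀ᶠ z in (𝒰 : Filter (Fin n → K)), ‖z‖ < δ := fun δ hδ =>
    h𝒰 (by simpa [Metric.ball, dist_zero_right] using Metric.ball_mem_nhds (0 : Fin n → K) hδ)
  -- Along an ultrafilter each coordinate is either eventually nonzero or eventually zero, so the
  -- coordinate stratum is fixed.
  set I : Set (Fin n) := {j | ∀ᶠ z in (𝒰 : Filter (Fin n → K)), z j ≠ 0} with hIdef
  have hIc : ∀ᶠ z in (𝒰 : Filter (Fin n → K)), ∀ j ∉ I, z j = 0 := by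
    refine eventually_all.2 fun j => ?_
    by_cases hj : j ∈ I
    · exact Eventually.of_forall fun z h => absurd hj h
    · filter_upwards [Ultrafilter.eventually_not.2 hj] with z hz _
      exact not_not.1 hz
  have hIne : I.Nonempty := by
    by_contra hIe
    rw [Set.not_nonempty_iff_eq_empty] at hIe
    obtain ⟨z, hz1, hz2⟩ := (hIc.and hbad).exists
    exact hz2.1 (funext fun j => hz1 j (by rw [hIe]; simp))
  choose N hN using hconvenient
  choose C hC using hbdd
  -- The monomials able to compete: on the stratum, any other one is a proper multiple of a pure
  -- power `x_j^(N_j)` with `j ∈ I`, which convenience places in `B i`.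
  set B : Fin l → Finset (Fin n →₀ ℕ) := fun i =>
    (Set.finite_Iic (Finsupp.equivFunOnFinite.symm (N i))).toFinset.filter fun m =>
      MvPowerSeries.coeff m (f i) ≠ 0 ∧ ∀ j ∉ I, m j = 0 with hBdef
  have hB : ∀ i m, m ∈ B i ↔ (∀ j, m j ≤ N i j) ∧ MvPowerSeries.coeff m (f i) ≠ 0 ∧
      ∀ j ∉ I, m j = 0 := by
    intro i m
    simp only [hBdef, Finset.mem_filter, Set.Finite.mem_toFinset, Set.mem_Iic]
    exact Iff.rfl
  have hBI : ∀ i, ∀ b ∈ B i, ∀ j ∉ I, b j = 0 := fun i b hb => ((hB i b).1 hb).2.2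
  have hsingle : ∀ i, ∀ j ∈ I, Finsupp.single j (N i j) ∈ B i := by
    intro i j hj
    refine (hB i _).2 ⟨fun k => ?_, hN i j, fun k hk => ?_⟩
    · by_cases hkj : k = j
      · rw [hkj, Finsupp.single_eq_same]
      · rw [Finsupp.single_eq_of_ne hkj]; exact Nat.zero_le _
    · exact Finsupp.single_eq_of_ne fun h => hk (h ▸ hj)
  have hnz : ∀ᶠ z in (𝒰 : Filter (Fin n → K)), ∀ j ∈ I, z j ≠ 0 := by
    refine eventually_all.2 fun j => ?_
    by_cases hj : j ∈ I
    · exact (show ∀ᶠ z in (𝒰 : Filter (Fin n → K)), z j ≠ 0 from hj).mono fun z hz _ => hz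
    · exact Eventually.of_forall fun z h => absurd h hj
  have hBne : ∀ i, (B i).Nonempty := fun i => ⟨_, hsingle i _ hIne.some_mem⟩
  choose m0 hm0 ℓ hℓ1 hℓ using fun i => exists_dominant_monomial (hBne i)
    fun b hb => hnz.mono fun z hz => mono_ne_zero hz (hBI i b hb)
  have hbig : ∀ i m, MvPowerSeries.coeff m (f i) ≠ 0 → (∀ j ∉ I, m j = 0) → m ∉ B i →
      ∃ j ∈ I, N i j < m j := by
    intro i m hm hmI hmB
    by_contra! hle
    refine hmB ((hB i m).2 ⟨fun j => ?_, hm, hmI⟩)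
    by_cases hj : j ∈ I
    · exact hle j hj
    · rw [hmI j hj]; exact Nat.zero_le _
  -- The weights `wt = 1` give `f_i`, and `wt m = m_j` gives `x_j ∂f_i/∂x_j`.
  have hlim : ∀ i, ∀ wt : (Fin n →₀ ℕ) → K, (∀ m, ‖wt m‖ ≤ 1) →
      Tendsto (fun z => seriesSum (fun m => wt m * MvPowerSeries.coeff m (f i)) z / mono z (m0 i)) 𝒰
        (𝓝 (∑ b ∈ B i, wt b * MvPowerSeries.coeff b (f i) * ℓ i b)) := by
    intro i wt hwt
    set d : (Fin n →₀ ℕ) → K := fun m => wt m * MvPowerSeries.coeff m (f i) with hd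
    have hdb : BoundedOn d ρ (C i) := (hC i).mul hρ hwt
    have h1 : Tendsto (fun z : Fin n → K => ∑ b ∈ B i, d b * (mono z b / mono z (m0 i))) 𝒰
        (𝓝 (∑ b ∈ B i, d b * ℓ i b)) :=
      tendsto_finsetSum _ fun b hb => tendsto_const_nhds.mul (hℓ i b hb).2
    set D : ℝ := C i * (∑ j, (ρ ^ N i j)⁻¹) * ρ⁻¹ with hD
    have h2 : Tendsto (fun z : Fin n → K => (seriesSum d z - ∑ b ∈ B i, d b * mono z b) /
        mono z (m0 i)) 𝒰 (𝓝 0) := by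
      have hz0 : Tendsto (fun z : Fin n → K => D * ‖z‖) 𝒰 (𝓝 0) := by
        have : Tendsto (fun z : Fin n → K => D * ‖z‖) (𝓝 0) (𝓝 (D * ‖(0 : Fin n → K)‖)) :=
          (continuous_const.mul continuous_norm).tendsto 0
        rw [norm_zero, mul_zero] at this
        exact this.mono_left h𝒰
      have hdom : ∀ᶠ z in (𝒰 : Filter (Fin n → K)), ∀ j ∈ I,
          ‖mono z (Finsupp.single j (N i j))‖ ≤ ‖mono z (m0 i)‖ := by
        refine eventually_all.2 fun j => ?_
        by_cases hj : j ∈ I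
        · exact (hℓ i _ (hsingle i j hj)).1.mono fun z hz _ => hz
        · exact Eventually.of_forall fun z h => absurd h hj
      refine squeeze_zero_norm' ?_ hz0
      filter_upwards [hIc, hdom, hsmall ρ hρ, hnz] with z hz1 hz2 hz3 hz4
      have hpos := norm_pos_iff.2 (mono_ne_zero hz4 (hBI i _ (hm0 i)))
      rw [norm_div, div_le_iff₀ hpos]
      exact norm_seriesSum_sub_le hdb hρ hz3 hz1
        (fun m hm => hbig i m (right_ne_zero_of_mul hm)) hz2
    have h3 := h2.add h1
    rw [zero_add] at h3
    refine h3.congr fun z => ?_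
    rw [sub_div, Finset.sum_div]
    simp only [mul_div_assoc]
    ring
  obtain ⟨ε, hε, hεU⟩ := Metric.mem_nhds_iff.1 (inter_mem hU (Metric.ball_mem_nhds _ hρ))
  obtain ⟨w, hwε, hw0, hwℓ, β, hβ, hβ1, hβ2, hβ3⟩ := exists_point_and_weight hϖ h𝒰
    (I := I) (fun j hj => hj) hBI hm0 (fun i b hb => (hℓ i b hb).2) hε
  have hwmem := hεU (mem_ball_zero_iff.2 hwε)
  have hwρ : ‖w‖ < ρ := mem_ball_zero_iff.1 hwmem.2
  have hle : ∀ i, ∀ b ∈ B i, ∑ j, β j * (m0 i j : ℝ) ≤ ∑ j, β j * (b j : ℝ) := by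
    intro i b hb
    by_cases h : ℓ i b = 0
    · exact (hβ2 i b hb h).le
    · exact (hβ1 i b hb h).ge
  have hterm : ∀ (m : Fin n →₀ ℕ) (j : Fin n), β j * (m j : ℝ) ≤ ∑ j, β j * (m j : ℝ) :=
    fun m j => Finset.single_le_sum (f := fun j => β j * (m j : ℝ))
      (fun k _ => mul_nonneg (hβ k).le (Nat.cast_nonneg _)) (Finset.mem_univ j)
  -- Three reasons for a strictly larger weight: the ratio tends to zero, the monomial is a proper
  -- multiple of some `x_j^(N_j)` with `j ∈ I`, or it involves a coordinate outside `I`.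
  have hcmp : ∀ i m, MvPowerSeries.coeff m (f i) ≠ 0 → ¬(m ∈ B i ∧ ℓ i m ≠ 0) →
      ∑ j, β j * (m0 i j : ℝ) < ∑ j, β j * (m j : ℝ) := by
    intro i m hm hmS
    by_cases hmI : ∀ j ∉ I, m j = 0
    · by_cases hmB : m ∈ B i
      · exact hβ2 i m hmB (by_contra fun h => hmS ⟨hmB, h⟩)
      · obtain ⟨j, hj, hjN⟩ := hbig i m hm hmI hmB
        have h1 := hle i _ (hsingle i j hj)
        have h2 : ∑ k, β k * ((Finsupp.single j (N i j) k : ℕ) : ℝ) = β j * (N i j : ℝ) := by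
          rw [Finset.sum_eq_single j]
          · rw [Finsupp.single_eq_same]
          · intro k _ hk; rw [Finsupp.single_eq_of_ne hk]; simp
          · simp
        rw [h2] at h1
        have h3 : β j * (N i j : ℝ) < β j * (m j : ℝ) :=
          mul_lt_mul_of_pos_left (by exact_mod_cast hjN) (hβ j)
        exact h1.trans_lt (h3.trans_le (hterm m j))
    · push Not at hmI
      obtain ⟨j, hj, hmj⟩ := hmI
      refine (hβ3 i j hj).trans_le (le_trans ?_ (hterm m j))
      exact le_mul_of_one_le_right (hβ j).le (by exact_mod_cast Nat.one_le_iff_ne_zero.2 hmj)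
  have hface : ∀ i m, MvPowerSeries.coeff m (faceFunction (f i) β) =
      if m ∈ B i ∧ ℓ i m ≠ 0 then MvPowerSeries.coeff m (f i) else 0 := by
    intro i m
    change (if (fun i => (m i : ℝ)) ∈ firstMeetLocus β (newtonPolyhedron (f i))
      then MvPowerSeries.coeff m (f i) else 0) = _
    by_cases hm : MvPowerSeries.coeff m (f i) = 0
    · rw [hm]; simp
    · refine if_congr ?_ rfl rfl
      rw [mem_firstMeetLocus_iff hβ hm]
      constructor
      · intro h
        by_contra hmS
        have h1 := hcmp i m hm hmS
        have h2 := h (m0 i) ((hB i _).1 (hm0 i)).2.1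
        linarith
      · rintro ⟨hmB, hmℓ⟩ m' hm'
        rw [hβ1 i m hmB hmℓ]
        by_cases hmS : m' ∈ B i ∧ ℓ i m' ≠ 0
        · exact hle i m' hmS.1
        · exact (hcmp i m' hm' hmS).le
  -- The face for `β` consists exactly of the monomials whose ratio survives in the limit, and `w`
  -- realizes these ratios; so face values at `w` are the limits in `hlim` times a nonzero monomial.
  have hFsum : ∀ i, ∀ wt : (Fin n →₀ ℕ) → K,
      seriesSum (fun m => wt m * MvPowerSeries.coeff m (faceFunction (f i) β)) w =
        (∑ b ∈ B i, wt b * MvPowerSeries.coeff b (f i) * ℓ i b) * mono w (m0 i) := by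
    intro i wt
    rw [seriesSum_eq, tsum_eq_sum (s := B i), Finset.sum_mul]
    · refine Finset.sum_congr rfl fun b hb => ?_
      rw [hface]
      by_cases h : ℓ i b = 0
      · rw [if_neg fun h' => h'.2 h, h]; ring
      · rw [if_pos ⟨hb, h⟩, hwℓ i b hb h]; ring
    · intro b hb
      rw [hface, if_neg fun h' => hb h'.1]; ring
  have hFzero : ∀ i, evalSeries (faceFunction (f i) β) w = 0 := by
    intro i
    have h1 := hFsum i fun _ => 1
    have h2 := hlim i (fun _ => 1) (by simp)
    have h3 : ∑ b ∈ B i, (1 : K) * MvPowerSeries.coeff b (f i) * ℓ i b = 0 := by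
      refine tendsto_nhds_unique h2 (tendsto_const_nhds.congr' ?_)
      filter_upwards [hbad] with z hz
      simp only [one_mul]
      rw [← evalSeries_eq, hz.2.1 i, zero_div]
    simp only [one_mul] at h1 h3
    rw [evalSeries_eq, h1, h3, zero_mul]
  have hrank := hnd β hβ w hwmem.1 hw0 hFzero
  rw [min_eq_left hln] at hrank
  have hnat : ∀ (j : Fin n) (m : Fin n →₀ ℕ), ‖((m j : ℕ) : K)‖ ≤ 1 := fun j m =>
    IsUltrametricDist.norm_natCast_le_one K _
  -- Scaling rows by the inverse dominant monomials and columns by the coordinates gives the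
  -- normalized logarithmic derivatives, which converge to their counterparts `M0` at `w`.
  set M : (Fin n → K) → Matrix (Fin l) (Fin n) K := fun z =>
    Matrix.diagonal (fun i => (mono z (m0 i))⁻¹) * jacobian (evalMap f) z * Matrix.diagonal z with hM
  set M0 : Matrix (Fin l) (Fin n) K := Matrix.diagonal (fun i => (mono w (m0 i))⁻¹) *
    jacobian (fun i => evalSeries (faceFunction (f i) β)) w * Matrix.diagonal w with hM0
  have hmw : ∀ i, mono w (m0 i) ≠ 0 := fun i =>
    mono_ne_zero (I := Set.univ) (fun j _ => hw0 j) (by simp)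
  have hM0rank : M0.rank = l := by
    rw [hM0, rank_diagonal_mul_mul (fun i => inv_ne_zero (hmw i)) _ hw0, hrank]
  have hM0val : ∀ i j, M0 i j = ∑ b ∈ B i, ((b j : ℕ) : K) * MvPowerSeries.coeff b (f i) * ℓ i b := by
    intro i j
    have hFb : BoundedOn (fun m => MvPowerSeries.coeff m (faceFunction (f i) β)) ρ (C i) := by
      intro m
      refine le_trans ?_ (hC i m)
      beta_reduce
      rw [hface]
      gcongr
      split_ifs
      · exact le_rfl
      · rw [norm_zero]; exact norm_nonneg _
    have h1 := hFb.mul_fderiv_single hρ hwρ j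
    rw [hFsum i, ← evalSeries_eq] at h1
    rw [hM0, Matrix.mul_diagonal, Matrix.diagonal_mul, jacobian, Matrix.of_apply, mul_assoc,
      mul_comm _ (w j), h1]
    have := hmw i
    field_simp
  have hMlim : Tendsto (fun z => (M z).row) 𝒰 (𝓝 M0.row) := by
    refine tendsto_pi_nhds.2 fun i => tendsto_pi_nhds.2 fun j => ?_
    change Tendsto (fun z => M z i j) 𝒰 (𝓝 (M0 i j))
    rw [hM0val]
    refine (hlim i (fun m => ((m j : ℕ) : K)) (hnat j)).congr' ?_
    filter_upwards [hsmall ρ hρ] with z hz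
    rw [← (hC i).mul_fderiv_single hρ hz j, ← evalSeries_eq]
    simp only [hM]
    rw [Matrix.mul_diagonal, Matrix.diagonal_mul, jacobian, Matrix.of_apply]
    change _ = (mono z (m0 i))⁻¹ * fderiv K (evalSeries (f i)) z (Pi.single j 1) * z j
    ring
  have hli := hMlim.eventually
    (isOpen_setOfPred_linearIndependent.mem_nhds (linearIndependent_row_of_rank hM0rank))
  obtain ⟨z, hz1, hz2⟩ := (hli.and hbad).exists
  have hMrank : (M z).rank = l := by
    have := LinearIndependent.rank_matrix hz1
    rwa [Fintype.card_fin] at this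
  refine hz2.2.2 (le_antisymm ?_ ?_)
  · simpa using Matrix.rank_le_card_height (jacobian (evalMap f) z)
  -- Some `z j` may vanish, so the scaling need not preserve the rank; but it can only lower it,
  -- which is the direction needed.
  · exact hMrank.ge.trans (mul_mul_le_rank _ _ _)

end NonDegeneracy

end LocalZeta

/-! ### Application to the Gel'fand-Leray measure. -/

theorem proposition3 {K : Type*} [NontriviallyNormedField K] [IsPAdicField K]
    [MeasurableSpace K] [BorelSpace K]
    (ϖ : RK K) (hϖ : Irreducible ϖ)
    (Ψ : AddChar K Circle) (hΨ : IsStandardAddChar ϖ Ψ)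
    -- there are `l = r + 1` functions, and `2 ≤ l ≤ n`
    (n r : ℕ) (hr : 2 ≤ r + 1) (hrn : r + 1 ≤ n)
    (U : Set (Fin n → K)) (hU : IsOpen U) (h0U : 0 ∈ U)
    (f : Fin (r + 1) → MvPowerSeries (Fin n) K)
    (hconv : ∀ i, ConvergesOn (f i) U)
    (hf0 : ∀ i, MvPowerSeries.coeff 0 (f i) = 0)
    (hconvenient : ∀ i, Convenient (f i))
    (hnd : NonDegenerate f U)
    (hnd' : NonDegenerate (butLast f) U) :
    -- all sufficiently small open neighbourhoods `W` of the origin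
    ∃ U₀ ∈ 𝓝 (0 : Fin n → K), U₀ ⊆ U ∧ ∀ W : Set (Fin n → K), IsOpen W → 0 ∈ W → W ⊆ U₀ →
      -- `V^(l-1)` is a closed submanifold of `W`
      (∀ z ∈ zeroSet W (evalMap (butLast f)), (jacobian (evalMap (butLast f)) z).rank = r) →
      -- `df_1 ∧ … ∧ df_l` does not vanish on `V^(l,c)`, for any `c ≠ 0`
      (∀ c : K, c ≠ 0 → ∀ z ∈ zeroSet W (evalMap (butLast f)), lastFun f z = c →
        (jacobian (evalMap f) z).rank = r + 1) →
      ∀ Φ : (Fin n → K) → ℂ, IsBruhatSchwartz Φ → Function.support Φ ⊆ W →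
        -- the integrals converge, also at `s = 0`
        (∀ (χ : UnitChar K) (s : ℂ), 0 ≤ s.re →
          Integrable (fun x => Φ x * quasiChar ϖ χ s (lastFun f x)) (glMeasure ϖ W f)) ∧
        (∀ z : K, Integrable (fun x => Φ x * (Ψ (z * lastFun f x) : ℂ)) (glMeasure ϖ W f)) ∧
        -- `Z_Φ(0, χ_triv)` is the boundary value of `Z_Φ(s, χ_triv)`, `Re s > 0`
        Tendsto (zetaInt ϖ W f Φ 1) (𝓝[{s : ℂ | 0 < s.re}] 0) (𝓝 (zetaInt ϖ W f Φ 1 0)) ∧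
        -- the expansions in powers of `t = q ^ (-s)` exist
        (∀ χ : UnitChar K, ∃ c, HasExpansion (resCard K) (zetaInt ϖ W f Φ χ) c) ∧
        (∃ c, HasExpansion (resCard K) (trivTerm (resCard K) (zetaInt ϖ W f Φ 1)) c) ∧
        ∀ (u : (RK K)ˣ) (m : ℤ),
          -- the sum over the nontrivial characters is finite
          {χ : UnitChar K | χ ≠ 1 ∧ gaussianSum ϖ Ψ χ⁻¹ * (χ u : ℂ) *
            coeffT (resCard K) (zetaInt ϖ W f Φ χ) (m - charConductor χ) ≠ 0}.Finite ∧
          oscInt ϖ Ψ W f Φ (((u : RK K) : K) * (ϖ : K) ^ (-m)) =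
            zetaInt ϖ W f Φ 1 0 +
            coeffT (resCard K) (trivTerm (resCard K) (zetaInt ϖ W f Φ 1)) (m - 1) +
            ∑ᶠ (χ : UnitChar K) (_ : χ ≠ 1), gaussianSum ϖ Ψ χ⁻¹ * (χ u : ℂ) *
              coeffT (resCard K) (zetaInt ϖ W f Φ χ) (m - charConductor χ) := by
  obtain ⟨ε, hε, hεU⟩ := Metric.isOpen_iff.1 hU 0 h0U
  -- Convergence at the single point with all coordinates `a` controls the series on the polydisc of
  -- radius `‖a‖`.
  obtain ⟨a, ha0, haε⟩ := NormedField.exists_norm_lt K hε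
  have haU : (fun _ => a : Fin n → K) ∈ U := by
    refine hεU ?_
    rw [mem_ball_zero_iff, pi_norm_lt_iff hε]
    exact fun _ => haε
  have hbdd := fun i => (hconv i).boundedOn haU
  refine ⟨U ∩ Metric.ball 0 ‖a‖ ∩ {z | z ≠ 0 → (∀ i, evalSeries (f i) z = 0) →
      (jacobian (evalMap f) z).rank = r + 1},
    inter_mem (inter_mem (hU.mem_nhds h0U) (Metric.ball_mem_nhds 0 ha0))
      (eventually_rank_jacobian hϖ (hU.mem_nhds h0U) ha0 hbdd hconvenient hnd hrn),
    fun z hz => hz.1.1, fun W hW _ hWU hsub _ Φ hΦ hΦW => ?_⟩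
  have hG : ∀ x ∈ W, ∀ i, HasStrictFDerivAt (evalMap f i) (fderiv K (evalMap f i) x) x := by
    intro x hx i
    obtain ⟨C, hC⟩ := hbdd i
    have := hC.hasStrictFDerivAt_fderiv ha0 (x := x) (by simpa using (hWU hx).1.2)
    rwa [← evalSeries_eq] at this
  have hSclopen : IsClopen (Function.support Φ) := by
    have := hΦ.1.isClopen_fiber 0
    simpa [Function.support, Set.compl_def] using this.compl
  have hScompact : IsCompact (Function.support Φ) := by
    have := hΦ.2
    rwa [HasCompactSupport, tsupport, hSclopen.isClosed.closure_eq] at this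
  obtain ⟨hfin, hnull⟩ := gelfandLeray_compact hϖ hW hG hrn hsub
    (fun x hx hx0 hx1 => (hWU hx).2 hx0 hx1) hScompact hΦW
  have hfinmeas : glMeasure ϖ W f (Function.support Φ) < ⊤ := hfin
  have hΦint : Integrable Φ (glMeasure ϖ W f) := by
    rw [← integrableOn_iff_integrable_of_support_subset subset_rfl]
    obtain ⟨C, hC⟩ := hScompact.exists_bound_of_continuousOn hΦ.1.continuous.continuousOn
    exact Measure.integrableOn_of_bounded hfinmeas.ne
      hΦ.1.continuous.measurable.aestronglyMeasurable
      (ae_restrict_of_forall_mem hSclopen.isClosed.measurableSet hC)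
  have hcont : ContinuousOn (lastFun f) (Function.support Φ) := fun x hx =>
    (hG x (hΦW hx) (Fin.last r)).hasFDerivAt.continuousAt.continuousWithinAt
  -- Outside `W` nothing is known about the sum of `f_l`. Cutting it off at the clopen support of
  -- `Φ` gives a continuous function and changes no integrand.
  set h : (Fin n → K) → K := (Function.support Φ).indicator (lastFun f) with hh
  have hhmeas : Measurable h := by
    classical
    refine Continuous.measurable ?_
    rw [hh, ← Set.piecewise_eq_indicator]
    refine continuous_piecewise (by simp [hSclopen.frontier_eq]) ?_ continuousOn_const
    rwa [hSclopen.isClosed.closure_eq]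
  have hmul (F : K → ℂ) : (fun x => Φ x * F (lastFun f x)) = fun x => Φ x * F (h x) := by
    funext x
    by_cases hx : Φ x = 0
    · simp [hx]
    · rw [hh, Set.indicator_of_mem (Function.mem_support.2 hx)]
  -- The function `f_l` is bounded on the compact support of `Φ`, though not necessarily by `1`;
  -- this is why negative powers of `t` can occur.
  obtain ⟨M, hM⟩ : ∃ M : ℕ, ∀ x, h x ≠ 0 → -(M : ℤ) ≤ ordK ϖ (h x) := by
    obtain ⟨C, hC⟩ := hScompact.exists_bound_of_continuousOn hcont
    have hpos := norm_unif_pos hϖ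
    obtain ⟨M, hM⟩ := pow_unbounded_of_one_lt C ((one_lt_inv₀ hpos).2 (norm_unif_lt_one hϖ))
    refine ⟨M, fun x hx => ?_⟩
    rw [← norm_le_zpow_iff hϖ hx, zpow_neg, zpow_natCast, ← inv_pow]
    have hxS : x ∈ Function.support Φ := Set.mem_of_indicator_ne_zero hx
    rw [hh, Set.indicator_of_mem hxS]
    exact (hC x hxS).trans hM.le
  have h0 : ∀ᵐ x ∂(glMeasure ϖ W f), h x = 0 → Φ x = 0 := by
    rw [ae_iff]
    refine measure_mono_null (fun x hx => ?_) hnull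
    obtain ⟨hx1, hx2⟩ := Classical.not_imp.1 hx
    rw [hh, Set.indicator_of_mem (Function.mem_support.2 hx2)] at hx1
    exact ⟨hx2, hx1⟩
  have hZ : zetaInt ϖ W f Φ =
      fun χ s => ∫ x, Φ x * quasiChar ϖ χ s (h x) ∂(glMeasure ϖ W f) := by
    funext χ s
    exact congrArg (fun g => ∫ x, g x ∂(glMeasure ϖ W f)) (hmul (quasiChar ϖ χ s))
  obtain ⟨htriv, hmain⟩ := integral_addChar_eq hϖ hΨ hΦint hhmeas hM h0 hZ
  refine ⟨fun χ s hs => ?_, fun z => ?_, ?_, fun χ => ?_, htriv, fun u m => ⟨(hmain u m).1, ?_⟩⟩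
  · rw [hmul (quasiChar ϖ χ s)]
    exact integrable_mul_quasiChar hϖ hΦint hhmeas hM χ hs
  · rw [hmul fun y => (Ψ (z * y) : ℂ)]
    exact integrable_mul_addChar hΨ hΦint hhmeas z
  · rw [hZ]
    exact tendsto_integral_quasiChar hϖ hΦint hhmeas hM 1
  · rw [hZ]
    exact ⟨_, hasExpansion_integral hϖ hΦint hhmeas hM χ⟩
  · rw [← (hmain u m).2, oscInt, hmul fun y => (Ψ (((u : RK K) : K) * (ϖ : K) ^ (-m) * y) : ℂ)]
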